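/- Let $n,d\ge 1$ and $p\ge 0$ be integers, let $X$ be an $n\times p$ real matrix with $i$th row $x_i^T$, let $y$ be an $n\times d$ real matrix with $i$th row $y_i^T$, and let $a\in\mathbb R$. Assume (N1) the $n\times(p+d)$ matrix $(X:y)$ has rank $p+d$, and (N2) $n>p+2d-2a$. Let $h$ be a mixing density, i.e. a probability density on $(0,\infty)$, that satisfies condition $\mathcal M$: $\int_0^\infty u^{d/2}h(u)\,du<\infty$. For a $p\times d$ matrix $\beta$ and a positive definite $d\times d$ matrix $\Sigma$, put $r_i(\beta,\Sigma)=(y_i-\beta^Tx_i)^T\Sigma^{-1}(y_i-\beta^Tx_i)$ and $$f(y\mid\beta,\Sigma)=\prod_{i=1}^n\int_0^\infty \frac{u^{d/2}}{(2\pi)^{d/2}|\Sigma|^{1/2}}\,e^{-u\,r_i(\beta,\Sigma)/2}\,h(u)\,du ,$$ let $\omega(\beta,\Sigma)=|\Sigma|^{-a}$ be the improper prior density with respect to Lebesgue measure $d\beta\,d\Sigma$ on the space $\mathsf X$ of all such pairs ($\Sigma$ being identified with its $d(d+1)/2$ entries on and above the diagonal), and let $m(y)=\int_{\mathsf X} f(y\mid\beta,\Sigma)\,\omega(\beta,\Sigma)\,d\beta\,d\Sigma$.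 The posterior is proper if $m(y)<\infty$; its density is then $\pi^*=f\omega/m(y)$. For $z\in(0,\infty)^n$ let $$\pi(\beta,\Sigma,z\mid y)=\Big[\prod_{i=1}^n \frac{z_i^{d/2}}{(2\pi)^{d/2}|\Sigma|^{1/2}}\,e^{-z_i r_i(\beta,\Sigma)/2}\,h(z_i)\Big]\omega(\beta,\Sigma),$$ let $\pi(\beta,\Sigma\mid z,y)$ be the corresponding conditional density of $(\beta,\Sigma)$ given $z$, and let $\pi(z\mid\beta,\Sigma,y)=\prod_{i=1}^n\psi(z_i;r_i(\beta,\Sigma))$, where, for $s\ge0$, $\psi(\cdot\,;s)$ is the probability density on $(0,\infty)$ proportional to $u^{d/2}e^{-su/2}h(u)$. The data augmentation (DA) chain is the Markov chain on $\mathsf X$ with transition density $$k(\beta,\Sigma\mid\tilde\beta,\tilde\Sigma)=\int_{(0,\infty)^n}\pi(\beta,\Sigma\mid z,y)\,\pi(z\mid\tilde\beta,\tilde\Sigma,y)\,dz ,$$ and $k^m$ denotes its $m$-step transition density. When the posterior is proper, the chain is called geometrically ergodic if there are $M:\mathsf X\to[0,\infty)$ and $\rho\in[0,1)$ such that, for all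 $m\ge1$ and all $(\tilde\beta,\tilde\Sigma)\in\mathsf X$, $$\int_{\mathsf X}\big|k^m(\beta,\Sigma\mid\tilde\beta,\tilde\Sigma)-\pi^*(\beta,\Sigma\mid y)\big|\,d\beta\,d\Sigma\le M(\tilde\beta,\tilde\Sigma)\,\rho^m .$$ Suppose that there exist $\lambda\in\big[0,\tfrac1{n-p+2a-1}\big)$ and $L\in\mathbb R$ such that, for every $s\ge0$, $$\frac{\int_0^\infty u^{(d-2)/2}e^{-su/2}h(u)\,du}{\int_0^\infty u^{d/2}e^{-su/2}h(u)\,du}\le\lambda s+L .$$ Then the posterior is proper and the DA chain is geometrically ergodic. -/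

import Mathlib

open MeasureTheory
open scoped ENNReal NNReal Matrix

noncomputable section

namespace MixtureRegression

/-- A mixing density: the Lebesgue density on `(0, ∞)` of a positive random variable
(values of `h` outside `(0, ∞)` play no role). -/
structure IsMixingDensity (h : ℝ → ℝ) : Prop where
  measurable : Measurable h
  nonneg : ∀ u, 0 < u → 0 ≤ h u
  lintegral_eq_one : ∫⁻ u in Set.Ioi (0 : ℝ), ENNReal.ofReal (h u) = 1

/-- The integral `∫₀^∞ u ^ c * exp (-s u / 2) * h u du`, as an element of `[0, ∞]`. -/
def mixIntegral (h : ℝ → ℝ) (c s : ℝ) : ℝ≥0∞ :=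
  ∫⁻ u in Set.Ioi (0 : ℝ), ENNReal.ofReal (u ^ c * Real.exp (-(s * u / 2)) * h u)

/-- The moment condition `∫₀^∞ u ^ (d / 2) * h u du < ∞`. -/
def ConditionM (d : ℕ) (h : ℝ → ℝ) : Prop :=
  ∫⁻ u in Set.Ioi (0 : ℝ), ENNReal.ofReal (u ^ ((d : ℝ) / 2) * h u) < ∞

/-- Coordinates of symmetric `d × d` matrices: the `d (d + 1) / 2` entries on and above the
diagonal. The `volume` on this space is Lebesgue measure. -/
abbrev SymCoord (d : ℕ) : Type := {q : Fin d × Fin d // q.1 ≤ q.2} → ℝ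

/-- The symmetric matrix with given entries on and above the diagonal. -/
def symMatrix {d : ℕ} (v : SymCoord d) : Matrix (Fin d) (Fin d) ℝ :=
  Matrix.of fun i j => v ⟨(min i j, max i j), min_le_max⟩

/-- Pairs `(β, Σ)`: a `p × d` matrix `β`, and a symmetric `d × d` matrix `Σ` in coordinates.
The `volume` on this space is `dβ dΣ`. -/
abbrev Param (p d : ℕ) : Type := (Fin p → Fin d → ℝ) × SymCoord d

/-- The matrix `β` of regression coefficients. -/
def Param.coeff {p d : ℕ} (θ : Param p d) : Matrix (Fin p) (Fin d) ℝ := Matrix.of θ.1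

/-- The scale matrix `Σ`. -/
def Param.scale {p d : ℕ} (θ : Param p d) : Matrix (Fin d) (Fin d) ℝ := symMatrix θ.2

/-- The state space: pairs `(β, Σ)` with `Σ` positive definite. -/
def stateSpace (p d : ℕ) : Set (Param p d) := {θ | θ.scale.PosDef}

section Model

variable {n p d : ℕ} (X : Matrix (Fin n) (Fin p) ℝ) (y : Matrix (Fin n) (Fin d) ℝ)
  (a : ℝ) (h : ℝ → ℝ)

/-- The residual `y_i - βᵀ x_i`, where `y_i`, `x_i` are the `i`-th rows of `y`, `X`. -/
def resid (θ : Param p d) (i : Fin n) : Fin d → ℝ := y i - θ.coeffᵀ *ᵥ X i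

/-- `r_i = (y_i - βᵀ x_i)ᵀ Σ⁻¹ (y_i - βᵀ x_i)`. -/
def quadForm (θ : Param p d) (i : Fin n) : ℝ :=
  resid X y θ i ⬝ᵥ (θ.scale⁻¹ *ᵥ resid X y θ i)

open Classical in
/-- The improper prior density `|Σ| ^ (-a)` on positive definite `Σ`, and `0` elsewhere. -/
def prior (θ : Param p d) : ℝ≥0∞ :=
  if θ ∈ stateSpace p d then ENNReal.ofReal (θ.scale.det ^ (-a)) else 0

/-- The joint density of `(Y_i, Z_i)` at `(y_i, u)` given `(β, Σ)`, where
`Z_i ∼ h` and `Y_i ∣ Z_i = u ∼ N_d (βᵀ x_i, Σ / u)`. -/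
def obsDensity (θ : Param p d) (i : Fin n) (u : ℝ) : ℝ≥0∞ :=
  ENNReal.ofReal
    (u ^ ((d : ℝ) / 2) / ((2 * Real.pi) ^ ((d : ℝ) / 2) * θ.scale.det ^ ((1 : ℝ) / 2))
      * Real.exp (-(u / 2) * quadForm X y θ i) * h u)

/-- The density `f (y ∣ β, Σ)` of the data. -/
def likelihood (θ : Param p d) : ℝ≥0∞ :=
  ∏ i, ∫⁻ u in Set.Ioi (0 : ℝ), obsDensity X y h θ i u

/-- `m (y)`, the integral of likelihood times prior. -/
def marginal : ℝ≥0∞ := ∫⁻ θ : Param p d, likelihood X y h θ * prior a θ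

/-- The posterior is proper when `m (y) < ∞`. -/
def PosteriorProper : Prop := marginal X y a h < ∞

/-- The posterior density `π* (β, Σ ∣ y)`. -/
def posterior (θ : Param p d) : ℝ≥0∞ := likelihood X y h θ * prior a θ / marginal X y a h

/-- The positive orthant, in which the latent vector `z` lives. -/
def posOrthant (n : ℕ) : Set (Fin n → ℝ) := {z | ∀ i, 0 < z i}

/-- The (possibly improper) joint density `π (β, Σ, z ∣ y)` of parameters and latent data. -/
def completeDensity (θ : Param p d) (z : Fin n → ℝ) : ℝ≥0∞ :=
  (∏ i, obsDensity X y h θ i (z i)) * prior a θ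

/-- The conditional density `π (β, Σ ∣ z, y)`. -/
def condParam (θ : Param p d) (z : Fin n → ℝ) : ℝ≥0∞ :=
  completeDensity X y a h θ z / ∫⁻ θ' : Param p d, completeDensity X y a h θ' z

/-- The density `ψ (u; s) = b (s) u ^ (d / 2) exp (-s u / 2) h u`. -/
def psi (d : ℕ) (h : ℝ → ℝ) (s u : ℝ) : ℝ≥0∞ :=
  ENNReal.ofReal (u ^ ((d : ℝ) / 2) * Real.exp (-(s * u / 2)) * h u)
    / mixIntegral h ((d : ℝ) / 2) s

/-- The conditional density `π (z ∣ β, Σ, y) = ∏ ψ (z_i; r_i)`. -/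
def condLatent (θ : Param p d) (z : Fin n → ℝ) : ℝ≥0∞ :=
  ∏ i, psi d h (quadForm X y θ i) (z i)

/-- The transition density `k (θ ∣ θ₀)` of the data augmentation chain: draw `z` given `θ₀`,
then `θ` given `z`. -/
def transDensity (θ θ₀ : Param p d) : ℝ≥0∞ :=
  ∫⁻ z in posOrthant n, condParam X y a h θ z * condLatent X y h θ₀ z

/-- `iterDensity X y a h m θ θ₀` is the `(m + 1)`-step transition density of the chain
from `θ₀` to `θ`. -/
def iterDensity : ℕ → Param p d → Param p d → ℝ≥0∞
  | 0 => transDensity X y a h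
  | m + 1 => fun θ θ₀ => ∫⁻ θ', transDensity X y a h θ θ' * iterDensity m θ' θ₀

/-- Geometric ergodicity: for all `m ≥ 1` and all initial states `θ₀`, the `L¹` distance
`∫ |k^m (θ ∣ θ₀) - π* (θ ∣ y)| dθ` is at most `M θ₀ * ρ ^ m`.
In `[0, ∞]`, where subtraction is truncated, `(s - t) + (t - s)` is `|s - t|`. -/
def GeometricallyErgodic : Prop :=
  ∃ (M : Param p d → ℝ≥0) (ρ : ℝ≥0), ρ < 1 ∧
    ∀ m : ℕ, ∀ θ₀ ∈ stateSpace p d,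
      ∫⁻ θ, ((iterDensity X y a h m θ θ₀ - posterior X y a h θ)
          + (posterior X y a h θ - iterDensity X y a h m θ θ₀))
        ≤ (M θ₀ : ℝ≥0∞) * (ρ : ℝ≥0∞) ^ (m + 1)

end Model

end MixtureRegression

end

/-!
Both claims follow from a drift condition and a minorization for the function
`V (β, Σ) = ∑ i, r_i (β, Σ)`.

*Drift.* Up to a factor depending only on `z`, the density of `(β, Σ)` given `z` is
`|Σ| ^ (-(n / 2 + a)) exp (-∑ z_i r_i / 2)`. A Gaussian integral over `β` and an inverse Wishart
integral over `Σ` evaluate its integral `J z` as a constant times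
`|Xᵀ D X| ^ (-d / 2) |S| ^ (-(n - p + 2 a - d - 1) / 2)`, where `D = diag z` and `S` is the
weighted residual cross-product matrix (`exists_paramIntegral_eq`); the inverse Wishart integral is
computed by induction on `d`, splitting off the first row of `Σ`. Since `|Xᵀ D X| |S|` is the Gram
determinant of `(X : y)` and the leverage of a single observation is at most one, multiplying `z_i`
by `1 + s` multiplies `|Xᵀ D X|` by a factor in `[1, 1 + s]` and `|S|` by at most `1 + s`; it
decreases `J` at most by the factor `(1 + s) ^ ((n - p + 2 a - 1) / 2)`
(`le_paramIntegral_update`). Differentiating at `s = 0` gives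
`E (r_i ∣ z) ≤ (n - p + 2 a - 1) / z_i` (`lintegral_paramKernel_mul_quadForm_le`). The mean of
`1 / z_i` given `(β, Σ)` is the ratio of mixing integrals in the hypothesis, hence at most
`lam * r_i + L`, and one step of the chain takes `V` to at most
`(n - p + 2 a - 1) (lam * V + n L)`, up to replacing `L` by its positive part.

*Minorization.* On `V ≤ R` every `r_i` lies in `[0, R]`, so the density of `z` is at least a fixed
product function of positive mass, and so is, after the draw of `(β, Σ)` given `z`, the transition
density.

*Propriety.* The unnormalized posterior is invariant whether or not it is integrable, and it is
integrable over the sets `V ≤ R`. By the drift condition the chain is eventually in one such set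
with probability at least one half, and Fatou's lemma bounds the total mass
(`lintegral_ne_top_of_drift`).

*Geometric ergodicity.* This is Harris' theorem (`exists_geometric_rate`), proved by the argument
of Hairer and Mattingly: for small `β` the transition kernel is a strict contraction for the `L¹`
distance with weight `1 + β V`.

All integrals are taken in `[0, ∞]`, and `|s - t|` is written `(s - t) + (t - s)` there. Points
outside the state space, where `Σ` is not positive definite, are given `V = ∞`.
-/

namespace MixtureRegression

/-! ### Harris' theorem for transition densities -/

section Harris

variable {Ω : Type*} [MeasurableSpace Ω] {ρ : Measure Ω}

/-- The choice of constants in the Hairer–Mattingly contraction argument. Here `v` stands for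
`V x + V y`. If `v ≤ R`, the minorization removes `2 e` from the total mass, and `β` is so small
that the drift constant costs at most half of that; if `R ≤ v`, the drift alone decreases
`2 + β v` by a fixed factor. -/
lemma exists_contraction_constants {γ K e R : ℝ} (hγ1 : γ < 1) (hK : 0 ≤ K)
    (he0 : 0 < e) (he1 : e ≤ 1) (hR : R = 8 * K / (1 - γ) + 1) :
    ∃ α β : ℝ, 0 < α ∧ α < 1 ∧ 0 < β ∧ ∀ v : ℝ, 0 ≤ v →
      (v ≤ R → 2 * (1 - e) + β * (γ * v + 2 * K) ≤ α * (2 + β * v)) ∧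
      (R ≤ v → 2 + β * (γ * v + 2 * K) ≤ α * (2 + β * v)) := by
  have h1γ : 0 < 1 - γ := by linarith
  have hR0 : 0 < R := by rw [hR]; positivity
  obtain ⟨β, hβ⟩ : ∃ β, β = e / (2 * (K + 1)) := ⟨_, rfl⟩
  have hβ0 : 0 < β := by rw [hβ]; positivity
  have hβK : β * K ≤ e / 2 := by
    have : β * (K + 1) = e / 2 := by rw [hβ]; field_simp
    nlinarith
  obtain ⟨δ, hδ⟩ : ∃ δ, δ = 3 / 4 * (1 - γ) * (β * R) / (2 + β * R) := ⟨_, rfl⟩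
  have hδ0 : 0 < δ := by rw [hδ]; positivity
  have hδR : δ * (2 + β * R) = 3 / 4 * (1 - γ) * (β * R) := by rw [hδ]; field_simp
  refine ⟨max (max (1 - e / 2) γ) (1 - δ), β, ?_, ?_, hβ0, fun v hv => ⟨fun _ => ?_, fun hv' => ?_⟩⟩
  · exact lt_max_of_lt_left (lt_max_of_lt_left (by linarith))
  · exact max_lt (max_lt (by linarith) hγ1) (by linarith)
  · obtain ⟨α, hα⟩ : ∃ α, α = max (max (1 - e / 2) γ) (1 - δ) := ⟨_, rfl⟩
    rw [← hα]
    have h1 : 1 - e / 2 ≤ α := by rw [hα]; exact le_max_of_le_left (le_max_left _ _)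
    have h2 : γ ≤ α := by rw [hα]; exact le_max_of_le_left (le_max_right _ _)
    have h3 : γ * (β * v) ≤ α * (β * v) := by gcongr
    nlinarith
  · obtain ⟨α, hα⟩ : ∃ α, α = max (max (1 - e / 2) γ) (1 - δ) := ⟨_, rfl⟩
    rw [← hα]
    have h1 : 1 - δ ≤ α := by rw [hα]; exact le_max_right _ _
    have hδ1 : δ ≤ 3 / 4 * (1 - γ) := by
      rw [hδ, div_le_iff₀ (by positivity)]
      have : 0 ≤ (1 - γ) := h1γ.le
      nlinarith
    have h2 : (1 - δ) * (2 + β * v) ≤ α * (2 + β * v) := by gcongr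
    have h8 : 8 * K ≤ (1 - γ) * R := by
      rw [hR, mul_add, mul_div_cancel₀ _ h1γ.ne']; linarith
    have h4 : 8 * K ≤ (1 - γ) * v := h8.trans (by gcongr)
    have h5 : β * (8 * K) ≤ β * ((1 - γ) * v) := by gcongr
    have h6 : δ * (2 + β * v) ≤ 3 / 4 * (1 - γ) * (β * v) := by
      have : δ * (β * (v - R)) ≤ 3 / 4 * (1 - γ) * (β * (v - R)) := by
        have : 0 ≤ β * (v - R) := mul_nonneg hβ0.le (by linarith)
        gcongr
      nlinarith
    nlinarith

variable {k : Ω → Ω → ℝ≥0∞} {V : Ω → ℝ≥0∞}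

/-- The Hairer–Mattingly estimate: a drift condition and a minorization on the sublevel sets of
`V` make the transition densities from any two points closer, in the weighted `L¹` distance with
weight `1 + β V`, than the two point masses are. -/
lemma exists_weighted_dist_le (hk : Measurable fun q : Ω × Ω => k q.1 q.2) (hV : Measurable V)
    {γ K : ℝ≥0} (hγ : γ < 1)
    (hmass : ∀ x, V x ≠ ∞ → ∫⁻ θ, k θ x ∂ρ = 1)
    (hdrift : ∀ x, ∫⁻ θ, V θ * k θ x ∂ρ ≤ γ * V x + K)
    (hmin : ∀ R : ℝ≥0, ∃ ν : Ω → ℝ≥0∞, Measurable ν ∧ ∫⁻ θ, ν θ ∂ρ ≠ 0 ∧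
      ∀ x, V x ≤ R → ∀ θ, ν θ ≤ k θ x) :
    ∃ α β : ℝ≥0, 0 < α ∧ α < 1 ∧ 0 < β ∧ ∀ x y,
      ∫⁻ θ, (1 + β * V θ) * ((k θ x - k θ y) + (k θ y - k θ x)) ∂ρ
        ≤ α * ((1 + β * V x) + (1 + β * V y)) := by
  have hγ' : (γ : ℝ) < 1 := by exact_mod_cast hγ
  obtain ⟨R, hR⟩ : ∃ R : ℝ, R = 8 * (K : ℝ) / (1 - γ) + 1 := ⟨_, rfl⟩
  have hR0 : 0 ≤ R := by
    rw [hR]; have : 0 < 1 - (γ : ℝ) := by linarith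
    positivity
  lift R to ℝ≥0 using hR0
  obtain ⟨ν, hν, hν0, hνk⟩ := hmin R
  obtain ⟨e, he⟩ : ∃ e : ℝ≥0, (e : ℝ≥0∞) = min (∫⁻ θ, ν θ ∂ρ) 1 :=
    ⟨_, ENNReal.coe_toNNReal (by simp)⟩
  have he0 : 0 < e := by
    have : (0 : ℝ≥0∞) < e := by rw [he]; exact lt_min (pos_iff_ne_zero.mpr hν0) one_pos
    exact_mod_cast this
  have he1 : e ≤ 1 := by
    have : (e : ℝ≥0∞) ≤ 1 := by rw [he]; exact min_le_right _ _
    exact_mod_cast this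
  obtain ⟨α, β, hα0, hα1, hβ0, hαβ⟩ := exists_contraction_constants (γ := γ) (K := K) (e := e)
    hγ' K.2 (by exact_mod_cast he0) (by exact_mod_cast he1) hR
  lift α to ℝ≥0 using hα0.le
  lift β to ℝ≥0 using hβ0.le
  refine ⟨α, β, by exact_mod_cast hα0, by exact_mod_cast hα1, by exact_mod_cast hβ0,
    fun x y => ?_⟩
  have hα0' : (α : ℝ≥0∞) ≠ 0 := by
    have : 0 < α := by exact_mod_cast hα0
    exact_mod_cast this.ne'
  have hβ0' : (β : ℝ≥0∞) ≠ 0 := by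
    have : 0 < β := by exact_mod_cast hβ0
    exact_mod_cast this.ne'
  have hkx : ∀ x, Measurable fun θ => k θ x := fun x =>
    hk.comp (measurable_id.prodMk measurable_const)
  by_cases hx : V x = ∞
  · simp [hx, ENNReal.mul_top, hα0', hβ0']
  by_cases hy : V y = ∞
  · simp [hy, ENNReal.mul_top, hα0', hβ0']
  obtain ⟨vx, hvx⟩ : ∃ v : ℝ≥0, (v : ℝ≥0∞) = V x := ⟨_, ENNReal.coe_toNNReal hx⟩
  obtain ⟨vy, hvy⟩ : ∃ v : ℝ≥0, (v : ℝ≥0∞) = V y := ⟨_, ENNReal.coe_toNNReal hy⟩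
  have hdx := hdrift x
  have hdy := hdrift y
  rw [← hvx] at hdx ⊢
  rw [← hvy] at hdy ⊢
  have hmx := hmass x hx
  have hmy := hmass y hy
  have key := hαβ (vx + vy) (by positivity)
  rcases le_total ((vx : ℝ) + vy) R with hle | hle
  · have hνx := hνk x (by
      rw [← hvx]; norm_cast; rw [← NNReal.coe_le_coe]; simpa using by linarith [vy.2])
    have hνy := hνk y (by
      rw [← hvy]; norm_cast; rw [← NNReal.coe_le_coe]; simpa using by linarith [vx.2])
    have hνi : ∫⁻ θ, ν θ ∂ρ ≤ 1 := hmx ▸ lintegral_mono hνx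
    have hsub : ∀ z, ∫⁻ θ, k θ z ∂ρ = 1 → (∀ θ, ν θ ≤ k θ z) →
        ∫⁻ θ, (k θ z - ν θ) ∂ρ = ((1 - e : ℝ≥0) : ℝ≥0∞) := fun z hz hzν => by
      rw [lintegral_sub hν (ne_top_of_le_ne_top ENNReal.one_ne_top hνi)
        (Filter.Eventually.of_forall hzν), hz, ENNReal.coe_sub, he, min_eq_left hνi]
      rfl
    calc ∫⁻ θ, (1 + β * V θ) * ((k θ x - k θ y) + (k θ y - k θ x)) ∂ρ
        ≤ ∫⁻ θ, ((k θ x - ν θ) + (k θ y - ν θ)) + β * (V θ * k θ x + V θ * k θ y) ∂ρ := by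
          refine lintegral_mono fun θ => ?_
          rw [add_mul, one_mul, mul_assoc, mul_add (V θ)]
          gcongr ?_ + ?_ + β * (V θ * ?_ + V θ * ?_)
          · exact tsub_le_tsub_left (hνy θ) _
          · exact tsub_le_tsub_left (hνx θ) _
          · exact tsub_le_self
          · exact tsub_le_self
      _ = ((1 - e : ℝ≥0) + (1 - e : ℝ≥0)) +
            β * (∫⁻ θ, V θ * k θ x ∂ρ + ∫⁻ θ, V θ * k θ y ∂ρ) := by
          rw [lintegral_add_left (by fun_prop),
            lintegral_add_left (by fun_prop), hsub x hmx hνx, hsub y hmy hνy,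
            lintegral_const_mul _ (by fun_prop),
            lintegral_add_left (by fun_prop)]
      _ ≤ ((1 - e : ℝ≥0) + (1 - e : ℝ≥0)) + β * ((γ * vx + K) + (γ * vy + K)) := by gcongr
      _ ≤ α * ((1 + β * vx) + (1 + β * vy)) := by
          norm_cast
          rw [← NNReal.coe_le_coe]
          push_cast [he1]
          linarith [key.1 hle]
  · calc ∫⁻ θ, (1 + β * V θ) * ((k θ x - k θ y) + (k θ y - k θ x)) ∂ρ
        ≤ ∫⁻ θ, (k θ x + k θ y) + β * (V θ * k θ x + V θ * k θ y) ∂ρ := by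
          refine lintegral_mono fun θ => ?_
          rw [add_mul, one_mul, mul_assoc, mul_add (V θ)]
          gcongr ?_ + ?_ + β * (V θ * ?_ + V θ * ?_) <;> exact tsub_le_self
      _ = (1 + 1) + β * (∫⁻ θ, V θ * k θ x ∂ρ + ∫⁻ θ, V θ * k θ y ∂ρ) := by
          rw [lintegral_add_left (by fun_prop),
            lintegral_add_left (hkx x), hmx, hmy,
            lintegral_const_mul _ (by fun_prop),
            lintegral_add_left (by fun_prop)]
      _ ≤ (1 + 1) + β * ((γ * vx + K) + (γ * vy + K)) := by gcongr
      _ ≤ α * ((1 + β * vx) + (1 + β * vy)) := by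
          norm_cast
          rw [← NNReal.coe_le_coe]
          push_cast
          linarith [key.2 hle]

/-- Contraction of densities of equal mass, from contraction of point masses: write the
difference of the densities as a mixture of differences of point masses. -/
lemma lintegral_weight_mul_dist_le [SFinite ρ] (hk : Measurable fun q : Ω × Ω => k q.1 q.2)
    {W : Ω → ℝ≥0∞} (hW : Measurable W) {α : ℝ≥0∞}
    (hpair : ∀ x y, ∫⁻ θ, W θ * ((k θ x - k θ y) + (k θ y - k θ x)) ∂ρ ≤ α * (W x + W y))
    {f g : Ω → ℝ≥0∞} (hf : Measurable f) (hg : Measurable g)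
    (hfg : ∫⁻ x, f x ∂ρ = ∫⁻ x, g x ∂ρ) (hfin : ∫⁻ x, f x ∂ρ ≠ ∞) :
    ∫⁻ θ, W θ * ((∫⁻ x, k θ x * f x ∂ρ - ∫⁻ x, k θ x * g x ∂ρ) +
        (∫⁻ x, k θ x * g x ∂ρ - ∫⁻ x, k θ x * f x ∂ρ)) ∂ρ
      ≤ α * ∫⁻ x, W x * ((f x - g x) + (g x - f x)) ∂ρ := by
  obtain ⟨p, hp⟩ : ∃ p : Ω → ℝ≥0∞, p = fun x => f x - g x := ⟨_, rfl⟩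
  obtain ⟨q, hq⟩ : ∃ q : Ω → ℝ≥0∞, q = fun x => g x - f x := ⟨_, rfl⟩
  obtain ⟨m, hm⟩ : ∃ m : Ω → ℝ≥0∞, m = fun x => min (f x) (g x) := ⟨_, rfl⟩
  have hpm : Measurable p := hp ▸ hf.sub hg
  have hqm : Measurable q := hq ▸ hg.sub hf
  have hmm : Measurable m := hm ▸ hf.min hg
  have hfe : ∀ x, f x = m x + p x := fun x => by
    rw [hm, hp]
    rcases le_total (f x) (g x) with h | h
    · simp [h, tsub_eq_zero_of_le]
    · simp [h, add_tsub_cancel_of_le]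
  have hge : ∀ x, g x = m x + q x := fun x => by
    rw [hm, hq]
    rcases le_total (f x) (g x) with h | h
    · simp [h, add_tsub_cancel_of_le]
    · simp [h, tsub_eq_zero_of_le]
  have hmfin : ∫⁻ x, m x ∂ρ ≠ ∞ :=
    ne_top_of_le_ne_top hfin (lintegral_mono fun x => by rw [hm]; exact min_le_left _ _)
  have hpfin : ∫⁻ x, p x ∂ρ ≠ ∞ :=
    ne_top_of_le_ne_top hfin (lintegral_mono fun x => by rw [hp]; exact tsub_le_self)
  have hpq : ∫⁻ x, p x ∂ρ = ∫⁻ x, q x ∂ρ := by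
    simp_rw [hfe, hge] at hfg
    rw [lintegral_add_left hmm, lintegral_add_left hmm] at hfg
    exact (ENNReal.add_right_inj hmfin).mp hfg
  have hkθ : ∀ θ, Measurable fun x => k θ x := fun θ =>
    hk.comp (measurable_const.prodMk measurable_id)
  have hkx : ∀ x, Measurable fun θ => k θ x := fun x =>
    hk.comp (measurable_id.prodMk measurable_const)
  obtain ⟨M, hM⟩ : ∃ M, M = ∫⁻ x, p x ∂ρ := ⟨_, rfl⟩
  by_cases hM0 : M = 0
  · -- equal masses and vanishing positive part: the densities agree almost everywhere
    have hp0 : p =ᵐ[ρ] 0 := (lintegral_eq_zero_iff hpm).mp (hM ▸ hM0)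
    have hq0 : q =ᵐ[ρ] 0 := (lintegral_eq_zero_iff hqm).mp (hpq ▸ hM ▸ hM0)
    have : ∀ θ, ∫⁻ x, k θ x * f x ∂ρ = ∫⁻ x, k θ x * g x ∂ρ := fun θ => by
      refine lintegral_congr_ae ?_
      filter_upwards [hp0, hq0] with x h1 h2
      rw [hfe, hge, h1, h2]
    simp [this]
  have hMtop : M ≠ ∞ := hM ▸ hpfin
  -- the product density of the positive and negative parts has total mass `M²`
  have hPp : ∀ θ, ∫⁻ x, k θ x * p x ∂ρ = M⁻¹ * ∫⁻ x, ∫⁻ y, k θ x * (p x * q y) ∂ρ ∂ρ := fun θ => by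
    have : ∀ x, ∫⁻ y, k θ x * (p x * q y) ∂ρ = k θ x * p x * M := fun x => by
      rw [hM, hpq, ← lintegral_const_mul _ hqm]
      simp_rw [mul_assoc]
    simp_rw [this]
    rw [lintegral_mul_const _ (by fun_prop), mul_comm, mul_assoc,
      ENNReal.mul_inv_cancel hM0 hMtop, mul_one]
  have hPq : ∀ θ, ∫⁻ x, k θ x * q x ∂ρ = M⁻¹ * ∫⁻ x, ∫⁻ y, k θ y * (p x * q y) ∂ρ ∂ρ := fun θ => by
    have : ∀ x, ∫⁻ y, k θ y * (p x * q y) ∂ρ = p x * ∫⁻ y, k θ y * q y ∂ρ := fun x => by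
      rw [← lintegral_const_mul _ (by fun_prop)]
      refine lintegral_congr fun y => ?_
      ring
    simp_rw [this]
    rw [lintegral_mul_const _ hpm, ← hM, ← mul_assoc, ENNReal.inv_mul_cancel hM0 hMtop, one_mul]
  obtain ⟨D, hD⟩ : ∃ D : Ω → Ω → Ω → ℝ≥0∞,
    D = fun θ x y => (k θ x - k θ y) + (k θ y - k θ x) := ⟨_, rfl⟩
  have hDm : Measurable fun t : Ω × Ω × Ω => D t.1 t.2.1 t.2.2 := by
    rw [hD]
    have h1 : Measurable fun t : Ω × Ω × Ω => k t.1 t.2.1 :=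
      hk.comp (f := fun t : Ω × Ω × Ω => (t.1, t.2.1)) (by fun_prop)
    have h2 : Measurable fun t : Ω × Ω × Ω => k t.1 t.2.2 :=
      hk.comp (f := fun t : Ω × Ω × Ω => (t.1, t.2.2)) (by fun_prop)
    exact (h1.sub h2).add (h2.sub h1)
  have hbound : ∀ θ, (∫⁻ x, k θ x * f x ∂ρ - ∫⁻ x, k θ x * g x ∂ρ) +
        (∫⁻ x, k θ x * g x ∂ρ - ∫⁻ x, k θ x * f x ∂ρ)
      ≤ M⁻¹ * ∫⁻ x, ∫⁻ y, D θ x y * (p x * q y) ∂ρ ∂ρ := fun θ => by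
    have e1 : ∫⁻ x, k θ x * f x ∂ρ = ∫⁻ x, k θ x * m x ∂ρ + ∫⁻ x, k θ x * p x ∂ρ := by
      rw [← lintegral_add_left (by fun_prop)]
      simp_rw [hfe, mul_add]
    have e2 : ∫⁻ x, k θ x * g x ∂ρ = ∫⁻ x, k θ x * m x ∂ρ + ∫⁻ x, k θ x * q x ∂ρ := by
      rw [← lintegral_add_left (by fun_prop)]
      simp_rw [hge, mul_add]
    have mA : Measurable fun t : Ω × Ω => k θ t.1 * (p t.1 * q t.2) :=
      ((hkθ θ).comp measurable_fst).mul ((hpm.comp measurable_fst).mul (hqm.comp measurable_snd))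
    have mB : Measurable fun t : Ω × Ω => k θ t.2 * (p t.1 * q t.2) :=
      ((hkθ θ).comp measurable_snd).mul ((hpm.comp measurable_fst).mul (hqm.comp measurable_snd))
    have mA' : ∀ x, Measurable fun y => k θ x * (p x * q y) := fun x => by fun_prop
    have mB' : ∀ x, Measurable fun y => k θ y * (p x * q y) := fun x => by fun_prop
    have mAB : Measurable fun x => ∫⁻ y, (k θ x * (p x * q y) - k θ y * (p x * q y)) ∂ρ :=
      (mA.sub mB).lintegral_prod_right'
    have sub_le : ∀ A B : Ω → Ω → ℝ≥0∞, Measurable (fun t : Ω × Ω => A t.1 t.2) →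
        Measurable (fun t : Ω × Ω => B t.1 t.2) →
        ∫⁻ x, ∫⁻ y, A x y ∂ρ ∂ρ - ∫⁻ x, ∫⁻ y, B x y ∂ρ ∂ρ ≤ ∫⁻ x, ∫⁻ y, A x y - B x y ∂ρ ∂ρ :=
      fun A B hA hB => (lintegral_sub_le _ _ hB.lintegral_prod_right').trans
        (lintegral_mono fun x =>
          lintegral_sub_le _ _ (hB.comp (measurable_const.prodMk measurable_id)))
    rw [e1, e2]
    refine (add_le_add add_tsub_add_le_tsub_left add_tsub_add_le_tsub_left).trans ?_
    rw [hPp, hPq, ← ENNReal.mul_sub (fun _ _ => ENNReal.inv_ne_top.mpr hM0),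
      ← ENNReal.mul_sub (fun _ _ => ENNReal.inv_ne_top.mpr hM0), ← mul_add]
    gcongr
    refine (add_le_add (sub_le _ _ mA mB) (sub_le _ _ mB mA)).trans ?_
    rw [← lintegral_add_left mAB]
    refine lintegral_mono fun x => ?_
    rw [← lintegral_add_left (by fun_prop)]
    refine lintegral_mono fun y => ?_
    simp only [hD]
    rw [add_mul]
    exact add_le_add (le_tsub_mul) (le_tsub_mul)
  have m1 : Measurable fun t : Ω × Ω × Ω => W t.1 * (D t.1 t.2.1 t.2.2 * (p t.2.1 * q t.2.2)) :=
    (hW.comp measurable_fst).mul (hDm.mul ((hpm.comp (by fun_prop)).mul (hqm.comp (by fun_prop))))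
  have m2 : ∀ x, Measurable fun t : Ω × Ω => W t.1 * (D t.1 x t.2 * (p x * q t.2)) := fun x =>
    m1.comp (f := fun t : Ω × Ω => (t.1, x, t.2)) (by fun_prop)
  calc _ ≤ ∫⁻ θ, W θ * (M⁻¹ * ∫⁻ x, ∫⁻ y, D θ x y * (p x * q y) ∂ρ ∂ρ) ∂ρ :=
        lintegral_mono fun θ => by gcongr; exact hbound θ
    _ = M⁻¹ * ∫⁻ θ, ∫⁻ x, ∫⁻ y, W θ * (D θ x y * (p x * q y)) ∂ρ ∂ρ ∂ρ := by
        have mD : ∀ θ, Measurable fun t : Ω × Ω => D θ t.1 t.2 * (p t.1 * q t.2) := fun θ =>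
          (hDm.comp (f := fun t : Ω × Ω => (θ, t.1, t.2)) (by fun_prop)).mul
            ((hpm.comp measurable_fst).mul (hqm.comp measurable_snd))
        rw [← lintegral_const_mul' _ _ (ENNReal.inv_ne_top.mpr hM0)]
        refine lintegral_congr fun θ => ?_
        have mD' : Measurable fun x => ∫⁻ y, D θ x y * (p x * q y) ∂ρ :=
          (mD θ).lintegral_prod_right'
        rw [mul_left_comm, ← lintegral_const_mul _ mD']
        congr 1
        refine lintegral_congr fun x => ?_
        have mD'' : Measurable fun y => D θ x y * (p x * q y) :=
          (mD θ).comp (measurable_const.prodMk measurable_id)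
        rw [← lintegral_const_mul _ mD'']
    _ = M⁻¹ * ∫⁻ x, ∫⁻ y, ∫⁻ θ, W θ * (D θ x y * (p x * q y)) ∂ρ ∂ρ ∂ρ := by
        have m3 : Measurable fun t : (Ω × Ω) × Ω =>
            W t.1.1 * (D t.1.1 t.1.2 t.2 * (p t.1.2 * q t.2)) :=
          m1.comp (f := fun t : (Ω × Ω) × Ω => (t.1.1, t.1.2, t.2)) (by fun_prop)
        rw [lintegral_lintegral_swap]
        · congr 1
          refine lintegral_congr fun x => ?_
          rw [lintegral_lintegral_swap]
          exact (m2 x).aemeasurable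
        · exact m3.lintegral_prod_right'.aemeasurable
    _ ≤ M⁻¹ * ∫⁻ x, ∫⁻ y, α * (W x * p x * q y + p x * (W y * q y)) ∂ρ ∂ρ := by
        gcongr with x y
        calc ∫⁻ θ, W θ * (D θ x y * (p x * q y)) ∂ρ
            = (∫⁻ θ, W θ * D θ x y ∂ρ) * (p x * q y) := by
              have mD : Measurable fun θ => D θ x y :=
                hDm.comp (f := fun θ : Ω => (θ, x, y)) (by fun_prop)
              rw [← lintegral_mul_const _ (by fun_prop)]
              simp_rw [mul_assoc]
          _ ≤ α * (W x + W y) * (p x * q y) := by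
              gcongr
              simpa only [hD] using hpair x y
          _ = _ := by ring
    _ = M⁻¹ * (α * (M * (∫⁻ x, W x * p x ∂ρ + ∫⁻ y, W y * q y ∂ρ))) := by
        have : ∀ x, ∫⁻ y, α * (W x * p x * q y + p x * (W y * q y)) ∂ρ
            = α * (W x * p x * M + p x * ∫⁻ y, W y * q y ∂ρ) := fun x => by
          rw [lintegral_const_mul _ (by fun_prop), lintegral_add_left (by fun_prop),
            lintegral_const_mul _ hqm, lintegral_const_mul _ (by fun_prop), ← hpq, hM]
        simp_rw [this]
        rw [lintegral_const_mul _ (by fun_prop), lintegral_add_left (by fun_prop),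
          lintegral_mul_const _ (by fun_prop), lintegral_mul_const _ hpm, ← hM]
        ring
    _ = α * ∫⁻ x, W x * ((f x - g x) + (g x - f x)) ∂ρ := by
        rw [mul_left_comm, ← mul_assoc M⁻¹, ENNReal.inv_mul_cancel hM0 hMtop, one_mul,
          ← lintegral_add_left (by fun_prop)]
        simp_rw [← mul_add, hp, hq]

/-- Under a drift condition, `V` is integrable against every finite invariant density; the
invariance is used for the bounded functions `min V N`. -/
lemma lintegral_mul_ne_top_of_drift [SFinite ρ] (hk : Measurable fun q : Ω × Ω => k q.1 q.2)
    (hV : Measurable V) {γ K : ℝ≥0} (hγ : γ < 1)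
    (hmass : ∀ x, V x ≠ ∞ → ∫⁻ θ, k θ x ∂ρ = 1)
    (hdrift : ∀ x, ∫⁻ θ, V θ * k θ x ∂ρ ≤ γ * V x + K)
    {g : Ω → ℝ≥0∞} (hg : Measurable g) (hgV : ∀ x, g x ≠ 0 → V x ≠ ∞)
    (hinv : ∀ θ, ∫⁻ x, k θ x * g x ∂ρ = g θ) (hfin : ∫⁻ x, g x ∂ρ ≠ ∞) :
    ∫⁻ x, V x * g x ∂ρ ≠ ∞ := by
  have hkx : ∀ x, Measurable fun θ => k θ x := fun x =>
    hk.comp (measurable_id.prodMk measurable_const)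
  have hkθ : ∀ θ, Measurable fun x => k θ x := fun θ =>
    hk.comp (measurable_const.prodMk measurable_id)
  have step : ∀ N : ℕ, ∫⁻ x, min (V x) N * g x ∂ρ
      ≤ ∫⁻ x, min (γ * V x + K) N * g x ∂ρ := fun N => by
    calc ∫⁻ x, min (V x) N * g x ∂ρ = ∫⁻ θ, ∫⁻ x, min (V θ) N * (k θ x * g x) ∂ρ ∂ρ := by
          refine lintegral_congr fun θ => ?_
          rw [lintegral_const_mul _ (by fun_prop), hinv]
      _ = ∫⁻ x, ∫⁻ θ, min (V θ) N * (k θ x * g x) ∂ρ ∂ρ := by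
          rw [lintegral_lintegral_swap]
          exact (((hV.comp measurable_fst).min measurable_const).mul
            (hk.mul (hg.comp measurable_snd))).aemeasurable
      _ ≤ ∫⁻ x, min (γ * V x + K) N * g x ∂ρ := by
          refine lintegral_mono fun x => ?_
          simp_rw [← mul_assoc]
          rw [lintegral_mul_const _ (by fun_prop)]
          rcases eq_or_ne (g x) 0 with h0 | h0
          · simp [h0]
          refine mul_le_mul_left (le_min ?_ ?_) _
          · exact (lintegral_mono fun θ => by gcongr; exact min_le_left _ _).trans (hdrift x)
          · calc ∫⁻ θ, min (V θ) N * k θ x ∂ρ ≤ ∫⁻ θ, N * k θ x ∂ρ :=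
                  lintegral_mono fun θ => by gcongr; exact min_le_right _ _
              _ = N := by rw [lintegral_const_mul _ (hkx x), hmass x (hgV x h0), mul_one]
  have pt : ∀ (N : ℕ) (v : ℝ≥0∞), min (γ * v + K) N + (1 - γ : ℝ≥0) * (if v ≤ N then v else 0)
      ≤ min v N + K := fun N v => by
    split_ifs with h
    · rw [min_eq_left h]
      calc _ ≤ (γ * v + K) + (1 - γ : ℝ≥0) * v := by gcongr; exact min_le_left _ _
        _ = ((γ + (1 - γ) : ℝ≥0) : ℝ≥0∞) * v + K := by push_cast; ring
        _ = v + K := by rw [add_tsub_cancel_of_le hγ.le]; simp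
    · rw [min_eq_right (not_le.mp h).le, mul_zero, add_zero]
      exact (min_le_right _ _).trans le_self_add
  have bound : ∀ N : ℕ, (1 - γ : ℝ≥0) * ∫⁻ x, (if V x ≤ N then V x else 0) * g x ∂ρ
      ≤ K * ∫⁻ x, g x ∂ρ := fun N => by
    have mI : Measurable fun x => (if V x ≤ N then V x else 0) :=
      Measurable.ite (measurableSet_le hV measurable_const) hV measurable_const
    have fin : ∫⁻ x, min (γ * V x + K) N * g x ∂ρ ≠ ∞ := by
      refine ne_top_of_le_ne_top (ENNReal.mul_ne_top (ENNReal.natCast_ne_top N) hfin) ?_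
      rw [← lintegral_const_mul _ hg]
      exact lintegral_mono fun x => by gcongr; exact min_le_right _ _
    refine (ENNReal.add_le_add_iff_left fin).mp ?_
    calc _ = ∫⁻ x, (min (γ * V x + K) N + (1 - γ : ℝ≥0) * (if V x ≤ N then V x else 0)) * g x ∂ρ := by
          rw [← lintegral_const_mul _ (by fun_prop), ← lintegral_add_right _ (by fun_prop)]
          simp_rw [add_mul, mul_assoc]
      _ ≤ ∫⁻ x, (min (V x) N + K) * g x ∂ρ := lintegral_mono fun x => mul_le_mul_left (pt N _) _
      _ = ∫⁻ x, min (V x) N * g x ∂ρ + K * ∫⁻ x, g x ∂ρ := by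
          simp_rw [add_mul]
          rw [lintegral_add_right _ (by fun_prop), lintegral_const_mul _ hg]
      _ ≤ _ := add_le_add_left (step N) _
  have h1γ : ((1 - γ : ℝ≥0) : ℝ≥0∞) ≠ 0 := by
    exact_mod_cast (tsub_pos_of_lt hγ).ne'
  have lim : ∫⁻ x, V x * g x ∂ρ
      = ⨆ N : ℕ, ∫⁻ x, (if V x ≤ N then V x else 0) * g x ∂ρ := by
    rw [← lintegral_iSup]
    · refine lintegral_congr fun x => le_antisymm ?_ ?_
      · rcases eq_or_ne (g x) 0 with h0 | h0
        · simp [h0]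
        obtain ⟨N, hN⟩ := exists_nat_ge (V x).toNNReal
        have : V x ≤ N := by
          rw [← ENNReal.coe_toNNReal (hgV x h0)]
          exact_mod_cast hN
        refine le_iSup_of_le N ?_
        simp [this]
      · refine iSup_le fun N => ?_
        gcongr
        split_ifs <;> simp
    · exact fun N => (Measurable.ite (measurableSet_le hV measurable_const) hV
        measurable_const).mul hg
    · intro N N' hNN' x
      dsimp only
      gcongr
      split_ifs with h1 h2
      · exact le_rfl
      · exact absurd (h1.trans (by exact_mod_cast hNN')) h2
      · simp
      · simp
  rw [lim]
  refine ne_top_of_le_ne_top (b := (1 - γ : ℝ≥0)⁻¹ * (K * ∫⁻ x, g x ∂ρ)) ?_ (iSup_le fun N => ?_)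
  · exact ENNReal.mul_ne_top ENNReal.coe_ne_top (ENNReal.mul_ne_top ENNReal.coe_ne_top hfin)
  · rw [ENNReal.coe_inv (tsub_pos_of_lt hγ).ne', ← ENNReal.div_eq_inv_mul,
      ENNReal.le_div_iff_mul_le (.inl h1γ) (.inl ENNReal.coe_ne_top), mul_comm]
    exact bound N

/-- An invariant density which is integrable over the sublevel sets of the drift function is
integrable. There is a sublevel set `C` such that, from every starting point, the chain is in `C`
with probability at least `1 / 2` at all large times. By invariance, the probability of being in
`C` at time `m` integrates against the density to its mass on `C`, for every `m`, so Fatou's lemma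
bounds the total mass by twice the mass of `C`. -/
lemma lintegral_ne_top_of_drift [SFinite ρ] (hk : Measurable fun q : Ω × Ω => k q.1 q.2)
    (hV : Measurable V) {γ K : ℝ≥0} (hγ : γ < 1)
    (hmass : ∀ x, V x ≠ ∞ → ∫⁻ θ, k θ x ∂ρ = 1)
    (hdrift : ∀ x, ∫⁻ θ, V θ * k θ x ∂ρ ≤ γ * V x + K)
    {g : Ω → ℝ≥0∞} (hg : Measurable g) (hgV : ∀ x, g x ≠ 0 → V x ≠ ∞)
    (hinv : ∀ θ, ∫⁻ x, k θ x * g x ∂ρ = g θ)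
    (hlevel : ∀ R : ℝ≥0, ∫⁻ x in {x | V x ≤ R}, g x ∂ρ ≠ ∞) :
    ∫⁻ x, g x ∂ρ ≠ ∞ := by
  have hkx : ∀ x, Measurable fun θ => k θ x := fun x =>
    hk.comp (measurable_id.prodMk measurable_const)
  have hkθ : ∀ θ, Measurable fun x => k θ x := fun θ =>
    hk.comp (measurable_const.prodMk measurable_id)
  obtain ⟨T, hT⟩ : ∃ T : (Ω → ℝ≥0∞) → Ω → ℝ≥0∞, T = fun φ x => ∫⁻ θ, φ θ * k θ x ∂ρ := ⟨_, rfl⟩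
  have hTd : ∀ φ x, T φ x = ∫⁻ θ, φ θ * k θ x ∂ρ := fun φ x => by rw [hT]
  have hTm : ∀ φ, Measurable φ → Measurable (T φ) := fun φ hφ => by
    have : Measurable fun q : Ω × Ω => φ q.2 * k q.2 q.1 :=
      (hφ.comp measurable_snd).mul (hk.comp measurable_swap)
    rw [hT]
    exact this.lintegral_prod_right'
  have hTinv : ∀ φ, Measurable φ → ∫⁻ x, T φ x * g x ∂ρ = ∫⁻ x, φ x * g x ∂ρ := fun φ hφ => by
    calc ∫⁻ x, T φ x * g x ∂ρ = ∫⁻ x, ∫⁻ θ, φ θ * (k θ x * g x) ∂ρ ∂ρ := by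
          refine lintegral_congr fun x => ?_
          simp_rw [hT, ← mul_assoc]
          rw [lintegral_mul_const _ (by fun_prop)]
      _ = ∫⁻ θ, ∫⁻ x, φ θ * (k θ x * g x) ∂ρ ∂ρ := by
          rw [lintegral_lintegral_swap]
          exact ((hφ.comp measurable_snd).mul
            ((hk.comp measurable_swap).mul (hg.comp measurable_fst))).aemeasurable
      _ = _ := by
          refine lintegral_congr fun θ => ?_
          rw [lintegral_const_mul _ (by fun_prop), hinv]
  -- the bound for `V` after many steps, the fixed point of the drift inequality
  obtain ⟨K', hK'⟩ : ∃ K' : ℝ≥0, γ * K' + K = K' := by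
    refine ⟨K / (1 - γ), ?_⟩
    have h1 : 1 - γ ≠ 0 := (tsub_pos_of_lt hγ).ne'
    have h2 : (1 - γ) * (K / (1 - γ)) = K := mul_div_cancel₀ K h1
    calc γ * (K / (1 - γ)) + K = γ * (K / (1 - γ)) + (1 - γ) * (K / (1 - γ)) := by rw [h2]
      _ = (γ + (1 - γ)) * (K / (1 - γ)) := by ring
      _ = _ := by rw [add_tsub_cancel_of_le hγ.le, one_mul]
  obtain ⟨R, hR⟩ : ∃ R : ℝ≥0, R = 4 * (K' + 1) := ⟨_, rfl⟩
  obtain ⟨φ, hφ⟩ : ∃ φ : Ω → ℝ≥0∞, φ = Set.indicator {x | V x ≤ R} 1 := ⟨_, rfl⟩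
  have hC : MeasurableSet {x | V x ≤ R} := measurableSet_le hV measurable_const
  have hφm : Measurable φ := hφ ▸ measurable_one.indicator hC
  -- Markov's inequality, which is then iterated along the chain
  have hφV : ∀ x, 1 ≤ φ x + (R : ℝ≥0∞)⁻¹ * V x := fun x => by
    by_cases hx : V x ≤ R
    · simp [hφ, hx]
    · have hR0 : (R : ℝ≥0∞) ≠ 0 := by rw [hR]; positivity
      refine le_add_of_nonneg_of_le bot_le ?_
      rw [← ENNReal.inv_mul_cancel hR0 ENNReal.coe_ne_top]
      gcongr
      exact (not_le.mp hx).le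
  have hit : ∀ m : ℕ, Measurable (T^[m] φ) ∧ ∫⁻ x, T^[m] φ x * g x ∂ρ = ∫⁻ x, φ x * g x ∂ρ ∧
      ∃ c : ℝ≥0, c + γ ^ m * K' ≤ K' ∧
        ∀ x, V x ≠ ∞ → 1 ≤ T^[m] φ x + (R : ℝ≥0∞)⁻¹ * ((γ : ℝ≥0∞) ^ m * V x + c) := fun m => by
    induction m with
    | zero =>
      refine ⟨hφm, rfl, 0, by simp, fun x _ => (hφV x).trans (le_of_eq ?_)⟩
      simp
    | succ m ih =>
      obtain ⟨ih1, ih2, c, hc, ih3⟩ := ih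
      rw [Function.iterate_succ_apply']
      refine ⟨hTm _ ih1, (hTinv _ ih1).trans ih2, c + γ ^ m * K, ?_, fun x hx => ?_⟩
      · calc c + γ ^ m * K + γ ^ (m + 1) * K' = c + γ ^ m * (γ * K' + K) := by ring
          _ ≤ K' := by rwa [hK']
      have hae : ∀ᵐ θ ∂ρ, V θ * k θ x ≠ ∞ := by
        have : ∫⁻ θ, V θ * k θ x ∂ρ ≠ ∞ := ne_top_of_le_ne_top
          (ENNReal.add_ne_top.mpr ⟨ENNReal.mul_ne_top ENNReal.coe_ne_top hx, ENNReal.coe_ne_top⟩)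
          (hdrift x)
        exact (ae_lt_top (by fun_prop) this).mono fun θ h => h.ne
      have hx' := hkx x
      calc (1 : ℝ≥0∞) = ∫⁻ θ, k θ x ∂ρ := (hmass x hx).symm
        _ ≤ ∫⁻ θ, (T^[m] φ θ + (R : ℝ≥0∞)⁻¹ * ((γ : ℝ≥0∞) ^ m * V θ + c)) * k θ x ∂ρ := by
            refine lintegral_mono_ae ?_
            filter_upwards [hae] with θ hθ
            rcases eq_or_ne (k θ x) 0 with h0 | h0
            · simp [h0]
            have hVθ : V θ ≠ ∞ := fun h => hθ (by rw [h, ENNReal.top_mul h0])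
            exact le_mul_of_one_le_left' (ih3 θ hVθ)
        _ = T (T^[m] φ) x + (R : ℝ≥0∞)⁻¹ *
              ((γ : ℝ≥0∞) ^ m * ∫⁻ θ, V θ * k θ x ∂ρ + c * ∫⁻ θ, k θ x ∂ρ) := by
            rw [← lintegral_const_mul _ (by fun_prop), ← lintegral_const_mul _ (by fun_prop),
              ← lintegral_add_left (by fun_prop), ← lintegral_const_mul _ (by fun_prop), hTd,
              ← lintegral_add_left (by fun_prop)]
            refine lintegral_congr fun θ => ?_
            ring
        _ ≤ T (T^[m] φ) x + (R : ℝ≥0∞)⁻¹ * ((γ : ℝ≥0∞) ^ m * (γ * V x + K) + c) := by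
            rw [hmass x hx, mul_one]
            gcongr
            exact hdrift x
        _ = _ := by
            push_cast
            ring
  have hhalf : ∀ x, (2 : ℝ≥0∞)⁻¹ * g x ≤ Filter.liminf (fun m => T^[m] φ x * g x) Filter.atTop :=
    fun x => by
    rcases eq_or_ne (g x) 0 with h0 | h0
    · simp [h0]
    have hx := hgV x h0
    have hlim : Filter.Tendsto (fun m : ℕ => (γ : ℝ≥0∞) ^ m * V x) Filter.atTop (nhds 0) := by
      have := ENNReal.Tendsto.mul_const (b := V x)
        (ENNReal.tendsto_pow_atTop_nhds_zero_of_lt_one (r := (γ : ℝ≥0∞)) (by exact_mod_cast hγ))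
        (.inr hx)
      simpa using this
    refine Filter.le_liminf_of_le (by isBoundedDefault) ?_
    filter_upwards [hlim.eventually (ge_mem_nhds zero_lt_one)] with m hm
    obtain ⟨-, -, c, hc, h1⟩ := hit m
    gcongr
    have hcK : c ≤ K' := le_self_add.trans hc
    have hR0 : (R : ℝ≥0∞) ≠ 0 := by rw [hR]; positivity
    have hR1 : (R : ℝ≥0∞)⁻¹ * ((γ : ℝ≥0∞) ^ m * V x + c) ≤ 2⁻¹ := by
      calc _ ≤ (R : ℝ≥0∞)⁻¹ * (1 + K') := by gcongr
        _ ≤ (R : ℝ≥0∞)⁻¹ * (R * 2⁻¹) := by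
            gcongr
            rw [← ENNReal.div_eq_inv_mul.trans (mul_comm _ _),
              ENNReal.le_div_iff_mul_le (by simp) (by simp), hR]
            norm_cast
            rw [← NNReal.coe_le_coe]
            push_cast
            linarith [K'.2]
        _ = 2⁻¹ := by rw [← mul_assoc, ENNReal.inv_mul_cancel hR0 ENNReal.coe_ne_top, one_mul]
    have h2 : (2 : ℝ≥0∞)⁻¹ + 2⁻¹ ≤ T^[m] φ x + 2⁻¹ := by
      rw [ENNReal.inv_two_add_inv_two]
      exact (h1 x hx).trans (by gcongr)
    exact (ENNReal.add_le_add_iff_right (by simp)).mp h2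
  have hfatou : (2 : ℝ≥0∞)⁻¹ * ∫⁻ x, g x ∂ρ ≤ ∫⁻ x in {x | V x ≤ R}, g x ∂ρ := by
    rw [← lintegral_const_mul _ hg]
    refine (lintegral_mono hhalf).trans ((lintegral_liminf_le fun m => (hit m).1.mul hg).trans ?_)
    refine (Filter.liminf_congr (Filter.Eventually.of_forall fun m => (hit m).2.1)).trans_le ?_
    rw [Filter.liminf_const, ← lintegral_indicator hC, hφ]
    refine lintegral_mono fun x => ?_
    by_cases hx : V x ≤ R <;> simp [hx]
  intro htop
  rw [htop, ENNReal.mul_top (by simp)] at hfatou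
  exact hlevel R (top_le_iff.mp hfatou)

/-- **Harris' theorem** for a chain with transition densities `k` and iterated densities `it`. -/
lemma exists_geometric_rate [SFinite ρ] (hk : Measurable fun q : Ω × Ω => k q.1 q.2)
    (hV : Measurable V) {γ K : ℝ≥0} (hγ : γ < 1)
    (hmass : ∀ x, V x ≠ ∞ → ∫⁻ θ, k θ x ∂ρ = 1)
    (hdrift : ∀ x, ∫⁻ θ, V θ * k θ x ∂ρ ≤ γ * V x + K)
    (hmin : ∀ R : ℝ≥0, ∃ ν : Ω → ℝ≥0∞, Measurable ν ∧ ∫⁻ θ, ν θ ∂ρ ≠ 0 ∧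
      ∀ x, V x ≤ R → ∀ θ, ν θ ≤ k θ x)
    (hkV : ∀ x θ, k θ x ≠ 0 → V θ ≠ ∞)
    {g : Ω → ℝ≥0∞} (hg : Measurable g) (hgV : ∀ x, g x ≠ 0 → V x ≠ ∞)
    (hinv : ∀ θ, ∫⁻ x, k θ x * g x ∂ρ = g θ) (hg1 : ∫⁻ x, g x ∂ρ = 1)
    {it : ℕ → Ω → Ω → ℝ≥0∞} (hit0 : it 0 = k)
    (hit : ∀ m θ x, it (m + 1) θ x = ∫⁻ u, k θ u * it m u x ∂ρ) :
    ∃ (M : Ω → ℝ≥0) (r : ℝ≥0), r < 1 ∧ ∀ m x, V x ≠ ∞ →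
      ∫⁻ θ, ((it m θ x - g θ) + (g θ - it m θ x)) ∂ρ ≤ (M x : ℝ≥0∞) * (r : ℝ≥0∞) ^ (m + 1) := by
  have hkx : ∀ x, Measurable fun θ => k θ x := fun x =>
    hk.comp (measurable_id.prodMk measurable_const)
  obtain ⟨α, β, hα0, hα1, hβ0, hpair⟩ := exists_weighted_dist_le hk hV hγ hmass hdrift hmin
  have hVg := lintegral_mul_ne_top_of_drift hk hV hγ hmass hdrift hg hgV hinv (by simp [hg1])
  have hWm : Measurable fun θ => 1 + (β : ℝ≥0∞) * V θ := by fun_prop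
  have hα0' : (α : ℝ≥0∞) ≠ 0 := by exact_mod_cast hα0.ne'
  obtain ⟨I, hI⟩ : ∃ I : Ω → ℝ≥0∞, I = fun x => ∫⁻ θ, (1 + β * V θ) * (k θ x + g θ) ∂ρ := ⟨_, rfl⟩
  have hIfin : ∀ x, V x ≠ ∞ → I x ≠ ∞ := fun x hx => by
    have hx' := hkx x
    have : I x = (∫⁻ θ, k θ x ∂ρ + ∫⁻ θ, g θ ∂ρ) +
        β * (∫⁻ θ, V θ * k θ x ∂ρ + ∫⁻ θ, V θ * g θ ∂ρ) := by
      rw [hI, ← lintegral_add_left (by fun_prop), ← lintegral_add_left (by fun_prop),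
        ← lintegral_const_mul _ (by fun_prop), ← lintegral_add_left (by fun_prop)]
      refine lintegral_congr fun θ => ?_
      ring
    rw [this, hmass x hx, hg1]
    have hVk : ∫⁻ θ, V θ * k θ x ∂ρ ≠ ∞ := ne_top_of_le_ne_top
      (ENNReal.add_ne_top.mpr ⟨ENNReal.mul_ne_top ENNReal.coe_ne_top hx, ENNReal.coe_ne_top⟩)
      (hdrift x)
    exact ENNReal.add_ne_top.mpr ⟨by simp, ENNReal.mul_ne_top ENNReal.coe_ne_top
      (ENNReal.add_ne_top.mpr ⟨hVk, hVg⟩)⟩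
  have main : ∀ x, V x ≠ ∞ → ∀ m, Measurable (fun θ => it m θ x) ∧ ∫⁻ θ, it m θ x ∂ρ = 1 ∧
      (∀ θ, it m θ x ≠ 0 → V θ ≠ ∞) ∧
      ∫⁻ θ, (1 + β * V θ) * ((it m θ x - g θ) + (g θ - it m θ x)) ∂ρ
        ≤ (α : ℝ≥0∞) ^ m * I x := fun x hx m => by
    induction m with
    | zero =>
      rw [hit0]
      refine ⟨hkx x, hmass x hx, hkV x, ?_⟩
      rw [pow_zero, one_mul, hI]
      refine lintegral_mono fun θ => ?_
      gcongr <;> exact tsub_le_self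
    | succ m ih =>
      obtain ⟨ih1, ih2, ih3, ih4⟩ := ih
      simp_rw [hit]
      have hm : Measurable fun q : Ω × Ω => k q.1 q.2 * it m q.2 x :=
        hk.mul (ih1.comp measurable_snd)
      refine ⟨hm.lintegral_prod_right', ?_, fun θ h0 => ?_, ?_⟩
      · rw [lintegral_lintegral_swap hm.aemeasurable]
        rw [← ih2]
        refine lintegral_congr fun u => ?_
        rw [lintegral_mul_const _ (hkx u)]
        rcases eq_or_ne (it m u x) 0 with h0 | h0
        · simp [h0]
        · rw [hmass u (ih3 u h0), one_mul]
      · by_contra hV'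
        refine h0 ?_
        have : ∀ u, k θ u = 0 := fun u => by
          by_contra h
          exact hkV u θ h hV'
        simp [this]
      · have := lintegral_weight_mul_dist_le hk hWm hpair ih1 hg (ih2.trans hg1.symm)
          (by simp [ih2])
        simp_rw [hinv] at this
        refine this.trans ?_
        rw [pow_succ', mul_assoc]
        gcongr
  refine ⟨fun x => (I x).toNNReal / α, α, hα1, fun m x hx => ?_⟩
  refine (lintegral_mono fun θ => ?_).trans ((main x hx m).2.2.2.trans (le_of_eq ?_))
  · exact le_mul_of_one_le_left' le_self_add
  · rw [ENNReal.coe_div hα0.ne', ENNReal.coe_toNNReal (hIfin x hx), pow_succ', ← mul_assoc,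
      ENNReal.div_mul_cancel hα0' ENNReal.coe_ne_top, mul_comm]

end Harris

/-! ### Lebesgue integrals over finite products and linear substitutions -/

lemma lintegral_fin_nat_prod_eq_prod {n : ℕ} {E : Type*} [MeasurableSpace E]
    (μ : Fin n → Measure E) [∀ i, SigmaFinite (μ i)] {f : Fin n → E → ℝ≥0∞}
    (hf : ∀ i, Measurable (f i)) :
    ∫⁻ x : Fin n → E, ∏ i, f i (x i) ∂(Measure.pi μ) = ∏ i, ∫⁻ x, f i x ∂(μ i) := by
  induction n with
  | zero => simp
  | succ n ih =>
    rw [← ((measurePreserving_piFinSuccAbove μ 0).symm).lintegral_comp_emb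
      (MeasurableEquiv.measurableEmbedding _)]
    have : ∀ q : E × (Fin n → E),
        ∏ i, f i ((MeasurableEquiv.piFinSuccAbove (fun _ => E) 0).symm q i)
          = f 0 q.1 * ∏ i : Fin n, f i.succ (q.2 i) := fun q => by
      simp_rw [MeasurableEquiv.piFinSuccAbove_symm_apply, Fin.insertNthEquiv,
        Fin.prod_univ_succ, Fin.insertNth_zero, Equiv.coe_fn_mk, Fin.cons_succ, Fin.cons_zero]
      rfl
    simp_rw [this]
    rw [lintegral_prod_mul (f := f 0) (g := fun y : Fin n → E => ∏ i : Fin n, f i.succ (y i))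
      (hf 0).aemeasurable (Finset.measurable_prod _ fun i _ =>
        (hf i.succ).comp (measurable_pi_apply i)).aemeasurable, Fin.prod_univ_succ]
    congr 1
    exact ih _ fun i => hf i.succ

lemma lintegral_pi_prod {ι : Type*} [Fintype ι] {E : Type*} [MeasurableSpace E]
    (μ : ι → Measure E) [∀ i, SigmaFinite (μ i)] {f : ι → E → ℝ≥0∞}
    (hf : ∀ i, Measurable (f i)) :
    ∫⁻ x : ι → E, ∏ i, f i (x i) ∂(Measure.pi μ) = ∏ i, ∫⁻ x, f i x ∂(μ i) := by
  let e := (Fintype.equivFin ι).symm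
  rw [← (measurePreserving_piCongrLeft _ e).lintegral_comp_emb
    (MeasurableEquiv.measurableEmbedding _)]
  simp_rw [← e.prod_comp, MeasurableEquiv.coe_piCongrLeft, Equiv.piCongrLeft_apply_apply]
  exact lintegral_fin_nat_prod_eq_prod _ fun i => hf (e i)

/-- Linear change of variables. -/
lemma lintegral_eq_det_mul {ι : Type*} [Fintype ι] [DecidableEq ι] {M : Matrix ι ι ℝ}
    (hM : M.det ≠ 0) {g : (ι → ℝ) → ℝ≥0∞} (hg : Measurable g) :
    ∫⁻ x, g x = ENNReal.ofReal |M.det| * ∫⁻ x, g (M *ᵥ x) := by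
  have h := Real.map_matrix_volume_pi_eq_smul_volume_pi hM
  have hm : Measurable (Matrix.toLin' M) := (LinearMap.continuous_on_pi _).measurable
  have h2 : ∫⁻ x, g (M *ᵥ x) = ENNReal.ofReal |(M.det)⁻¹| * ∫⁻ x, g x := by
    have : ∫⁻ x, g (M *ᵥ x) = ∫⁻ x, g x ∂(Measure.map (Matrix.toLin' M) volume) := by
      rw [lintegral_map hg hm]
      rfl
    rw [this, h, lintegral_smul_measure, smul_eq_mul]
  rw [h2, ← mul_assoc, ← ENNReal.ofReal_mul (abs_nonneg _), ← abs_mul, mul_inv_cancel₀ hM]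
  simp

/-- The volume on matrices agrees with the one on families indexed by pairs. -/
lemma lintegral_curry {ι κ : Type*} [Fintype ι] [Fintype κ] (g : (ι → κ → ℝ) → ℝ≥0∞) :
    ∫⁻ β : ι → κ → ℝ, g β = ∫⁻ b : ι × κ → ℝ, g (fun i j => b (i, j)) := by
  have hmp : MeasurePreserving (MeasurableEquiv.curry ι κ ℝ).symm volume volume := by
    refine ⟨(MeasurableEquiv.curry ι κ ℝ).symm.measurable, (Measure.pi_eq fun s _ => ?_).symm⟩
    rw [MeasurableEquiv.map_apply]
    have : (MeasurableEquiv.curry ι κ ℝ).symm ⁻¹' (Set.univ.pi s)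
        = Set.univ.pi fun i => Set.univ.pi fun j => s (i, j) := by
      ext β
      simp [MeasurableEquiv.coe_curry_symm, Set.mem_pi, Function.uncurry, Prod.forall]
    rw [this, volume_pi_pi]
    simp_rw [volume_pi_pi]
    rw [Fintype.prod_prod_type]
  exact (hmp.symm.lintegral_comp_emb (MeasurableEquiv.measurableEmbedding _) g).symm

/-! ### The Gaussian integral -/

/-- The integral of the standard Gaussian kernel on `ℝ ^ ι`. -/
noncomputable def gaussConst (ι : Type*) [Fintype ι] : ℝ≥0∞ :=
  ∫⁻ x : ι → ℝ, ENNReal.ofReal (Real.exp (-(x ⬝ᵥ x) / 2))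

lemma gaussConst_ne_zero (ι : Type*) [Fintype ι] : gaussConst ι ≠ 0 := by
  rw [gaussConst, Ne, lintegral_eq_zero_iff (by unfold dotProduct; fun_prop)]
  intro h
  have : ∀ᵐ x : ι → ℝ, False := h.mono fun x hx => by
    have := Real.exp_pos (-(x ⬝ᵥ x) / 2)
    simp only [Pi.zero_apply, ENNReal.ofReal_eq_zero] at hx
    linarith
  rw [Filter.eventually_false_iff_eq_bot] at this
  exact (NeZero.ne (volume : Measure (ι → ℝ))) (ae_eq_bot.mp this)

lemma gaussConst_ne_top (ι : Type*) [Fintype ι] : gaussConst ι ≠ ∞ := by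
  have : ∀ x : ι → ℝ, ENNReal.ofReal (Real.exp (-(x ⬝ᵥ x) / 2))
      = ∏ i, ENNReal.ofReal (Real.exp (-(1 / 2) * (x i) ^ 2)) := fun x => by
    rw [← ENNReal.ofReal_prod_of_nonneg fun _ _ => (Real.exp_pos _).le, ← Real.exp_sum]
    congr 2
    rw [dotProduct, ← Finset.mul_sum]
    simp_rw [pow_two]
    ring
  simp_rw [gaussConst, this]
  rw [volume_pi, lintegral_pi_prod (fun _ : ι => volume)
    (f := fun _ t => ENNReal.ofReal (Real.exp (-(1 / 2) * t ^ 2))) fun _ => by fun_prop]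
  refine ENNReal.prod_ne_top fun i _ => ?_
  exact (integrable_exp_neg_mul_sq (by norm_num : (0 : ℝ) < 1 / 2)).lintegral_lt_top.ne

/-- The Gaussian integral with a positive definite quadratic form. -/
lemma lintegral_exp_neg_quadForm {ι : Type*} [Fintype ι] [DecidableEq ι] {M : Matrix ι ι ℝ}
    (hM : M.PosDef) :
    ∫⁻ x : ι → ℝ, ENNReal.ofReal (Real.exp (-(x ⬝ᵥ M *ᵥ x) / 2))
      = gaussConst ι * ENNReal.ofReal (M.det ^ (-(1 / 2) : ℝ)) := by
  obtain ⟨B, hB⟩ : ∃ B : Matrix ι ι ℝ, M = Bᵀ * B := by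
    open scoped MatrixOrder in
    obtain ⟨B, hB⟩ := CStarAlgebra.nonneg_iff_eq_star_mul_self.mp hM.posSemidef.nonneg
    exact ⟨B, hB⟩
  have hdet : M.det = B.det ^ 2 := by rw [hB, Matrix.det_mul, Matrix.det_transpose, pow_two]
  have hpos := hM.det_pos
  have hB0 : B.det ≠ 0 := fun h => by rw [hdet, h] at hpos; simp at hpos
  have hq : ∀ x, x ⬝ᵥ M *ᵥ x = (B *ᵥ x) ⬝ᵥ (B *ᵥ x) := fun x => by
    rw [hB, ← Matrix.mulVec_mulVec, Matrix.dotProduct_mulVec, Matrix.vecMul_transpose]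
  have hr : M.det ^ (-(1 / 2) : ℝ) = |B.det|⁻¹ := by
    rw [hdet, Real.rpow_neg (sq_nonneg _), ← Real.sqrt_eq_rpow, Real.sqrt_sq_eq_abs]
  simp_rw [hq]
  rw [gaussConst, lintegral_eq_det_mul (g := fun x => ENNReal.ofReal (Real.exp (-(x ⬝ᵥ x) / 2))) hB0
    (by unfold dotProduct; fun_prop), hr, mul_comm, ← mul_assoc,
    ← ENNReal.ofReal_mul (by positivity), inv_mul_cancel₀ (by positivity)]
  simp

/-- The Gaussian integral is unaffected by the location of the centre. -/
lemma lintegral_exp_neg_quadForm_sub {ι : Type*} [Fintype ι] [DecidableEq ι] {M : Matrix ι ι ℝ}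
    (hM : M.PosDef) (c : ι → ℝ) :
    ∫⁻ x : ι → ℝ, ENNReal.ofReal (Real.exp (-((x - c) ⬝ᵥ M *ᵥ (x - c)) / 2))
      = gaussConst ι * ENNReal.ofReal (M.det ^ (-(1 / 2) : ℝ)) := by
  rw [← lintegral_exp_neg_quadForm hM]
  exact lintegral_sub_right_eq_self
    (fun x : ι → ℝ => ENNReal.ofReal (Real.exp (-(x ⬝ᵥ M *ᵥ x) / 2))) c

/-! ### The inverse gamma integral -/

/-- The integral of the inverse gamma kernel `s ^ (-r) exp (-1 / (2 s))`. -/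
noncomputable def invGammaConst (r : ℝ) : ℝ≥0∞ :=
  ∫⁻ s in Set.Ioi (0 : ℝ), ENNReal.ofReal (s ^ (-r) * Real.exp (-(1 / s) / 2))

lemma invGammaConst_ne_zero (r : ℝ) : invGammaConst r ≠ 0 := by
  rw [invGammaConst, Ne, lintegral_eq_zero_iff (by fun_prop)]
  intro h
  have : ∀ᵐ s : ℝ ∂(volume.restrict (Set.Ioi 0)), False := by
    filter_upwards [h, ae_restrict_mem measurableSet_Ioi] with s hs h0
    have := mul_pos (Real.rpow_pos_of_pos h0 (-r)) (Real.exp_pos (-(1 / s) / 2))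
    simp only [Pi.zero_apply, ENNReal.ofReal_eq_zero] at hs
    linarith
  rw [Filter.eventually_false_iff_eq_bot, ae_eq_bot, Measure.restrict_eq_zero] at this
  simp at this

lemma invGammaConst_ne_top {r : ℝ} (hr : 1 < r) : invGammaConst r ≠ ∞ := by
  have h1 : IntegrableOn (fun x : ℝ => x ^ (r - 2) * Real.exp (-(1 / 2) * x)) (Set.Ioi 0) := by
    have := integrableOn_rpow_mul_exp_neg_mul_rpow (s := r - 2) (p := 1) (b := 1 / 2)
      (by linarith) (by norm_num) (by norm_num)
    simpa using this
  have h2 := (integrableOn_Ioi_comp_rpow_iff'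
    (fun x : ℝ => x ^ (r - 2) * Real.exp (-(1 / 2) * x)) (p := -1) (by norm_num)).mpr h1
  have h3 : IntegrableOn (fun s : ℝ => s ^ (-r) * Real.exp (-(1 / s) / 2)) (Set.Ioi 0) := by
    refine h2.congr_fun (fun s hs => ?_) measurableSet_Ioi
    have hs0 : (0 : ℝ) < s := hs
    dsimp only
    rw [smul_eq_mul, ← mul_assoc, ← Real.rpow_mul hs0.le, ← Real.rpow_add hs0, Real.rpow_neg_one]
    congr 2
    · ring
    · field_simp
  exact h3.lintegral_lt_top.ne

lemma lintegral_inv_gamma (r : ℝ) {δ : ℝ} (hδ : 0 < δ) :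
    ∫⁻ s in Set.Ioi (0 : ℝ), ENNReal.ofReal (s ^ (-r) * Real.exp (-(δ / s) / 2))
      = invGammaConst r * ENNReal.ofReal (δ ^ (1 - r)) := by
  rw [invGammaConst, ← lintegral_indicator measurableSet_Ioi,
    ← lintegral_indicator measurableSet_Ioi]
  have hm : Measurable ((Set.Ioi (0 : ℝ)).indicator fun s =>
      ENNReal.ofReal (s ^ (-r) * Real.exp (-(δ / s) / 2))) :=
    Measurable.indicator (by fun_prop) measurableSet_Ioi
  conv_lhs => rw [← Real.smul_map_volume_mul_left hδ.ne']
  rw [lintegral_smul_measure, lintegral_map hm (by fun_prop), smul_eq_mul, abs_of_pos hδ, mul_comm,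
    ← lintegral_mul_const' _ _ ENNReal.ofReal_ne_top,
    ← lintegral_mul_const' _ _ ENNReal.ofReal_ne_top]
  refine lintegral_congr fun s => ?_
  by_cases hs : 0 < s
  · rw [Set.indicator_of_mem (by simpa using mul_pos hδ hs), Set.indicator_of_mem (by simpa using hs),
      ← ENNReal.ofReal_mul (by positivity), ← ENNReal.ofReal_mul (by positivity)]
    congr 1
    rw [Real.mul_rpow hδ.le hs.le, sub_eq_add_neg, Real.rpow_add hδ, Real.rpow_one]
    have : δ / (δ * s) = 1 / s := by field_simp
    rw [this]
    ring
  · have hs' : ¬ 0 < δ * s := fun h => hs (pos_of_mul_pos_right h hδ.le)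
    rw [Set.indicator_of_notMem (by simpa using hs'), Set.indicator_of_notMem (by simpa using hs)]
    simp

/-! ### The inverse Wishart integral -/

lemma continuous_symMatrix {d : ℕ} : Continuous (symMatrix : SymCoord d → _) := by
  unfold symMatrix
  exact continuous_matrix fun i j => continuous_apply _

lemma symMatrix_isSymm {d : ℕ} (v : SymCoord d) : (symMatrix v).IsSymm := by
  ext i j
  simp only [symMatrix, Matrix.transpose_apply, Matrix.of_apply]
  congr 2
  simp [min_comm, max_comm]

lemma measurable_det_symMatrix {d : ℕ} : Measurable fun v : SymCoord d => (symMatrix v).det :=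
  (continuous_symMatrix.matrix_det).measurable

/-- Positive definiteness is the intersection of a closed condition (positive semidefiniteness)
with an open one (non-vanishing determinant). -/
lemma measurableSet_posDef {d : ℕ} : MeasurableSet {v : SymCoord d | (symMatrix v).PosDef} := by
  have : {v : SymCoord d | (symMatrix v).PosDef}
      = (⋂ x : Fin d → ℝ, {v | 0 ≤ x ⬝ᵥ symMatrix v *ᵥ x}) ∩ {v | (symMatrix v).det ≠ 0} := by
    ext v
    have hs : (symMatrix v).IsHermitian := symMatrix_isSymm v
    constructor
    · intro h
      exact ⟨Set.mem_iInter.mpr fun x => h.posSemidef.dotProduct_mulVec_nonneg x, h.det_pos.ne'⟩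
    · rintro ⟨h1, h2⟩
      have : (symMatrix v).PosSemidef :=
        .of_dotProduct_mulVec_nonneg hs fun x => Set.mem_iInter.mp h1 x
      exact this.posDef_iff_det_ne_zero.mpr h2
  rw [this]
  refine (IsClosed.measurableSet ?_).inter ?_
  · refine isClosed_iInter fun x => isClosed_le continuous_const ?_
    exact continuous_const.dotProduct (continuous_symMatrix.matrix_mulVec continuous_const)
  · exact (isOpen_ne.preimage continuous_symMatrix.matrix_det).measurableSet

lemma measurable_inv_symMatrix {d : ℕ} (i j : Fin d) :
    Measurable fun v : SymCoord d => (symMatrix v)⁻¹ i j := by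
  simp_rw [Matrix.inv_def, Ring.inverse_eq_inv', Matrix.smul_apply, smul_eq_mul]
  refine measurable_det_symMatrix.inv.mul ?_
  exact (continuous_symMatrix.matrix_adjugate.matrix_elem i j).measurable

open Classical in
/-- The inverse Wishart kernel `|Σ| ^ (-q) exp (-tr (Σ⁻¹ S) / 2)`, supported on positive definite
`Σ`. -/
noncomputable def wishartKernel {d : ℕ} (q : ℝ) (S : Matrix (Fin d) (Fin d) ℝ) (v : SymCoord d) :
    ℝ≥0∞ :=
  if (symMatrix v).PosDef then
    ENNReal.ofReal ((symMatrix v).det ^ (-q) * Real.exp (-((symMatrix v)⁻¹ * S).trace / 2))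
  else 0

lemma measurable_wishartKernel {d : ℕ} (q : ℝ) (S : Matrix (Fin d) (Fin d) ℝ) :
    Measurable (wishartKernel q S) := by
  refine Measurable.ite measurableSet_posDef (ENNReal.measurable_ofReal.comp ?_) measurable_const
  refine (measurable_det_symMatrix.pow_const _).mul (Real.measurable_exp.comp ?_)
  refine Measurable.div_const (Measurable.neg ?_) _
  simp_rw [Matrix.trace, Matrix.diag, Matrix.mul_apply]
  exact Finset.measurable_sum _ fun i _ => Finset.measurable_sum _ fun j _ =>
    (measurable_inv_symMatrix i j).mul_const _

section Blocks

variable {m : Type*} [Fintype m] [DecidableEq m]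

/-- The symmetric matrix with corner `σ`, border `b` and lower right block `W`. -/
def bordered (σ : ℝ) (b : m → ℝ) (W : Matrix m m ℝ) : Matrix (Unit ⊕ m) (Unit ⊕ m) ℝ :=
  Matrix.fromBlocks (Matrix.of fun _ _ => σ) (Matrix.replicateRow Unit b)
    (Matrix.replicateCol Unit b) W

lemma det_bordered {W : Matrix m m ℝ} (hW : W.PosDef) (σ : ℝ) (b : m → ℝ) :
    (bordered σ b W).det = W.det * (σ - b ⬝ᵥ W⁻¹ *ᵥ b) := by
  have := hW.isUnit.invertible
  rw [bordered, Matrix.det_fromBlocks₂₂]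
  congr 1
  rw [Matrix.det_unique, Matrix.invOf_eq_nonsing_inv]
  simp [Matrix.mul_apply, dotProduct, Matrix.mulVec, Finset.sum_mul, Finset.mul_sum]
  rw [Finset.sum_comm]
  simp_rw [mul_assoc]

lemma posDef_bordered_iff {W : Matrix m m ℝ} (hW : W.PosDef) (σ : ℝ) (b : m → ℝ) :
    (bordered σ b W).PosDef ↔ 0 < σ - b ⬝ᵥ W⁻¹ *ᵥ b := by
  have := hW.isUnit.invertible
  have h1 : (bordered σ b W).PosSemidef ↔ 0 ≤ σ - b ⬝ᵥ W⁻¹ *ᵥ b := by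
    have h := Matrix.PosDef.fromBlocks₂₂ (Matrix.of fun _ _ => σ : Matrix Unit Unit ℝ)
      (Matrix.replicateRow Unit b) hW
    rw [show (Matrix.replicateRow Unit b)ᴴ = Matrix.replicateCol Unit b by ext; simp] at h
    rw [bordered, h]
    have : (Matrix.of fun _ _ => σ : Matrix Unit Unit ℝ)
        - Matrix.replicateRow Unit b * W⁻¹ * Matrix.replicateCol Unit b
        = Matrix.diagonal fun _ => σ - b ⬝ᵥ W⁻¹ *ᵥ b := by
      ext
      simp [Matrix.mul_apply, dotProduct, Matrix.mulVec, Finset.sum_mul, Finset.mul_sum]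
      rw [Finset.sum_comm]
      simp_rw [mul_assoc]
    rw [this, Matrix.posSemidef_diagonal_iff]
    simp
  constructor
  · intro h
    have h2 := h.det_pos
    rw [det_bordered hW] at h2
    exact pos_of_mul_pos_right h2 hW.det_pos.le
  · intro h
    rw [(h1.mpr h.le).posDef_iff_det_ne_zero, det_bordered hW]
    exact (mul_pos hW.det_pos h).ne'

/-- The trace of `Σ⁻¹ S` in block form, where `Σ` is parametrized by its lower right block `W`,
the regression vector `c` and the Schur complement `s`. -/
lemma trace_inv_bordered_mul {W : Matrix m m ℝ} (hW : W.PosDef) {s : ℝ} (hs : s ≠ 0) (c : m → ℝ)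
    (a : ℝ) (g : m → ℝ) (T : Matrix m m ℝ) :
    ((bordered (s + c ⬝ᵥ W *ᵥ c) (W *ᵥ c) W)⁻¹ * bordered a g T).trace
      = (a - 2 * (c ⬝ᵥ g) + c ⬝ᵥ T *ᵥ c) / s + (W⁻¹ * T).trace := by
  have hWu : IsUnit W.det := (Matrix.isUnit_iff_isUnit_det W).mp hW.isUnit
  have hWs : Wᵀ = W := hW.isHermitian
  obtain ⟨r, hr⟩ : ∃ r, r = W *ᵥ c := ⟨_, rfl⟩
  have hr1 : ∀ j, ∑ k, c k * W k j = r j := fun j => by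
    have : c ᵥ* W = r := by rw [hr, ← Matrix.vecMul_transpose, hWs]
    exact congrFun this j
  have hr2 : ∀ i, ∑ k, W⁻¹ i k * r k = c i := fun i => by
    have : W⁻¹ *ᵥ r = c := by
      rw [hr, Matrix.mulVec_mulVec, Matrix.nonsing_inv_mul _ hWu, Matrix.one_mulVec]
    exact congrFun this i
  have hr3 : ∀ i j, ∑ k, W⁻¹ i k * W k j = (1 : Matrix m m ℝ) i j := fun i j => by
    rw [← Matrix.nonsing_inv_mul _ hWu]; rfl
  obtain ⟨t, ht⟩ : ∃ t, t = ∑ k, c k * r k := ⟨_, rfl⟩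
  have ht' : c ⬝ᵥ r = t := ht.symm
  have hinv : (bordered (s + c ⬝ᵥ W *ᵥ c) (W *ᵥ c) W)⁻¹
      = Matrix.fromBlocks (Matrix.of fun _ _ => 1 / s)
        (Matrix.replicateRow Unit fun j => -(c j / s))
        (Matrix.replicateCol Unit fun j => -(c j / s))
        (Matrix.of fun i j => W⁻¹ i j + c i / s * c j) := by
    refine Matrix.inv_eq_left_inv ?_
    rw [← hr, ht', bordered, Matrix.fromBlocks_multiply, ← Matrix.fromBlocks_one]
    congr 1
    · ext
      simp only [Matrix.add_apply, Matrix.mul_apply, Matrix.of_apply, Matrix.replicateRow_apply,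
        Matrix.replicateCol_apply, Finset.univ_unique, Finset.sum_singleton, Matrix.one_apply_eq]
      have : ∑ x, -(c x / s) * r x = -(t / s) := by
        rw [ht, Finset.sum_div, ← Finset.sum_neg_distrib]
        exact Finset.sum_congr rfl fun k _ => by ring
      rw [this]
      field_simp
      ring
    · ext _ j
      simp only [Matrix.add_apply, Matrix.mul_apply, Matrix.of_apply, Matrix.replicateRow_apply,
        Finset.univ_unique, Finset.sum_singleton, Matrix.zero_apply]
      have : ∑ x, -(c x / s) * W x j = -(r j / s) := by
        rw [← hr1, Finset.sum_div, ← Finset.sum_neg_distrib]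
        exact Finset.sum_congr rfl fun k _ => by ring
      rw [this]
      ring
    · ext i _
      simp only [Matrix.add_apply, Matrix.mul_apply, Matrix.of_apply,
        Matrix.replicateCol_apply, Finset.univ_unique, Finset.sum_singleton, Matrix.zero_apply]
      have : ∑ x, (W⁻¹ i x + c i / s * c x) * r x = c i + c i / s * t := by
        rw [← hr2 i, ht, Finset.mul_sum, ← Finset.sum_add_distrib]
        exact Finset.sum_congr rfl fun k _ => by rw [hr2 i]; ring
      rw [this]
      field_simp
      ring
    · ext i j
      simp only [Matrix.add_apply, Matrix.mul_apply, Matrix.of_apply, Matrix.replicateRow_apply,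
        Matrix.replicateCol_apply, Finset.univ_unique, Finset.sum_singleton]
      have : ∑ x, (W⁻¹ i x + c i / s * c x) * W x j
          = (1 : Matrix m m ℝ) i j + c i / s * r j := by
        rw [← hr3 i j, ← hr1 j, Finset.mul_sum, ← Finset.sum_add_distrib]
        exact Finset.sum_congr rfl fun k _ => by ring
      rw [this]
      ring
  rw [hinv, bordered, Matrix.fromBlocks_multiply]
  simp only [Matrix.trace, Matrix.diag_apply, Fintype.sum_sum_type, Matrix.fromBlocks_apply₁₁,
    Matrix.fromBlocks_apply₂₂, Matrix.add_apply, Matrix.mul_apply, Matrix.of_apply,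
    Matrix.replicateRow_apply, Matrix.replicateCol_apply, Finset.univ_unique,
    Finset.sum_singleton, dotProduct, Matrix.mulVec]
  have e1 : ∑ x, -(c x / s) * g x = -((∑ x, c x * g x) / s) := by
    rw [Finset.sum_div, ← Finset.sum_neg_distrib]
    exact Finset.sum_congr rfl fun k _ => by ring
  have e2 : ∑ i, (-(c i / s) * g i + ∑ k, (W⁻¹ i k + c i / s * c k) * T k i)
      = -((∑ x, c x * g x) / s) + (∑ i, ∑ k, W⁻¹ i k * T k i)
        + (∑ k, c k * ∑ i, T k i * c i) / s := by
    rw [Finset.sum_add_distrib, e1, add_assoc]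
    congr 1
    have : (∑ k, c k * ∑ i, T k i * c i) / s = ∑ i, ∑ k, c i / s * c k * T k i := by
      rw [Finset.sum_comm, Finset.sum_div]
      refine Finset.sum_congr rfl fun k _ => ?_
      rw [Finset.mul_sum, Finset.sum_div]
      exact Finset.sum_congr rfl fun i _ => by ring
    rw [this, ← Finset.sum_add_distrib]
    refine Finset.sum_congr rfl fun i _ => ?_
    rw [← Finset.sum_add_distrib]
    exact Finset.sum_congr rfl fun k _ => by ring
  rw [e1, e2]
  ring

end Blocks

/-- Splitting off the first row and column. -/
def borderIndex (d : ℕ) : Unit ⊕ Fin d ≃ Fin (d + 1) where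
  toFun := Sum.elim (fun _ => 0) Fin.succ
  invFun := Fin.cases (.inl ()) .inr
  left_inv := by rintro (_ | _) <;> rfl
  right_inv i := by cases i using Fin.cases <;> rfl

/-- Splitting the entries on and above the diagonal into the corner, the first row and the rest. -/
noncomputable def symIndex (d : ℕ) :
    Unit ⊕ (Fin d ⊕ {q : Fin d × Fin d // q.1 ≤ q.2}) ≃
      {q : Fin (d + 1) × Fin (d + 1) // q.1 ≤ q.2} :=
  Equiv.ofBijective
    (Sum.elim (fun _ => ⟨(0, 0), le_rfl⟩) (Sum.elim (fun j => ⟨(0, j.succ), Fin.zero_le _⟩)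
      fun q => ⟨(q.1.1.succ, q.1.2.succ), Fin.succ_le_succ_iff.mpr q.2⟩)) <| by
    constructor
    · rintro (_ | _ | ⟨⟨_, _⟩, _⟩) (_ | _ | ⟨⟨_, _⟩, _⟩) h <;>
        simp_all [Fin.succ_ne_zero, (Fin.succ_ne_zero _).symm]
    · rintro ⟨⟨i, j⟩, hij⟩
      cases i using Fin.cases with
      | zero =>
        cases j using Fin.cases with
        | zero => exact ⟨.inl (), rfl⟩
        | succ j => exact ⟨.inr (.inl j), rfl⟩
      | succ i =>
        cases j using Fin.cases with
        | zero => exact absurd hij (by simp)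
        | succ j => exact ⟨.inr (.inr ⟨(i, j), Fin.succ_le_succ_iff.mp hij⟩), rfl⟩

/-- Coordinates of the bordered symmetric matrix with corner `σ`, border `b` and lower right
block `w`. -/
noncomputable def symCons {d : ℕ} (σ : ℝ) (b : Fin d → ℝ) (w : SymCoord d) : SymCoord (d + 1) :=
  fun q => Sum.elim (fun _ => σ) (Sum.elim b w) ((symIndex d).symm q)

lemma symMatrix_symCons {d : ℕ} (σ : ℝ) (b : Fin d → ℝ) (w : SymCoord d) :
    symMatrix (symCons σ b w)
      = (bordered σ b (symMatrix w)).submatrix (borderIndex d).symm (borderIndex d).symm := by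
  have key : ∀ s, symCons σ b w (symIndex d s) = Sum.elim (fun _ => σ) (Sum.elim b w) s := fun s => by
    simp [symCons]
  have h00 := key (.inl ())
  have h0 := fun j => key (.inr (.inl j))
  have h1 := fun q => key (.inr (.inr q))
  ext i j
  simp only [symMatrix, Matrix.of_apply, Matrix.submatrix_apply]
  cases i using Fin.cases with
  | zero =>
    cases j using Fin.cases with
    | zero => exact h00
    | succ j =>
      refine Eq.trans ?_ (h0 j)
      congr 1
  | succ i =>
    cases j using Fin.cases with
    | zero =>
      refine Eq.trans ?_ (h0 i)
      congr 1
    | succ j =>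
      refine Eq.trans ?_ (h1 ⟨(min i j, max i j), min_le_max⟩)
      congr 1
      refine Subtype.ext (Prod.ext ?_ ?_)
      · exact ((Fin.strictMono_succ (n := d)).monotone.map_min).symm
      · exact ((Fin.strictMono_succ (n := d)).monotone.map_max).symm

lemma measurable_symCons {d : ℕ} : Measurable fun t : SymCoord d × (Fin d → ℝ) × ℝ =>
    symCons t.2.2 t.2.1 t.1 := by
  refine measurable_pi_lambda _ fun q => ?_
  unfold symCons
  rcases (symIndex d).symm q with _ | j | r
  · exact measurable_snd.comp measurable_snd
  · change Measurable fun t : SymCoord d × (Fin d → ℝ) × ℝ => t.2.1 j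
    fun_prop
  · change Measurable fun t : SymCoord d × (Fin d → ℝ) × ℝ => t.1 r
    fun_prop

lemma lintegral_symCoord_succ {d : ℕ} {f : SymCoord (d + 1) → ℝ≥0∞} (hf : Measurable f) :
    ∫⁻ v, f v = ∫⁻ w : SymCoord d, ∫⁻ b : Fin d → ℝ, ∫⁻ σ : ℝ, f (symCons σ b w) := by
  have h1 := (volume_measurePreserving_piCongrLeft (fun _ => ℝ) (symIndex d))
  have h2 := (volume_measurePreserving_sumPiEquivProdPi_symm
    (fun _ : Unit ⊕ (Fin d ⊕ {q : Fin d × Fin d // q.1 ≤ q.2}) => ℝ))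
  have h3 := (volume_measurePreserving_sumPiEquivProdPi_symm
    (fun _ : Fin d ⊕ {q : Fin d × Fin d // q.1 ≤ q.2} => ℝ))
  have hv : ∀ x, MeasurableEquiv.piCongrLeft (fun _ => ℝ) (symIndex d) x
      = fun q => x ((symIndex d).symm q) := fun x => by
    ext q
    obtain ⟨s, rfl⟩ := (symIndex d).surjective q
    rw [MeasurableEquiv.coe_piCongrLeft, Equiv.piCongrLeft_apply_apply, Equiv.symm_apply_apply]
  have hm := measurable_symCons (d := d)
  rw [← h1.lintegral_comp_emb (MeasurableEquiv.measurableEmbedding _),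
    ← h2.lintegral_comp_emb (MeasurableEquiv.measurableEmbedding _), Measure.volume_eq_prod,
    lintegral_prod_symm _ (Measurable.aemeasurable (by
      exact hf.comp ((MeasurableEquiv.measurable _).comp (MeasurableEquiv.measurable _)))),
    ← h3.lintegral_comp_emb (MeasurableEquiv.measurableEmbedding _), Measure.volume_eq_prod]
  have hfun := (volume_preserving_funUnique Unit ℝ).symm
  have step : ∀ (b : Fin d → ℝ) (w : SymCoord d),
      ∫⁻ x : Unit → ℝ, f (MeasurableEquiv.piCongrLeft (fun _ => ℝ) (symIndex d)
        ((MeasurableEquiv.sumPiEquivProdPi fun _ => ℝ).symm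
          (x, (MeasurableEquiv.sumPiEquivProdPi fun _ => ℝ).symm (b, w))))
      = ∫⁻ σ : ℝ, f (symCons σ b w) := fun b w => by
    rw [← hfun.lintegral_comp_emb (MeasurableEquiv.measurableEmbedding _)]
    refine lintegral_congr fun σ => ?_
    rw [hv]
    rfl
  rw [lintegral_prod_symm]
  · exact lintegral_congr fun w => lintegral_congr fun b => step b w
  · refine Measurable.aemeasurable ?_
    have : (fun t : (Fin d → ℝ) × SymCoord d => ∫⁻ x : Unit → ℝ,
        f (MeasurableEquiv.piCongrLeft (fun _ => ℝ) (symIndex d)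
        ((MeasurableEquiv.sumPiEquivProdPi fun _ => ℝ).symm
          (x, (MeasurableEquiv.sumPiEquivProdPi fun _ => ℝ).symm t))))
        = fun t => ∫⁻ σ : ℝ, f (symCons σ t.1 t.2) := funext fun t => step t.1 t.2
    change Measurable (fun t : (Fin d → ℝ) × SymCoord d => ∫⁻ x : Unit → ℝ,
        f (MeasurableEquiv.piCongrLeft (fun _ => ℝ) (symIndex d)
        ((MeasurableEquiv.sumPiEquivProdPi fun _ => ℝ).symm
          (x, (MeasurableEquiv.sumPiEquivProdPi fun _ => ℝ).symm t))))
    rw [this]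
    have hm' : Measurable fun t : ((Fin d → ℝ) × SymCoord d) × ℝ => f (symCons t.2 t.1.1 t.1.2) :=
      (hf.comp hm).comp (f := fun t : ((Fin d → ℝ) × SymCoord d) × ℝ => (t.1.2, t.1.1, t.2))
        (by fun_prop)
    exact hm'.lintegral_prod_right'

lemma measurable_exp_neg_inv_smul {d : ℕ} (T : Matrix (Fin d) (Fin d) ℝ) (c₀ : Fin d → ℝ) :
    Measurable fun t : (Fin d → ℝ) × ℝ =>
      ENNReal.ofReal (Real.exp (-((t.1 - c₀) ⬝ᵥ (t.2⁻¹ • T) *ᵥ (t.1 - c₀)) / 2)) := by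
  have h1 : Continuous fun x : Fin d → ℝ => (x - c₀) ⬝ᵥ T *ᵥ (x - c₀) :=
    (continuous_id.sub continuous_const).dotProduct
      (continuous_const.matrix_mulVec (continuous_id.sub continuous_const))
  have h2 : Measurable fun x : Fin d → ℝ => (x - c₀) ⬝ᵥ T *ᵥ (x - c₀) := h1.measurable
  simp_rw [Matrix.smul_mulVec, dotProduct_smul, smul_eq_mul]
  exact ENNReal.measurable_ofReal.comp (Real.measurable_exp.comp
    (((measurable_snd.inv.mul (h2.comp measurable_fst)).neg).div_const 2))

lemma ofReal_mul_lintegral_exp_neg_quadForm {d : ℕ} {T : Matrix (Fin d) (Fin d) ℝ} (hT : T.PosDef)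
    (c₀ : Fin d → ℝ) {s : ℝ} (hs : 0 < s) (q E : ℝ) :
    ENNReal.ofReal (s ^ (-q) * Real.exp E) * ∫⁻ c : Fin d → ℝ,
        ENNReal.ofReal (Real.exp (-((c - c₀) ⬝ᵥ (s⁻¹ • T) *ᵥ (c - c₀)) / 2))
      = gaussConst (Fin d) * ENNReal.ofReal (T.det ^ (-(1 / 2) : ℝ)) *
        ENNReal.ofReal (s ^ (-(q - (d : ℝ) / 2)) * Real.exp E) := by
  have hdT := hT.det_pos
  rw [lintegral_exp_neg_quadForm_sub (hT.smul (inv_pos.mpr hs)), mul_left_comm, mul_assoc,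
    ← ENNReal.ofReal_mul (by positivity), ← ENNReal.ofReal_mul (by positivity)]
  congr 2
  rw [Matrix.det_smul, Fintype.card_fin, Real.mul_rpow (by positivity) hdT.le,
    ← Real.rpow_natCast, Real.inv_rpow (by positivity),
    Real.inv_rpow (by positivity), ← Real.rpow_mul hs.le,
    ← Real.rpow_neg hs.le,
    show -(q - (d : ℝ) / 2) = -q + -((d : ℝ) * -(1 / 2)) by ring, Real.rpow_add hs]
  ring

/-- The inner part of the recursion for the inverse Wishart integral: integrating over the corner
and the border lowers the dimension and the exponent by one. -/
lemma lintegral_wishartKernel_symCons {d : ℕ} {q : ℝ} {a : ℝ} {g : Fin d → ℝ}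
    {T : Matrix (Fin d) (Fin d) ℝ} (hT : T.PosDef) {δ : ℝ} (hδ : δ = a - g ⬝ᵥ T⁻¹ *ᵥ g)
    (hδ0 : 0 < δ) (w : SymCoord d) :
    ∫⁻ b : Fin d → ℝ, ∫⁻ σ : ℝ, wishartKernel q
        ((bordered a g T).submatrix (borderIndex d).symm (borderIndex d).symm) (symCons σ b w)
      = wishartKernel (q - 1) T w * (gaussConst (Fin d) * invGammaConst (q - (d : ℝ) / 2)
          * ENNReal.ofReal (T.det ^ (-(1 / 2) : ℝ) * δ ^ (1 - (q - (d : ℝ) / 2)))) := by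
  obtain ⟨W, hWdef⟩ : ∃ W, W = symMatrix w := ⟨_, rfl⟩
  have hTu : IsUnit T.det := (Matrix.isUnit_iff_isUnit_det T).mp hT.isUnit
  have hTs : Tᵀ = T := hT.isHermitian
  have hkern : ∀ σ b, wishartKernel q
      ((bordered a g T).submatrix (borderIndex d).symm (borderIndex d).symm) (symCons σ b w)
      = open Classical in if (bordered σ b W).PosDef then ENNReal.ofReal ((bordered σ b W).det ^ (-q)
          * Real.exp (-((bordered σ b W)⁻¹ * bordered a g T).trace / 2)) else 0 := fun σ b => by
    have hpd : ((bordered σ b W).submatrix (borderIndex d).symm (borderIndex d).symm).PosDef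
        ↔ (bordered σ b W).PosDef := by
      refine ⟨fun h => ?_, fun h => h.submatrix (Equiv.injective _)⟩
      simpa using h.submatrix (borderIndex d).injective
    have htr : (((bordered σ b W).submatrix (borderIndex d).symm (borderIndex d).symm)⁻¹
        * (bordered a g T).submatrix (borderIndex d).symm (borderIndex d).symm).trace
        = ((bordered σ b W)⁻¹ * bordered a g T).trace := by
      rw [Matrix.inv_submatrix_equiv, Matrix.submatrix_mul_equiv]
      exact Equiv.sum_comp (borderIndex d).symm
        (fun i => ((bordered σ b W)⁻¹ * bordered a g T) i i)
    rw [wishartKernel, symMatrix_symCons, ← hWdef, Matrix.det_submatrix_equiv_self, htr]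
    by_cases h : (bordered σ b W).PosDef
    · rw [if_pos h, if_pos (hpd.mpr h)]
    · rw [if_neg h, if_neg fun h' => h (hpd.mp h')]
  by_cases hW : W.PosDef
  swap
  · have h0 : ∀ σ b, ¬ (bordered σ b W).PosDef := fun σ b h =>
      hW (h.submatrix (e := Sum.inr) Sum.inr_injective)
    have h1 : wishartKernel (q - 1) T w = 0 := by rw [wishartKernel, ← hWdef, if_neg hW]
    simp [hkern, h0, h1]
  have hWpos := hW.det_pos
  have hWu : IsUnit W.det := (Matrix.isUnit_iff_isUnit_det W).mp hW.isUnit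
  obtain ⟨c₀, hc₀⟩ : ∃ c₀, c₀ = T⁻¹ *ᵥ g := ⟨_, rfl⟩
  have hTc₀ : T *ᵥ c₀ = g := by
    rw [hc₀, Matrix.mulVec_mulVec, Matrix.mul_nonsing_inv _ hTu, Matrix.one_mulVec]
  have hsq : ∀ c, a - 2 * (c ⬝ᵥ g) + c ⬝ᵥ T *ᵥ c = δ + (c - c₀) ⬝ᵥ T *ᵥ (c - c₀) := fun c => by
    have h1 : c₀ ⬝ᵥ T *ᵥ c = c ⬝ᵥ g := by
      rw [Matrix.dotProduct_mulVec, ← Matrix.mulVec_transpose, hTs, hTc₀, dotProduct_comm]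
    rw [Matrix.mulVec_sub, sub_dotProduct, dotProduct_sub, dotProduct_sub, hTc₀, h1, hδ, ← hc₀,
      dotProduct_comm g c₀]
    ring
  -- the kernel in the coordinates given by the Schur complement and the regression vector
  have hval : ∀ (c : Fin d → ℝ) (s : ℝ), wishartKernel q
      ((bordered a g T).submatrix (borderIndex d).symm (borderIndex d).symm)
        (symCons (s + c ⬝ᵥ W *ᵥ c) (W *ᵥ c) w)
      = ENNReal.ofReal (W.det ^ (-q) * Real.exp (-(W⁻¹ * T).trace / 2)) *
        (Set.Ioi (0 : ℝ)).indicator (fun s => ENNReal.ofReal (s ^ (-q) * Real.exp (-(δ / s) / 2)) *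
          ENNReal.ofReal (Real.exp (-((c - c₀) ⬝ᵥ (s⁻¹ • T) *ᵥ (c - c₀)) / 2))) s := fun c s => by
    have hsch : s + c ⬝ᵥ W *ᵥ c - (W *ᵥ c) ⬝ᵥ W⁻¹ *ᵥ (W *ᵥ c) = s := by
      rw [Matrix.mulVec_mulVec, Matrix.nonsing_inv_mul _ hWu, Matrix.one_mulVec,
        dotProduct_comm (W *ᵥ c)]
      ring
    rw [hkern, det_bordered hW, posDef_bordered_iff hW, hsch]
    by_cases hs : 0 < s
    · rw [if_pos hs, Set.indicator_of_mem (by simpa using hs), trace_inv_bordered_mul hW hs.ne',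
        hsq, ← ENNReal.ofReal_mul (by positivity), ← ENNReal.ofReal_mul (by positivity)]
      congr 1
      rw [Real.mul_rpow hWpos.le hs.le, Matrix.smul_mulVec, dotProduct_smul, smul_eq_mul]
      have : -((δ + (c - c₀) ⬝ᵥ T *ᵥ (c - c₀)) / s + (W⁻¹ * T).trace) / 2
          = -(W⁻¹ * T).trace / 2 + (-(δ / s) / 2
            + -(s⁻¹ * (c - c₀) ⬝ᵥ T *ᵥ (c - c₀)) / 2) := by
        field_simp
        ring
      rw [this, Real.exp_add, Real.exp_add]
      ring
    · rw [if_neg hs, Set.indicator_of_notMem (by simpa using hs), mul_zero]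
  have hmK : Measurable fun t : (Fin d → ℝ) × ℝ => wishartKernel q
      ((bordered a g T).submatrix (borderIndex d).symm (borderIndex d).symm)
        (symCons t.2 t.1 w) :=
    ((measurable_wishartKernel _ _).comp measurable_symCons).comp
      (f := fun t : (Fin d → ℝ) × ℝ => (w, t.1, t.2)) (by fun_prop)
  rw [lintegral_eq_det_mul hWpos.ne' (g := fun b => ∫⁻ σ : ℝ, wishartKernel q
      ((bordered a g T).submatrix (borderIndex d).symm (borderIndex d).symm) (symCons σ b w))
      hmK.lintegral_prod_right']
  have hshift : ∀ c : Fin d → ℝ, ∫⁻ σ : ℝ, wishartKernel q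
      ((bordered a g T).submatrix (borderIndex d).symm (borderIndex d).symm)
        (symCons σ (W *ᵥ c) w)
      = ENNReal.ofReal (W.det ^ (-q) * Real.exp (-(W⁻¹ * T).trace / 2)) *
        ∫⁻ s in Set.Ioi (0 : ℝ), ENNReal.ofReal (s ^ (-q) * Real.exp (-(δ / s) / 2)) *
          ENNReal.ofReal (Real.exp (-((c - c₀) ⬝ᵥ (s⁻¹ • T) *ᵥ (c - c₀)) / 2)) := fun c => by
    rw [← lintegral_add_right_eq_self _ (c ⬝ᵥ W *ᵥ c)]
    simp_rw [hval]
    rw [lintegral_const_mul' _ _ ENNReal.ofReal_ne_top, lintegral_indicator measurableSet_Ioi]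
  simp_rw [hshift]
  rw [lintegral_const_mul' _ _ ENNReal.ofReal_ne_top, lintegral_lintegral_swap]
  swap
  · exact ((by fun_prop : Measurable fun t : (Fin d → ℝ) × ℝ =>
      ENNReal.ofReal (t.2 ^ (-q) * Real.exp (-(δ / t.2) / 2))).mul
      (measurable_exp_neg_inv_smul T c₀)).aemeasurable
  have hcint : ∀ s ∈ Set.Ioi (0 : ℝ),
      ∫⁻ c : Fin d → ℝ, ENNReal.ofReal (s ^ (-q) * Real.exp (-(δ / s) / 2)) *
          ENNReal.ofReal (Real.exp (-((c - c₀) ⬝ᵥ (s⁻¹ • T) *ᵥ (c - c₀)) / 2))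
      = gaussConst (Fin d) * ENNReal.ofReal (T.det ^ (-(1 / 2) : ℝ)) *
        ENNReal.ofReal (s ^ (-(q - (d : ℝ) / 2)) * Real.exp (-(δ / s) / 2)) := fun s hs => by
    rw [lintegral_const_mul' _ _ ENNReal.ofReal_ne_top]
    exact ofReal_mul_lintegral_exp_neg_quadForm hT c₀ hs _ _
  rw [setLIntegral_congr_fun measurableSet_Ioi hcint, lintegral_const_mul' _ _
    (ENNReal.mul_ne_top (gaussConst_ne_top _) ENNReal.ofReal_ne_top), lintegral_inv_gamma _ hδ0,
    wishartKernel, ← hWdef, if_pos hW, abs_of_pos hWpos, ← mul_assoc,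
    ← ENNReal.ofReal_mul hWpos.le]
  have hp : W.det * (W.det ^ (-q) * Real.exp (-(W⁻¹ * T).trace / 2))
      = W.det ^ (-(q - 1)) * Real.exp (-(W⁻¹ * T).trace / 2) := by
    rw [show -(q - 1) = -q + 1 by ring, Real.rpow_add hWpos, Real.rpow_one]
    ring
  have hdT := hT.det_pos
  rw [hp, ENNReal.ofReal_mul (p := T.det ^ (-(1 / 2) : ℝ)) (by positivity)]
  ring

/-- The inverse Wishart integral, up to a constant depending on the dimension and the exponent. -/
theorem exists_lintegral_wishartKernel (d : ℕ) : ∀ q : ℝ, (d : ℝ) < q →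
    ∃ C : ℝ≥0∞, C ≠ 0 ∧ C ≠ ∞ ∧ ∀ S : Matrix (Fin d) (Fin d) ℝ, S.PosDef →
      ∫⁻ v, wishartKernel q S v = C * ENNReal.ofReal (S.det ^ (-(q - ((d : ℝ) + 1) / 2))) := by
  induction d with
  | zero =>
    intro q _
    refine ⟨1, one_ne_zero, ENNReal.one_ne_top, fun S _ => ?_⟩
    have : ∀ v : SymCoord 0, wishartKernel q S v = 1 := fun v => by
      rw [wishartKernel, if_pos]
      · simp [Matrix.trace]
      · exact .of_dotProduct_mulVec_pos (symMatrix_isSymm v)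
          fun x hx => absurd (Subsingleton.elim x 0) hx
    simp_rw [this]
    have : IsEmpty {q : Fin 0 × Fin 0 // q.1 ≤ q.2} := ⟨fun q => q.1.1.elim0⟩
    simp [volume_pi]
  | succ d ih =>
    intro q hq
    push_cast at hq
    obtain ⟨C, hC0, hC1, hC⟩ := ih (q - 1) (by linarith)
    have hq' : 1 < q - (d : ℝ) / 2 := by linarith [(Nat.cast_nonneg d : (0 : ℝ) ≤ d)]
    refine ⟨C * (gaussConst (Fin d) * invGammaConst (q - (d : ℝ) / 2)),
      mul_ne_zero hC0 (mul_ne_zero (gaussConst_ne_zero _) (invGammaConst_ne_zero _)),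
      ENNReal.mul_ne_top hC1 (ENNReal.mul_ne_top (gaussConst_ne_top _) (invGammaConst_ne_top hq')),
      fun S hS => ?_⟩
    obtain ⟨a, ha⟩ : ∃ a, a = S 0 0 := ⟨_, rfl⟩
    obtain ⟨g, hg⟩ : ∃ g : Fin d → ℝ, g = fun j => S 0 j.succ := ⟨_, rfl⟩
    obtain ⟨T, hTdef⟩ : ∃ T, T = S.submatrix Fin.succ Fin.succ := ⟨_, rfl⟩
    have hT : T.PosDef := hTdef ▸ hS.submatrix (Fin.succ_injective d)
    have hSs : ∀ i j, S i j = S j i := fun i j => by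
      have : Sᵀ = S := hS.isHermitian
      exact congrFun (congrFun this j) i
    have hSb : S = (bordered a g T).submatrix (borderIndex d).symm (borderIndex d).symm := by
      ext i j
      cases i using Fin.cases with
      | zero =>
        cases j using Fin.cases with
        | zero => exact ha.symm
        | succ j => exact (congrFun hg j).symm
      | succ i =>
        cases j using Fin.cases with
        | zero => exact (hSs _ _).trans (congrFun hg i).symm
        | succ j => exact (congrFun (congrFun hTdef i) j).symm
    obtain ⟨δ, hδ⟩ : ∃ δ, δ = a - g ⬝ᵥ T⁻¹ *ᵥ g := ⟨_, rfl⟩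
    have hdet : S.det = T.det * δ := by
      rw [hSb, Matrix.det_submatrix_equiv_self, det_bordered hT, hδ]
    have hTpos := hT.det_pos
    have hδ0 : 0 < δ := by
      have := hS.det_pos
      rw [hdet] at this
      exact pos_of_mul_pos_right this hTpos.le
    rw [lintegral_symCoord_succ (measurable_wishartKernel _ _), hdet, hSb]
    simp_rw [lintegral_wishartKernel_symCons hT hδ hδ0]
    rw [lintegral_mul_const _ (measurable_wishartKernel _ _), hC T hT, mul_mul_mul_comm,
      ← ENNReal.ofReal_mul (by positivity)]
    congr 2
    rw [← mul_assoc, ← Real.rpow_add hTpos, Real.mul_rpow hTpos.le hδ0.le]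
    push_cast
    congr 2 <;> ring

/-! ### Weighted Gram matrices -/

section Gram

variable {n : ℕ} {κ : Type*} [Fintype κ] [DecidableEq κ]

/-- The weighted Gram matrix `Uᵀ diag(z) U`. -/
def gram (U : Matrix (Fin n) κ ℝ) (z : Fin n → ℝ) : Matrix κ κ ℝ :=
  Uᵀ * Matrix.diagonal z * U

omit [Fintype κ] [DecidableEq κ] in
lemma gram_apply (U : Matrix (Fin n) κ ℝ) (z : Fin n → ℝ) (k l : κ) :
    gram U z k l = ∑ j, z j * (U j k * U j l) := by
  rw [gram, Matrix.mul_apply]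
  refine Finset.sum_congr rfl fun j _ => ?_
  rw [Matrix.mul_diagonal, Matrix.transpose_apply]
  ring

omit [DecidableEq κ] in
lemma posDef_gram {U : Matrix (Fin n) κ ℝ} (hU : Function.Injective U.mulVec) {z : Fin n → ℝ}
    (hz : ∀ i, 0 < z i) : (gram U z).PosDef :=
  (Matrix.PosDef.diagonal hz).conjTranspose_mul_mul_same hU

omit [Fintype κ] [DecidableEq κ] in
lemma gram_update (U : Matrix (Fin n) κ ℝ) (z : Fin n → ℝ) (i : Fin n) (s : ℝ) :
    gram U (Function.update z i ((1 + s) * z i))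
      = gram U z + Matrix.replicateCol Unit (U i) * Matrix.replicateRow Unit ((s * z i) • U i) := by
  ext k l
  rw [Matrix.add_apply, gram_apply, gram_apply]
  have hrow : (Matrix.replicateCol Unit (U i) * Matrix.replicateRow Unit ((s * z i) • U i)) k l
      = s * z i * (U i k * U i l) := by
    simp [Matrix.mul_apply]
    ring
  rw [hrow, ← Finset.add_sum_erase _ _ (Finset.mem_univ i),
    ← Finset.add_sum_erase _ (fun j => z j * (U j k * U j l)) (Finset.mem_univ i),
    Function.update_self, Finset.sum_congr rfl fun j hj => by
      rw [Function.update_of_ne (Finset.ne_of_mem_erase hj)]]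
  ring

/-- The leverage of an observation is at most one, so multiplying its weight by `1 + s` increases
the determinant of the Gram matrix by a factor between `1` and `1 + s`. -/
lemma det_gram_update_mem {U : Matrix (Fin n) κ ℝ} (hU : Function.Injective U.mulVec)
    {z : Fin n → ℝ} (hz : ∀ i, 0 < z i) (i : Fin n) {s : ℝ} (hs : 0 ≤ s) :
    (gram U z).det ≤ (gram U (Function.update z i ((1 + s) * z i))).det ∧
      (gram U (Function.update z i ((1 + s) * z i))).det ≤ (1 + s) * (gram U z).det := by
  have hM := posDef_gram hU hz
  have hMu : IsUnit (gram U z).det := (Matrix.isUnit_iff_isUnit_det _).mp hM.isUnit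
  obtain ⟨x, hx⟩ : ∃ x, x = (gram U z)⁻¹ *ᵥ U i := ⟨_, rfl⟩
  have hMx : gram U z *ᵥ x = U i := by
    rw [hx, Matrix.mulVec_mulVec, Matrix.mul_nonsing_inv _ hMu, Matrix.one_mulVec]
  have hlev0 : 0 ≤ U i ⬝ᵥ x := by
    rw [hx]; exact hM.inv.posSemidef.dotProduct_mulVec_nonneg (U i)
  -- the quadratic form of the Gram matrix at `x` dominates its `i`-th term
  have hlev1 : z i * (U i ⬝ᵥ x) ^ 2 ≤ U i ⬝ᵥ x := by
    have h1 : x ⬝ᵥ gram U z *ᵥ x = ∑ j, z j * (U j ⬝ᵥ x) ^ 2 := by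
      rw [gram, ← Matrix.mulVec_mulVec, ← Matrix.mulVec_mulVec, Matrix.dotProduct_mulVec,
        Matrix.vecMul_transpose, dotProduct]
      refine Finset.sum_congr rfl fun j _ => ?_
      rw [Matrix.mulVec_diagonal, Matrix.mulVec]
      ring
    have h2 : x ⬝ᵥ gram U z *ᵥ x = U i ⬝ᵥ x := by rw [hMx, dotProduct_comm]
    refine le_of_le_of_eq ?_ (h1.symm.trans h2)
    exact Finset.single_le_sum (f := fun j => z j * (U j ⬝ᵥ x) ^ 2)
      (fun j _ => mul_nonneg (hz j).le (sq_nonneg _)) (Finset.mem_univ i)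
  have hlev2 : z i * (U i ⬝ᵥ x) ≤ 1 := by
    rcases hlev0.eq_or_lt with h | h
    · rw [← h]; simp
    · have : z i * (U i ⬝ᵥ x) * (U i ⬝ᵥ x) ≤ 1 * (U i ⬝ᵥ x) := by nlinarith
      exact le_of_mul_le_mul_right this h
  have hdet : (gram U (Function.update z i ((1 + s) * z i))).det
      = (gram U z).det * (1 + s * (z i * (U i ⬝ᵥ x))) := by
    rw [gram_update, Matrix.det_add_replicateCol_mul_replicateRow hMu]
    congr 1
    rw [Matrix.det_unique, Matrix.add_apply, Matrix.one_apply_eq, Matrix.mul_assoc,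
      ← Matrix.replicateCol_mulVec, ← hx, Matrix.replicateRow_mul_replicateCol_apply,
      smul_dotProduct, smul_eq_mul]
    ring
  have hpos := hM.det_pos
  have h0 : 0 ≤ z i * (U i ⬝ᵥ x) := mul_nonneg (hz i).le hlev0
  rw [hdet]
  constructor
  · nlinarith [mul_nonneg hpos.le (mul_nonneg hs h0)]
  · nlinarith [mul_nonneg hpos.le (mul_nonneg hs (sub_nonneg.mpr hlev2))]

end Gram

section Regression

variable {n p d : ℕ} (X : Matrix (Fin n) (Fin p) ℝ) (y : Matrix (Fin n) (Fin d) ℝ)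

/-- The weighted least squares estimate of `β`. -/
noncomputable def lsCoeff (z : Fin n → ℝ) : Matrix (Fin p) (Fin d) ℝ :=
  (gram X z)⁻¹ * (Xᵀ * Matrix.diagonal z * y)

/-- The weighted residual cross-product matrix at the least squares estimate. -/
noncomputable def residGram (z : Fin n → ℝ) : Matrix (Fin d) (Fin d) ℝ :=
  gram (y - X * lsCoeff X y z) z

variable {X y}

lemma injective_mulVec_fromCols (hrank : (Matrix.fromCols X y).rank = p + d) :
    Function.Injective (Matrix.fromCols X y).mulVec := by
  rw [← Matrix.coe_mulVecLin, ← LinearMap.ker_eq_bot]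
  have h := LinearMap.finrank_range_add_finrank_ker (Matrix.fromCols X y).mulVecLin
  rw [Matrix.rank] at hrank
  rw [hrank] at h
  simp only [Module.finrank_fintype_fun_eq_card, Fintype.card_sum, Fintype.card_fin] at h
  exact Submodule.finrank_eq_zero.mp (by omega)

lemma injective_mulVec_left (hU : Function.Injective (Matrix.fromCols X y).mulVec) :
    Function.Injective X.mulVec := fun v w h => by
  have : (Matrix.fromCols X y).mulVec (Sum.elim v 0)
      = (Matrix.fromCols X y).mulVec (Sum.elim w 0) := by
    rw [Matrix.fromCols_mulVec, Matrix.fromCols_mulVec]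
    simpa using h
  exact congrArg (· ∘ Sum.inl) (hU this)

lemma isUnit_det_gram (hU : Function.Injective (Matrix.fromCols X y).mulVec) {z : Fin n → ℝ}
    (hz : ∀ i, 0 < z i) : IsUnit (gram X z).det :=
  (Matrix.isUnit_iff_isUnit_det _).mp (posDef_gram (injective_mulVec_left hU) hz).isUnit

/-- The normal equations. -/
lemma transpose_mul_diagonal_mul_resid (hU : Function.Injective (Matrix.fromCols X y).mulVec)
    {z : Fin n → ℝ} (hz : ∀ i, 0 < z i) :
    Xᵀ * Matrix.diagonal z * (y - X * lsCoeff X y z) = 0 := by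
  rw [Matrix.mul_sub, ← Matrix.mul_assoc, lsCoeff, ← gram,
    Matrix.mul_nonsing_inv_cancel_left _ _ (isUnit_det_gram hU hz), sub_self]

lemma posDef_residGram (hU : Function.Injective (Matrix.fromCols X y).mulVec) {z : Fin n → ℝ}
    (hz : ∀ i, 0 < z i) : (residGram X y z).PosDef := by
  refine posDef_gram (fun v w h => ?_) hz
  have e : ∀ v, (y - X * lsCoeff X y z) *ᵥ v
      = (Matrix.fromCols X y).mulVec (Sum.elim (-(lsCoeff X y z *ᵥ v)) v) := fun v => by
    rw [Matrix.fromCols_mulVec, Matrix.sub_mulVec, ← Matrix.mulVec_mulVec]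
    simp only [Sum.elim_comp_inl, Sum.elim_comp_inr, Matrix.mulVec_neg]
    abel
  simp only [e] at h
  exact congrArg (· ∘ Sum.inr) (hU h)

lemma det_gram_fromCols (hU : Function.Injective (Matrix.fromCols X y).mulVec) {z : Fin n → ℝ}
    (hz : ∀ i, 0 < z i) :
    (gram (Matrix.fromCols X y) z).det = (gram X z).det * (residGram X y z).det := by
  have hu := isUnit_det_gram hU hz
  have := ((Matrix.isUnit_iff_isUnit_det _).mpr hu).invertible
  have hT : (gram X z)ᵀ = gram X z := (posDef_gram (injective_mulVec_left hU) hz).isHermitian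
  have hblock : gram (Matrix.fromCols X y) z = Matrix.fromBlocks (gram X z)
      (Xᵀ * Matrix.diagonal z * y) (yᵀ * Matrix.diagonal z * X) (gram y z) := by
    rw [gram, Matrix.transpose_fromCols, Matrix.fromRows_mul, Matrix.fromRows_mul_fromCols]
    rfl
  rw [hblock, Matrix.det_fromBlocks₁₁, Matrix.invOf_eq_nonsing_inv]
  congr 2
  have h1 : residGram X y z = yᵀ * Matrix.diagonal z * (y - X * lsCoeff X y z) := by
    rw [residGram, gram, Matrix.transpose_sub, Matrix.sub_mul, Matrix.sub_mul,
      Matrix.transpose_mul, Matrix.mul_assoc (lsCoeff X y z)ᵀ, Matrix.mul_assoc (lsCoeff X y z)ᵀ,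
      transpose_mul_diagonal_mul_resid hU hz, Matrix.mul_zero, sub_zero]
  rw [h1, Matrix.mul_sub, lsCoeff, gram]
  simp only [Matrix.mul_assoc]

/-- Decomposition of the weighted cross-product of residuals around the least squares estimate. -/
lemma gram_sub_mul (hU : Function.Injective (Matrix.fromCols X y).mulVec) {z : Fin n → ℝ}
    (hz : ∀ i, 0 < z i) (β : Matrix (Fin p) (Fin d) ℝ) :
    gram (y - X * β) z = residGram X y z
      + (β - lsCoeff X y z)ᵀ * gram X z * (β - lsCoeff X y z) := by
  obtain ⟨γ, hγ⟩ : ∃ γ, γ = β - lsCoeff X y z := ⟨_, rfl⟩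
  obtain ⟨R, hR⟩ : ∃ R, R = y - X * lsCoeff X y z := ⟨_, rfl⟩
  have h1 : y - X * β = R - X * γ := by rw [hR, hγ, Matrix.mul_sub]; abel
  have h2 : Xᵀ * Matrix.diagonal z * R = 0 := hR ▸ transpose_mul_diagonal_mul_resid hU hz
  have h3 : Rᵀ * Matrix.diagonal z * X = 0 := by
    have := congrArg Matrix.transpose h2
    simpa [Matrix.transpose_mul, Matrix.mul_assoc] using this
  rw [residGram, ← hγ, ← hR, h1, gram, gram, gram, Matrix.transpose_sub, Matrix.sub_mul,
    Matrix.mul_sub, Matrix.sub_mul, Matrix.sub_mul, ← Matrix.mul_assoc _ X, h3,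
    Matrix.transpose_mul]
  have h4 : γᵀ * Xᵀ * Matrix.diagonal z * R = 0 := by
    rw [Matrix.mul_assoc γᵀ, Matrix.mul_assoc γᵀ, h2, Matrix.mul_zero]
  rw [h4, Matrix.zero_mul]
  simp [Matrix.mul_assoc]

open scoped Kronecker in
/-- The weighted sum of the Mahalanobis norms of the residuals, split into a term free of `β` and
a quadratic form in the entries of `β`. -/
lemma sum_mul_quadForm (hU : Function.Injective (Matrix.fromCols X y).mulVec) {z : Fin n → ℝ}
    (hz : ∀ i, 0 < z i) (θ : Param p d) :
    ∑ i, z i * quadForm X y θ i = (θ.scale⁻¹ * residGram X y z).trace +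
      ((fun q : Fin p × Fin d => θ.1 q.1 q.2) - fun q => lsCoeff X y z q.1 q.2) ⬝ᵥ
        (gram X z ⊗ₖ θ.scale⁻¹) *ᵥ
          ((fun q : Fin p × Fin d => θ.1 q.1 q.2) - fun q => lsCoeff X y z q.1 q.2) := by
  obtain ⟨P, hP⟩ : ∃ P, P = θ.scale⁻¹ := ⟨_, rfl⟩
  have hPs : ∀ i j, P i j = P j i := fun i j => by
    have : Pᵀ = P := by
      rw [hP, Matrix.transpose_nonsing_inv]
      exact congrArg _ (symMatrix_isSymm θ.2)
    exact congrFun (congrFun this j) i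
  have hres : ∀ i j, resid X y θ i j = (y - X * θ.coeff) i j := fun i j => by
    rw [resid, Pi.sub_apply, Matrix.sub_apply, Matrix.mulVec, Matrix.mul_apply, dotProduct]
    congr 1
    exact Finset.sum_congr rfl fun k _ => mul_comm _ _
  have h1 : ∑ i, z i * quadForm X y θ i = (P * gram (y - X * θ.coeff) z).trace := by
    simp only [quadForm, ← hP, dotProduct, Matrix.mulVec, hres, gram_apply, Matrix.trace,
      Matrix.diag_apply, Matrix.mul_apply (M := P),
      Finset.mul_sum]
    rw [Finset.sum_comm]
    refine Finset.sum_congr rfl fun j _ => ?_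
    rw [Finset.sum_comm]
    refine Finset.sum_congr rfl fun k _ => Finset.sum_congr rfl fun i _ => ?_
    rw [hPs j k]
    ring
  rw [h1, gram_sub_mul hU hz, Matrix.mul_add, Matrix.trace_add, ← hP]
  congr 1
  obtain ⟨γ, hγ⟩ : ∃ γ, γ = θ.coeff - lsCoeff X y z := ⟨_, rfl⟩
  have hγ' : ((fun q : Fin p × Fin d => θ.1 q.1 q.2) - fun q => lsCoeff X y z q.1 q.2)
      = fun q => γ q.1 q.2 := by
    rw [hγ]; rfl
  rw [hγ', ← hγ]
  simp only [Matrix.trace, Matrix.diag_apply, Matrix.mul_apply, Matrix.transpose_apply, dotProduct,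
    Matrix.mulVec, Fintype.sum_prod_type, Matrix.kroneckerMap_apply, Finset.mul_sum,
    Finset.sum_mul]
  rw [Finset.sum_comm]
  conv_rhs => rw [Finset.sum_comm]
  refine Finset.sum_congr rfl fun j _ => ?_
  rw [Finset.sum_comm]
  conv_rhs => rw [Finset.sum_comm]
  refine Finset.sum_congr rfl fun l _ => ?_
  rw [Finset.sum_comm]
  refine Finset.sum_congr rfl fun k _ => Finset.sum_congr rfl fun m _ => ?_
  rw [hPs m j]
  ring

end Regression

/-! ### The conditional density of the parameters -/

section Conditional

variable {n p d : ℕ} (X : Matrix (Fin n) (Fin p) ℝ) (y : Matrix (Fin n) (Fin d) ℝ) (a : ℝ)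

open Classical in
/-- The conditional density of the parameters given the latent weights `z`, up to a factor
depending only on `z`. -/
noncomputable def paramKernel (θ : Param p d) (z : Fin n → ℝ) : ℝ≥0∞ :=
  if θ ∈ stateSpace p d then
    ENNReal.ofReal (θ.scale.det ^ (-((n : ℝ) / 2 + a)) *
      Real.exp (-(∑ i, z i * quadForm X y θ i) / 2))
  else 0

/-- The integral of the parameter kernel. -/
noncomputable def paramIntegral (z : Fin n → ℝ) : ℝ≥0∞ := ∫⁻ θ : Param p d, paramKernel X y a θ z

variable {X y a}

lemma measurableSet_stateSpace : MeasurableSet (stateSpace p d) :=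
  measurable_snd measurableSet_posDef

variable (X y) in
lemma measurable_quadForm (i : Fin n) : Measurable fun θ : Param p d => quadForm X y θ i := by
  have hr : ∀ j, Measurable fun θ : Param p d => resid X y θ i j := fun j => by
    simp only [resid, Pi.sub_apply, Matrix.mulVec, dotProduct, Matrix.transpose_apply, Param.coeff,
      Matrix.of_apply]
    fun_prop
  simp only [quadForm, dotProduct, Matrix.mulVec]
  refine Finset.measurable_sum _ fun j _ => (hr j).mul (Finset.measurable_sum _ fun k _ =>
    Measurable.mul ?_ (hr k))
  exact (measurable_inv_symMatrix j k).comp measurable_snd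

lemma measurable_det_scale : Measurable fun θ : Param p d => θ.scale.det :=
  measurable_det_symMatrix.comp measurable_snd

lemma quadForm_nonneg {θ : Param p d} (hθ : θ ∈ stateSpace p d) (i : Fin n) :
    0 ≤ quadForm X y θ i :=
  (Matrix.PosDef.inv hθ).posSemidef.dotProduct_mulVec_nonneg _

variable (X y a) in
lemma measurable_paramKernel :
    Measurable fun t : Param p d × (Fin n → ℝ) => paramKernel X y a t.1 t.2 := by
  refine Measurable.ite (measurable_fst measurableSet_stateSpace)
    (ENNReal.measurable_ofReal.comp ?_) measurable_const
  refine ((measurable_det_scale.comp measurable_fst).pow_const _).mul (Real.measurable_exp.comp ?_)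
  refine Measurable.div_const (Measurable.neg (Finset.measurable_sum _ fun i _ => ?_)) _
  exact ((measurable_pi_apply i).comp measurable_snd).mul
    ((measurable_quadForm X y i).comp measurable_fst)

open scoped Kronecker in
/-- The normal–inverse-Wishart integral, up to a positive constant. -/
lemma exists_paramIntegral_eq (hU : Function.Injective (Matrix.fromCols X y).mulVec)
    (hn : (p : ℝ) + 2 * d - 2 * a < n) :
    ∃ C : ℝ≥0∞, C ≠ 0 ∧ C ≠ ∞ ∧ ∀ z : Fin n → ℝ, (∀ i, 0 < z i) →
      paramIntegral X y a z = C * ENNReal.ofReal ((gram X z).det ^ (-((d : ℝ) / 2)) *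
        (residGram X y z).det ^ (-(((n : ℝ) - p + 2 * a - d - 1) / 2))) := by
  obtain ⟨q, hq⟩ : ∃ q : ℝ, q = ((n : ℝ) - p) / 2 + a := ⟨_, rfl⟩
  obtain ⟨C, hC0, hC1, hC⟩ := exists_lintegral_wishartKernel d q (by rw [hq]; linarith)
  refine ⟨gaussConst (Fin p × Fin d) * C, mul_ne_zero (gaussConst_ne_zero _) hC0,
    ENNReal.mul_ne_top (gaussConst_ne_top _) hC1, fun z hz => ?_⟩
  have hH := posDef_gram (injective_mulVec_left hU) hz
  have hHpos := hH.det_pos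
  have hinner : ∀ v : SymCoord d, ∫⁻ β : Fin p → Fin d → ℝ, paramKernel X y a (β, v) z
      = gaussConst (Fin p × Fin d) * ENNReal.ofReal ((gram X z).det ^ (-((d : ℝ) / 2))) *
        wishartKernel q (residGram X y z) v := fun v => by
    by_cases hv : (symMatrix v).PosDef
    swap
    · have : ∀ β : Fin p → Fin d → ℝ, paramKernel X y a (β, v) z = 0 := fun β => if_neg hv
      simp [this, wishartKernel, if_neg hv]
    have hvpos := hv.det_pos
    have hM : (gram X z ⊗ₖ (symMatrix v)⁻¹).PosDef := hH.kronecker hv.inv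
    have hk : ∀ β : Fin p → Fin d → ℝ, paramKernel X y a (β, v) z
        = ENNReal.ofReal ((symMatrix v).det ^ (-((n : ℝ) / 2 + a)) *
            Real.exp (-((symMatrix v)⁻¹ * residGram X y z).trace / 2)) *
          ENNReal.ofReal (Real.exp (-(((fun q : Fin p × Fin d => β q.1 q.2)
            - fun q => lsCoeff X y z q.1 q.2) ⬝ᵥ (gram X z ⊗ₖ (symMatrix v)⁻¹) *ᵥ
              ((fun q : Fin p × Fin d => β q.1 q.2) - fun q => lsCoeff X y z q.1 q.2)) / 2)) :=
      fun β => by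
      have hmem : ((β, v) : Param p d) ∈ stateSpace p d := hv
      rw [paramKernel, if_pos hmem, sum_mul_quadForm hU hz, ← ENNReal.ofReal_mul (by positivity),
        mul_assoc, ← Real.exp_add]
      simp only [Param.scale]
      congr 3
      ring
    simp_rw [hk]
    rw [lintegral_const_mul' _ _ ENNReal.ofReal_ne_top, lintegral_curry]
    have hg := lintegral_exp_neg_quadForm_sub hM (fun q => lsCoeff X y z q.1 q.2)
    simp only [Prod.mk.eta]
    rw [hg, wishartKernel, if_pos hv, Matrix.det_kronecker, mul_left_comm, mul_assoc,
      ← ENNReal.ofReal_mul (by positivity), ← ENNReal.ofReal_mul (by positivity)]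
    congr 2
    rw [Matrix.det_nonsing_inv, Ring.inverse_eq_inv', Fintype.card_fin, Fintype.card_fin,
      Real.mul_rpow (by positivity) (by positivity), ← Real.rpow_natCast, ← Real.rpow_natCast,
      Real.inv_rpow hvpos.le, Real.inv_rpow (by positivity), ← Real.rpow_mul hHpos.le,
      ← Real.rpow_mul hvpos.le, ← Real.rpow_neg hvpos.le,
      show -q = -((n : ℝ) / 2 + a) + -((p : ℝ) * -(1 / 2)) by rw [hq]; ring, Real.rpow_add hvpos,
      show (d : ℝ) * -(1 / 2) = -((d : ℝ) / 2) by ring]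
    ring
  have hm : Measurable fun θ : Param p d => paramKernel X y a θ z :=
    (measurable_paramKernel X y a).comp (f := fun θ : Param p d => (θ, z)) (by fun_prop)
  have hS := posDef_residGram hU hz
  have hSpos := hS.det_pos
  rw [paramIntegral, Measure.volume_eq_prod, lintegral_prod_symm _ hm.aemeasurable]
  simp_rw [hinner]
  rw [lintegral_const_mul _ (measurable_wishartKernel _ _), hC _ hS,
    ENNReal.ofReal_mul (by positivity),
    show -(((n : ℝ) - p + 2 * a - d - 1) / 2) = -(q - ((d : ℝ) + 1) / 2) by rw [hq]; ring]
  ring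

lemma paramIntegral_ne_zero (hU : Function.Injective (Matrix.fromCols X y).mulVec)
    (hn : (p : ℝ) + 2 * d - 2 * a < n) {z : Fin n → ℝ} (hz : ∀ i, 0 < z i) :
    paramIntegral X y a z ≠ 0 := by
  obtain ⟨C, hC0, -, hC⟩ := exists_paramIntegral_eq hU hn
  have h1 := (posDef_gram (injective_mulVec_left hU) hz).det_pos
  have h2 := (posDef_residGram hU hz).det_pos
  rw [hC z hz]
  refine mul_ne_zero hC0 (ENNReal.ofReal_pos.mpr ?_).ne'
  positivity

lemma paramIntegral_ne_top (hU : Function.Injective (Matrix.fromCols X y).mulVec)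
    (hn : (p : ℝ) + 2 * d - 2 * a < n) {z : Fin n → ℝ} (hz : ∀ i, 0 < z i) :
    paramIntegral X y a z ≠ ∞ := by
  obtain ⟨C, -, hC1, hC⟩ := exists_paramIntegral_eq hU hn
  rw [hC z hz]
  exact ENNReal.mul_ne_top hC1 ENNReal.ofReal_ne_top

/-- Increasing one latent weight by a factor `1 + s` decreases the parameter integral by a factor
of at most `(1 + s) ^ ((n - p + 2 a - 1) / 2)`. -/
lemma le_paramIntegral_update (hd : 0 < d) (hU : Function.Injective (Matrix.fromCols X y).mulVec)
    (hn : (p : ℝ) + 2 * d - 2 * a < n) {z : Fin n → ℝ} (hz : ∀ i, 0 < z i) (i : Fin n) {s : ℝ}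
    (hs : 0 ≤ s) :
    ENNReal.ofReal ((1 + s) ^ (-(((n : ℝ) - p + 2 * a - 1) / 2))) * paramIntegral X y a z
      ≤ paramIntegral X y a (Function.update z i ((1 + s) * z i)) := by
  obtain ⟨C, -, -, hC⟩ := exists_paramIntegral_eq hU hn
  have hs1 : 0 < 1 + s := by linarith
  have hz' : ∀ j, 0 < Function.update z i ((1 + s) * z i) j := fun j => by
    by_cases hj : j = i
    · subst hj; rw [Function.update_self]; exact mul_pos hs1 (hz j)
    · rw [Function.update_of_ne hj]; exact hz j
  have hX := injective_mulVec_left hU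
  have h1 := (posDef_gram hX hz).det_pos
  have h2 := (posDef_residGram hU hz).det_pos
  have h1' := (posDef_gram hX hz').det_pos
  have h2' := (posDef_residGram hU hz').det_pos
  obtain ⟨hA1, hA2⟩ := det_gram_update_mem hX hz i hs
  have hB2 := (det_gram_update_mem hU hz i hs).2
  rw [det_gram_fromCols hU hz, det_gram_fromCols hU hz'] at hB2
  have hS : (residGram X y (Function.update z i ((1 + s) * z i))).det
      ≤ (1 + s) * (residGram X y z).det := by
    have := (mul_le_mul_of_nonneg_right hA1 h2'.le).trans hB2
    nlinarith
  have hd' : (1 : ℝ) ≤ d := by exact_mod_cast hd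
  rw [hC z hz, hC _ hz', mul_left_comm, ← ENNReal.ofReal_mul (by positivity)]
  gcongr C * ENNReal.ofReal ?_
  have e1 := Real.rpow_le_rpow_of_nonpos h1' hA2 (z := -((d : ℝ) / 2)) (by linarith)
  have e2 := Real.rpow_le_rpow_of_nonpos h2' hS
    (z := -(((n : ℝ) - p + 2 * a - d - 1) / 2)) (by linarith)
  rw [Real.mul_rpow hs1.le h1.le] at e1
  rw [Real.mul_rpow hs1.le h2.le] at e2
  refine le_trans (le_of_eq ?_) (mul_le_mul e1 e2 (by positivity) (by positivity))
  rw [show -(((n : ℝ) - p + 2 * a - 1) / 2) = -((d : ℝ) / 2)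
    + -(((n : ℝ) - p + 2 * a - d - 1) / 2) by ring, Real.rpow_add hs1]
  ring

/-- Under the conditional density of the parameters given `z`, the mean of `z_i r_i` is at most
`n - p + 2 a - 1`. The bound is the derivative at `s = 0` of the inequality in
`le_paramIntegral_update`. -/
lemma lintegral_paramKernel_mul_quadForm_le (hd : 0 < d)
    (hU : Function.Injective (Matrix.fromCols X y).mulVec)
    (hn : (p : ℝ) + 2 * d - 2 * a < n) {z : Fin n → ℝ} (hz : ∀ i, 0 < z i) (i : Fin n) :
    ∫⁻ θ : Param p d, paramKernel X y a θ z * ENNReal.ofReal (z i * quadForm X y θ i)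
      ≤ ENNReal.ofReal ((n : ℝ) - p + 2 * a - 1) * paramIntegral X y a z := by
  obtain ⟨k, hk⟩ : ∃ k : ℝ, k = ((n : ℝ) - p + 2 * a - 1) / 2 := ⟨_, rfl⟩
  have hd' : (1 : ℝ) ≤ d := by exact_mod_cast hd
  have hk0 : 0 ≤ k := by rw [hk]; linarith
  have hm : Measurable fun θ : Param p d => paramKernel X y a θ z :=
    (measurable_paramKernel X y a).comp (f := fun θ : Param p d => (θ, z)) (by fun_prop)
  have hqm := measurable_quadForm X y i
  have hfin := paramIntegral_ne_top hU hn hz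
  -- difference quotients of the integral in the direction of the `i`-th weight
  have hdiff : ∀ s : ℝ, 0 < s → ∫⁻ θ : Param p d, paramKernel X y a θ z *
      ENNReal.ofReal (1 - Real.exp (-(s * (z i * quadForm X y θ i) / 2)))
        ≤ ENNReal.ofReal (s * k) * paramIntegral X y a z := fun s hs => by
    have hsplit : ∀ θ : Param p d, paramKernel X y a θ z *
        ENNReal.ofReal (1 - Real.exp (-(s * (z i * quadForm X y θ i) / 2)))
          + paramKernel X y a θ (Function.update z i ((1 + s) * z i)) = paramKernel X y a θ z :=
      fun θ => by
      by_cases hθ : θ ∈ stateSpace p d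
      swap
      · simp [paramKernel, hθ]
      have hdet : 0 < θ.scale.det := Matrix.PosDef.det_pos hθ
      have hr := quadForm_nonneg (X := X) (y := y) hθ i
      have hsum : ∑ j, Function.update z i ((1 + s) * z i) j * quadForm X y θ j
          = ∑ j, z j * quadForm X y θ j + s * (z i * quadForm X y θ i) := by
        rw [← Finset.add_sum_erase _ _ (Finset.mem_univ i),
          ← Finset.add_sum_erase _ (fun j => z j * quadForm X y θ j) (Finset.mem_univ i),
          Function.update_self, Finset.sum_congr rfl fun j hj => by
            rw [Function.update_of_ne (Finset.ne_of_mem_erase hj)]]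
        ring
      have he : Real.exp (-(s * (z i * quadForm X y θ i) / 2)) ≤ 1 := by
        rw [Real.exp_le_one_iff]
        have := mul_nonneg hs.le (mul_nonneg (hz i).le hr)
        linarith
      rw [paramKernel, paramKernel, if_pos hθ, if_pos hθ, hsum,
        ← ENNReal.ofReal_mul (by positivity),
        ← ENNReal.ofReal_add (mul_nonneg (by positivity) (by linarith)) (by positivity)]
      congr 1
      rw [show -(∑ j, z j * quadForm X y θ j + s * (z i * quadForm X y θ i)) / 2
        = -(∑ j, z j * quadForm X y θ j) / 2 + -(s * (z i * quadForm X y θ i) / 2) by ring,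
        Real.exp_add]
      ring
    have hJ : (∫⁻ θ : Param p d, paramKernel X y a θ z *
        ENNReal.ofReal (1 - Real.exp (-(s * (z i * quadForm X y θ i) / 2))))
          + paramIntegral X y a (Function.update z i ((1 + s) * z i)) = paramIntegral X y a z := by
      have hm' : Measurable fun θ : Param p d => paramKernel X y a θ z *
          ENNReal.ofReal (1 - Real.exp (-(s * (z i * quadForm X y θ i) / 2))) := by fun_prop
      exact (lintegral_add_left hm' _).symm.trans (lintegral_congr hsplit)
    have hbern : 1 - s * k ≤ (1 + s) ^ (-k) := by
      rw [Real.rpow_def_of_pos (by linarith)]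
      have h1 := Real.add_one_le_exp (Real.log (1 + s) * -k)
      have h2 := Real.log_le_sub_one_of_pos (show 0 < 1 + s by linarith)
      nlinarith
    have hlow := le_paramIntegral_update hd hU hn hz i hs.le
    rw [← hk] at hlow
    have hJ'fin : paramIntegral X y a (Function.update z i ((1 + s) * z i)) ≠ ∞ :=
      ne_top_of_le_ne_top hfin (le_add_self.trans_eq hJ)
    refine (ENNReal.add_le_add_iff_right hJ'fin).mp ?_
    rw [hJ]
    calc paramIntegral X y a z
        ≤ (ENNReal.ofReal (s * k) + ENNReal.ofReal (1 - s * k)) * paramIntegral X y a z := by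
          refine le_mul_of_one_le_left' ?_
          calc (1 : ℝ≥0∞) = ENNReal.ofReal (s * k + (1 - s * k)) := by simp
            _ ≤ _ := ENNReal.ofReal_add_le
      _ ≤ _ := by
          rw [add_mul]
          gcongr
          exact le_trans (by gcongr) hlow
  -- `1 - exp (-x) ≥ x / (1 + x)`
  have hlb : ∀ x : ℝ, 0 ≤ x → x / (1 + x) ≤ 1 - Real.exp (-x) := fun x hx => by
    have h1 : Real.exp (-x) ≤ (1 + x)⁻¹ := by
      rw [Real.exp_neg]
      exact inv_anti₀ (by linarith) (by linarith [Real.add_one_le_exp x])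
    have h2 : x / (1 + x) = 1 - (1 + x)⁻¹ := by
      have : 1 + x ≠ 0 := by linarith
      field_simp
      ring
    linarith
  have hquot : ∀ N : ℕ, ∫⁻ θ : Param p d, paramKernel X y a θ z * ENNReal.ofReal
      ((z i * quadForm X y θ i / 2) / (1 + (1 / ((N : ℝ) + 1)) * (z i * quadForm X y θ i / 2)))
        ≤ ENNReal.ofReal k * paramIntegral X y a z := fun N => by
    obtain ⟨s, hs⟩ : ∃ s : ℝ, s = 1 / ((N : ℝ) + 1) := ⟨_, rfl⟩
    have hs0 : 0 < s := by rw [hs]; positivity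
    have hs0' : ENNReal.ofReal s ≠ 0 := (ENNReal.ofReal_pos.mpr hs0).ne'
    rw [← hs, ← ENNReal.mul_le_mul_iff_right hs0' ENNReal.ofReal_ne_top, ← mul_assoc,
      ← ENNReal.ofReal_mul hs0.le, ← lintegral_const_mul' _ _ ENNReal.ofReal_ne_top]
    refine le_trans (lintegral_mono fun θ => ?_) (hdiff s hs0)
    by_cases hθ : θ ∈ stateSpace p d
    swap
    · simp [paramKernel, hθ]
    have hr := mul_nonneg (hz i).le (quadForm_nonneg (X := X) (y := y) hθ i)
    rw [mul_left_comm, ← ENNReal.ofReal_mul hs0.le]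
    gcongr
    have := hlb (s * (z i * quadForm X y θ i / 2)) (by positivity)
    rw [show s * (z i * quadForm X y θ i / 2) = s * (z i * quadForm X y θ i) / 2 by ring] at this
    refine le_trans (le_of_eq ?_) this
    rw [← mul_div_assoc]
    congr 1 <;> ring
  have hlim : ∀ θ : Param p d, paramKernel X y a θ z * ENNReal.ofReal (z i * quadForm X y θ i / 2)
      ≤ Filter.liminf (fun N : ℕ => paramKernel X y a θ z * ENNReal.ofReal
        ((z i * quadForm X y θ i / 2) / (1 + (1 / ((N : ℝ) + 1)) * (z i * quadForm X y θ i / 2))))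
          Filter.atTop := fun θ => by
    have h1 : Filter.Tendsto (fun N : ℕ => (z i * quadForm X y θ i / 2) /
        (1 + (1 / ((N : ℝ) + 1)) * (z i * quadForm X y θ i / 2))) Filter.atTop
        (nhds (z i * quadForm X y θ i / 2)) := by
      have h0 := tendsto_one_div_add_atTop_nhds_zero_nat (𝕜 := ℝ)
      have h2 : Filter.Tendsto (fun N : ℕ => (z i * quadForm X y θ i / 2) /
          (1 + (1 / ((N : ℝ) + 1)) * (z i * quadForm X y θ i / 2))) Filter.atTop
          (nhds ((z i * quadForm X y θ i / 2) / (1 + 0 * (z i * quadForm X y θ i / 2)))) :=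
        tendsto_const_nhds.div ((h0.mul_const _).const_add 1) (by simp)
      simpa using h2
    have hfin : paramKernel X y a θ z ≠ ∞ := by
      unfold paramKernel
      split_ifs <;> simp
    exact (ENNReal.Tendsto.const_mul (ENNReal.tendsto_ofReal h1) (.inr hfin)).liminf_eq.ge
  have hhalf : ∫⁻ θ : Param p d, paramKernel X y a θ z * ENNReal.ofReal (z i * quadForm X y θ i / 2)
      ≤ ENNReal.ofReal k * paramIntegral X y a z := by
    refine (lintegral_mono hlim).trans ((lintegral_liminf_le fun N => by fun_prop).trans ?_)
    refine Filter.liminf_le_of_le (by isBoundedDefault) fun b hb => ?_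
    obtain ⟨N, hN⟩ := hb.exists
    exact hN.trans (hquot N)
  calc ∫⁻ θ : Param p d, paramKernel X y a θ z * ENNReal.ofReal (z i * quadForm X y θ i)
      = 2 * ∫⁻ θ : Param p d, paramKernel X y a θ z *
          ENNReal.ofReal (z i * quadForm X y θ i / 2) := by
        rw [← lintegral_const_mul' _ _ (by simp)]
        refine lintegral_congr fun θ => ?_
        rw [mul_left_comm, show (2 : ℝ≥0∞) = ENNReal.ofReal 2 by simp,
          ← ENNReal.ofReal_mul (by norm_num)]
        congr 2
        ring
    _ ≤ 2 * (ENNReal.ofReal k * paramIntegral X y a z) := by gcongr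
    _ = _ := by
        rw [← mul_assoc, show (2 : ℝ≥0∞) = ENNReal.ofReal 2 by simp,
          ← ENNReal.ofReal_mul (by norm_num), hk]
        congr 2
        ring

end Conditional

/-! ### The mixing integrals and the conditional density of the latent weights -/

section Latent

variable {n p d : ℕ} {X : Matrix (Fin n) (Fin p) ℝ} {y : Matrix (Fin n) (Fin d) ℝ} {a : ℝ}
  {h : ℝ → ℝ}

lemma measurable_mixIntegrand (hh : IsMixingDensity h) (c : ℝ) :
    Measurable fun t : ℝ × ℝ =>
      ENNReal.ofReal (t.2 ^ c * Real.exp (-(t.1 * t.2 / 2)) * h t.2) := by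
  have := hh.measurable
  fun_prop

lemma measurable_mixIntegral (hh : IsMixingDensity h) (c : ℝ) : Measurable (mixIntegral h c) :=
  (measurable_mixIntegrand hh c).lintegral_prod_right'

lemma mixIntegral_ne_zero (hh : IsMixingDensity h) (c s : ℝ) : mixIntegral h c s ≠ 0 := by
  intro h0
  have hm := hh.measurable
  rw [mixIntegral, lintegral_eq_zero_iff (by fun_prop)] at h0
  have h1 : ∫⁻ u in Set.Ioi (0 : ℝ), ENNReal.ofReal (h u) = 0 := by
    rw [lintegral_eq_zero_iff (by fun_prop)]
    filter_upwards [h0, ae_restrict_mem measurableSet_Ioi] with u hu hu0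
    have hpos := mul_pos (Real.rpow_pos_of_pos hu0 c) (Real.exp_pos (-(s * u / 2)))
    simp only [Pi.zero_apply, ENNReal.ofReal_eq_zero] at hu ⊢
    exact nonpos_of_mul_nonpos_right hu hpos
  rw [hh.lintegral_eq_one] at h1
  exact one_ne_zero h1

lemma mixIntegral_anti (hh : IsMixingDensity h) (c : ℝ) : Antitone (mixIntegral h c) := by
  intro s t hst
  refine setLIntegral_mono' measurableSet_Ioi fun u (hu : 0 < u) => ?_
  have := hh.nonneg u hu
  gcongr

lemma mixIntegral_ne_top (hh : IsMixingDensity h) (hM : ConditionM d h) {s : ℝ} (hs : 0 ≤ s) :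
    mixIntegral h ((d : ℝ) / 2) s ≠ ∞ := by
  refine ne_top_of_le_ne_top ?_ (mixIntegral_anti hh _ hs)
  simpa [mixIntegral] using hM.ne

lemma measurableSet_posOrthant : MeasurableSet (posOrthant n) := by
  have : posOrthant n = Set.univ.pi fun _ => Set.Ioi (0 : ℝ) := by
    ext z; simp [posOrthant]
  rw [this]
  exact MeasurableSet.univ_pi fun _ => measurableSet_Ioi

lemma lintegral_posOrthant_prod {f : Fin n → ℝ → ℝ≥0∞} (hf : ∀ i, Measurable (f i)) :
    ∫⁻ z in posOrthant n, ∏ i, f i (z i) = ∏ i, ∫⁻ u in Set.Ioi (0 : ℝ), f i u := by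
  have : posOrthant n = Set.univ.pi fun _ => Set.Ioi (0 : ℝ) := by
    ext z; simp [posOrthant]
  rw [this, volume_pi, Measure.restrict_pi_pi]
  exact lintegral_pi_prod (fun _ : Fin n => volume.restrict (Set.Ioi (0 : ℝ))) hf

lemma measurable_psi_right (hh : IsMixingDensity h) (d : ℕ) (s : ℝ) :
    Measurable fun u => psi d h s u := by
  have hm := hh.measurable
  simp only [psi]
  fun_prop

lemma measurable_condLatent (hh : IsMixingDensity h) :
    Measurable fun t : Param p d × (Fin n → ℝ) => condLatent X y h t.1 t.2 := by
  have hm := hh.measurable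
  have hI := measurable_mixIntegral hh ((d : ℝ) / 2)
  have hq := measurable_quadForm X y
  simp only [condLatent, psi]
  refine Finset.measurable_fun_prod _ fun i _ => Measurable.div ?_ ?_
  · fun_prop
  · exact hI.comp ((hq i).comp measurable_fst)

lemma lintegral_psi (hh : IsMixingDensity h) (hM : ConditionM d h) {s : ℝ} (hs : 0 ≤ s) :
    ∫⁻ u in Set.Ioi (0 : ℝ), psi d h s u = 1 := by
  have hm := hh.measurable
  simp only [psi, div_eq_mul_inv]
  rw [lintegral_mul_const _ (by fun_prop)]
  exact ENNReal.mul_inv_cancel (mixIntegral_ne_zero hh _ _) (mixIntegral_ne_top hh hM hs)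

lemma lintegral_condLatent (hh : IsMixingDensity h) (hM : ConditionM d h) {θ : Param p d}
    (hθ : θ ∈ stateSpace p d) : ∫⁻ z in posOrthant n, condLatent X y h θ z = 1 := by
  simp only [condLatent]
  rw [lintegral_posOrthant_prod fun i => measurable_psi_right hh d _]
  exact Finset.prod_eq_one fun i _ => lintegral_psi hh hM (quadForm_nonneg hθ i)

/-- The conditional mean of the reciprocal of a latent weight is a ratio of mixing integrals. -/
lemma lintegral_inv_mul_condLatent (hh : IsMixingDensity h) (hM : ConditionM d h) {θ : Param p d}
    (hθ : θ ∈ stateSpace p d) (i : Fin n) :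
    ∫⁻ z in posOrthant n, ENNReal.ofReal (z i)⁻¹ * condLatent X y h θ z
      = mixIntegral h (((d : ℝ) - 2) / 2) (quadForm X y θ i)
          / mixIntegral h ((d : ℝ) / 2) (quadForm X y θ i) := by
  have hm := hh.measurable
  have hf : ∀ z : Fin n → ℝ, ENNReal.ofReal (z i)⁻¹ * condLatent X y h θ z
      = ∏ j, (if j = i then fun u => ENNReal.ofReal u⁻¹ * psi d h (quadForm X y θ j) u
          else psi d h (quadForm X y θ j)) (z j) := fun z => by
    rw [condLatent, ← Finset.mul_prod_erase _ _ (Finset.mem_univ i),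
      ← Finset.mul_prod_erase _ (fun j => (if j = i then fun u => ENNReal.ofReal u⁻¹ *
        psi d h (quadForm X y θ j) u else psi d h (quadForm X y θ j)) (z j)) (Finset.mem_univ i),
      ← mul_assoc]
    simp only [if_true]
    congr 1
    refine Finset.prod_congr rfl fun j hj => ?_
    rw [if_neg (Finset.ne_of_mem_erase hj)]
  simp_rw [hf]
  rw [lintegral_posOrthant_prod, Finset.prod_eq_single i]
  · simp only [if_true, psi, div_eq_mul_inv, ← mul_assoc]
    rw [lintegral_mul_const _ (by fun_prop), mixIntegral]
    congr 1
    refine setLIntegral_congr_fun measurableSet_Ioi fun u (hu : 0 < u) => ?_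
    rw [← ENNReal.ofReal_mul (by positivity)]
    congr 1
    rw [show ((d : ℝ) - 2) * 2⁻¹ = (d : ℝ) * 2⁻¹ + -1 by ring, Real.rpow_add hu,
      Real.rpow_neg_one]
    ring_nf
  · intro j _ hj
    rw [if_neg hj]
    exact lintegral_psi hh hM (quadForm_nonneg hθ j)
  · simp
  · intro j
    have := measurable_psi_right hh d (quadForm X y θ j)
    split_ifs
    · fun_prop
    · exact this

/-! ### The joint density -/

/-- The factor of the joint density that depends only on the latent weights. -/
noncomputable def latentWeight (d : ℕ) (h : ℝ → ℝ) {n : ℕ} (z : Fin n → ℝ) : ℝ≥0∞ :=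
  ∏ i, ENNReal.ofReal (z i ^ ((d : ℝ) / 2) / (2 * Real.pi) ^ ((d : ℝ) / 2) * h (z i))

lemma measurable_latentWeight (hh : IsMixingDensity h) :
    Measurable fun z : Fin n → ℝ => latentWeight d h z := by
  have hm := hh.measurable
  unfold latentWeight
  fun_prop

lemma latentWeight_ne_top (z : Fin n → ℝ) : latentWeight d h z ≠ ∞ :=
  ENNReal.prod_ne_top fun _ _ => ENNReal.ofReal_ne_top

lemma completeDensity_eq (hh : IsMixingDensity h) (θ : Param p d) {z : Fin n → ℝ}
    (hz : z ∈ posOrthant n) :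
    completeDensity X y a h θ z = latentWeight d h z * paramKernel X y a θ z := by
  by_cases hθ : θ ∈ stateSpace p d
  swap
  · simp [completeDensity, prior, paramKernel, hθ]
  have hdet : 0 < θ.scale.det := Matrix.PosDef.det_pos hθ
  have hz' : ∀ i, 0 < z i := hz
  have hhz : ∀ i, 0 ≤ h (z i) := fun i => hh.nonneg _ (hz i)
  have hpi := Real.pi_pos
  rw [completeDensity, prior, paramKernel, if_pos hθ, if_pos hθ, latentWeight]
  simp only [obsDensity]
  have hpos : ∀ i, 0 ≤ z i ^ ((d : ℝ) / 2) := fun i => Real.rpow_nonneg (hz' i).le _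
  rw [← ENNReal.ofReal_prod_of_nonneg, ← ENNReal.ofReal_prod_of_nonneg,
    ← ENNReal.ofReal_mul, ← ENNReal.ofReal_mul]
  · congr 1
    have hexp : Real.exp (-(∑ i, z i * quadForm X y θ i) / 2)
        = ∏ i, Real.exp (-(z i / 2) * quadForm X y θ i) := by
      rw [← Real.exp_sum, ← Finset.sum_neg_distrib, Finset.sum_div]
      congr 1
      exact Finset.sum_congr rfl fun i _ => by ring
    have hdetn : θ.scale.det ^ (-((n : ℝ) / 2 + a))
        = (∏ _i : Fin n, (θ.scale.det ^ ((1 : ℝ) / 2))⁻¹) * θ.scale.det ^ (-a) := by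
      rw [Finset.prod_const, Finset.card_univ, Fintype.card_fin, ← Real.rpow_neg hdet.le,
        ← Real.rpow_natCast, ← Real.rpow_mul hdet.le, ← Real.rpow_add hdet]
      congr 1
      ring
    rw [hexp, hdetn, mul_right_comm _ (θ.scale.det ^ (-a)), ← mul_assoc, ← Finset.prod_mul_distrib,
      ← Finset.prod_mul_distrib]
    congr 1
    refine Finset.prod_congr rfl fun i _ => ?_
    rw [div_mul_eq_div_div]
    ring
  · exact Finset.prod_nonneg fun i _ => mul_nonneg (div_nonneg (hpos i) (by positivity)) (hhz i)
  · exact Finset.prod_nonneg fun i _ => mul_nonneg (mul_nonneg (div_nonneg (hpos i)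
      (by positivity)) (Real.exp_pos _).le) (hhz i)
  · exact fun i _ => mul_nonneg (div_nonneg (hpos i) (by positivity)) (hhz i)
  · exact fun i _ => mul_nonneg (mul_nonneg (div_nonneg (hpos i)
      (by positivity)) (Real.exp_pos _).le) (hhz i)

lemma obsDensity_eq {θ : Param p d} (hθ : θ ∈ stateSpace p d) (i : Fin n) (u : ℝ) :
    obsDensity X y h θ i u
      = ENNReal.ofReal ((2 * Real.pi) ^ ((d : ℝ) / 2) * θ.scale.det ^ ((1 : ℝ) / 2))⁻¹ *
        ENNReal.ofReal (u ^ ((d : ℝ) / 2) * Real.exp (-(quadForm X y θ i * u / 2)) * h u) := by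
  have hdet : 0 < θ.scale.det := Matrix.PosDef.det_pos hθ
  have hpi := Real.pi_pos
  rw [obsDensity, ← ENNReal.ofReal_mul (by positivity)]
  congr 1
  rw [show -(u / 2) * quadForm X y θ i = -(quadForm X y θ i * u / 2) by ring]
  ring

lemma lintegral_obsDensity {θ : Param p d} (hθ : θ ∈ stateSpace p d)
    (i : Fin n) :
    ∫⁻ u in Set.Ioi (0 : ℝ), obsDensity X y h θ i u
      = ENNReal.ofReal ((2 * Real.pi) ^ ((d : ℝ) / 2) * θ.scale.det ^ ((1 : ℝ) / 2))⁻¹ *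
        mixIntegral h ((d : ℝ) / 2) (quadForm X y θ i) := by
  simp_rw [obsDensity_eq hθ]
  rw [lintegral_const_mul' _ _ ENNReal.ofReal_ne_top, mixIntegral]

/-- The unnormalized posterior is the marginal over the latent weights of the joint density. -/
lemma likelihood_mul_prior_eq (hh : IsMixingDensity h) (θ : Param p d) :
    likelihood X y h θ * prior a θ
      = ∫⁻ z in posOrthant n, latentWeight d h z * paramKernel X y a θ z := by
  have hm := hh.measurable
  have hprior : prior a θ ≠ ∞ := by
    unfold prior
    split_ifs <;> simp
  have hobs : ∀ i : Fin n, Measurable (obsDensity X y h θ i) := fun i => by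
    unfold obsDensity
    fun_prop
  rw [likelihood, ← lintegral_posOrthant_prod hobs, ← lintegral_mul_const' _ _ hprior]
  exact setLIntegral_congr_fun measurableSet_posOrthant fun z hz => completeDensity_eq hh θ hz

/-- Bayes' rule for the latent weights. -/
lemma condLatent_mul_eq (hh : IsMixingDensity h) (hM : ConditionM d h) (θ : Param p d)
    {z : Fin n → ℝ} (hz : z ∈ posOrthant n) :
    condLatent X y h θ z * (likelihood X y h θ * prior a θ)
      = latentWeight d h z * paramKernel X y a θ z := by
  rw [← completeDensity_eq hh θ hz, completeDensity, ← mul_assoc]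
  by_cases hθ : θ ∈ stateSpace p d
  swap
  · simp [prior, hθ]
  congr 1
  rw [condLatent, likelihood, ← Finset.prod_mul_distrib]
  refine Finset.prod_congr rfl fun i _ => ?_
  rw [lintegral_obsDensity hθ, obsDensity_eq hθ, psi, mul_left_comm, ENNReal.div_mul_cancel
    (mixIntegral_ne_zero hh _ _) (mixIntegral_ne_top hh hM (quadForm_nonneg hθ i))]

lemma likelihood_mul_prior_ne_zero (hh : IsMixingDensity h) {θ : Param p d}
    (hθ : θ ∈ stateSpace p d) : likelihood X y h θ * prior a θ ≠ 0 := by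
  have hdet : 0 < θ.scale.det := Matrix.PosDef.det_pos hθ
  have hpi := Real.pi_pos
  refine mul_ne_zero (Finset.prod_ne_zero_iff.mpr fun i _ => ?_) ?_
  · rw [lintegral_obsDensity hθ]
    exact mul_ne_zero (ENNReal.ofReal_pos.mpr (by positivity)).ne' (mixIntegral_ne_zero hh _ _)
  · rw [prior, if_pos hθ]
    exact (ENNReal.ofReal_pos.mpr (by positivity)).ne'

lemma measurable_likelihood_mul_prior (hh : IsMixingDensity h) :
    Measurable fun θ : Param p d => likelihood X y h θ * prior a θ := by
  simp_rw [likelihood_mul_prior_eq hh]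
  have : Measurable fun t : Param p d × (Fin n → ℝ) =>
      latentWeight d h t.2 * paramKernel X y a t.1 t.2 :=
    ((measurable_latentWeight hh).comp measurable_snd).mul (measurable_paramKernel X y a)
  exact this.lintegral_prod_right'

end Latent

/-! ### Drift and minorization for the data augmentation chain -/

section Chain

variable {n p d : ℕ} {X : Matrix (Fin n) (Fin p) ℝ} {y : Matrix (Fin n) (Fin d) ℝ} {a : ℝ}
  {h : ℝ → ℝ}

variable (X y a) in
lemma measurable_paramIntegral : Measurable (paramIntegral X y a) :=
  (measurable_paramKernel X y a).lintegral_prod_left'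

variable (X y a) in
lemma measurable_paramKernel_div :
    Measurable fun t : Param p d × (Fin n → ℝ) =>
      paramKernel X y a t.1 t.2 / paramIntegral X y a t.2 :=
  (measurable_paramKernel X y a).div ((measurable_paramIntegral X y a).comp measurable_snd)

/-- The factor `latentWeight` of the joint density cancels in the conditional density of the
parameters. Where it vanishes that conditional density is `0 / 0`, but there the conditional
density of the latent weights vanishes as well. -/
lemma transDensity_eq (hh : IsMixingDensity h) (θ θ₀ : Param p d) :
    transDensity X y a h θ θ₀ = ∫⁻ z in posOrthant n,
      paramKernel X y a θ z / paramIntegral X y a z * condLatent X y h θ₀ z := by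
  refine setLIntegral_congr_fun measurableSet_posOrthant fun z hz => ?_
  simp only [condParam, completeDensity_eq hh _ hz]
  rw [lintegral_const_mul' _ _ (latentWeight_ne_top z)]
  by_cases hw : latentWeight d h z = 0
  · have hz' : ∀ i, 0 < z i := hz
    obtain ⟨i, -, hi⟩ := Finset.prod_eq_zero_iff.mp hw
    have hpi := Real.pi_pos
    have hhi : h (z i) ≤ 0 := by
      rw [ENNReal.ofReal_eq_zero] at hi
      exact nonpos_of_mul_nonpos_right hi (div_pos (Real.rpow_pos_of_pos (hz' i) _) (by positivity))
    have h0 : condLatent X y h θ₀ z = 0 := by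
      refine Finset.prod_eq_zero (Finset.mem_univ i) ?_
      rw [psi, le_antisymm hhi (hh.nonneg _ (hz' i))]
      simp
    rw [h0, mul_zero, mul_zero]
  · rw [ENNReal.mul_div_mul_left _ _ hw (latentWeight_ne_top z), paramIntegral]

lemma measurable_transDensity (hh : IsMixingDensity h) :
    Measurable fun q : Param p d × Param p d => transDensity X y a h q.1 q.2 := by
  simp_rw [transDensity_eq hh]
  have h1 : Measurable fun t : (Param p d × Param p d) × (Fin n → ℝ) =>
      paramKernel X y a t.1.1 t.2 / paramIntegral X y a t.2 :=
    (measurable_paramKernel_div X y a).comp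
      (f := fun t : (Param p d × Param p d) × (Fin n → ℝ) => (t.1.1, t.2)) (by fun_prop)
  have h2 : Measurable fun t : (Param p d × Param p d) × (Fin n → ℝ) =>
      condLatent X y h t.1.2 t.2 :=
    (measurable_condLatent hh).comp
      (f := fun t : (Param p d × Param p d) × (Fin n → ℝ) => (t.1.2, t.2)) (by fun_prop)
  exact (h1.mul h2).lintegral_prod_right'

/-- Tonelli's theorem for mixtures over `z` of the parameter kernels. -/
lemma lintegral_mul_lintegral_paramKernel {G : Param p d → ℝ≥0∞} (hG : Measurable G)
    {F : (Fin n → ℝ) → ℝ≥0∞} (hF : Measurable F) :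
    ∫⁻ θ, G θ * ∫⁻ z in posOrthant n, paramKernel X y a θ z / paramIntegral X y a z * F z
      = ∫⁻ z in posOrthant n, (∫⁻ θ, paramKernel X y a θ z * G θ) / paramIntegral X y a z * F z := by
  have h1 := measurable_paramKernel_div X y a
  have h2 : Measurable fun t : Param p d × (Fin n → ℝ) =>
      G t.1 * (paramKernel X y a t.1 t.2 / paramIntegral X y a t.2 * F t.2) :=
    (hG.comp measurable_fst).mul (h1.mul (hF.comp measurable_snd))
  have h3 : ∀ θ, G θ * ∫⁻ z in posOrthant n, paramKernel X y a θ z / paramIntegral X y a z * F z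
      = ∫⁻ z in posOrthant n, G θ * (paramKernel X y a θ z / paramIntegral X y a z * F z) :=
    fun θ => (lintegral_const_mul _ ((h1.comp (measurable_const.prodMk measurable_id)).mul hF)).symm
  simp_rw [h3]
  rw [lintegral_lintegral_swap h2.aemeasurable]
  refine lintegral_congr fun z => ?_
  have h4 : Measurable fun θ => paramKernel X y a θ z :=
    (measurable_paramKernel X y a).comp (f := fun θ : Param p d => (θ, z)) (by fun_prop)
  rw [div_eq_mul_inv, mul_assoc]
  refine Eq.trans (lintegral_congr fun θ => ?_) (lintegral_mul_const _ (h4.mul hG))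
  rw [div_eq_mul_inv]
  ring

/-- A mixture of the conditional densities of the parameters has the mass of the mixing
function. -/
lemma lintegral_lintegral_paramKernel (hU : Function.Injective (Matrix.fromCols X y).mulVec)
    (hn : (p : ℝ) + 2 * d - 2 * a < n) {F : (Fin n → ℝ) → ℝ≥0∞} (hF : Measurable F) :
    ∫⁻ θ, ∫⁻ z in posOrthant n, paramKernel X y a θ z / paramIntegral X y a z * F z
      = ∫⁻ z in posOrthant n, F z := by
  have := lintegral_mul_lintegral_paramKernel (X := X) (y := y) (a := a) (d := d)
    (G := fun _ => 1) measurable_const hF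
  simp only [one_mul, mul_one] at this
  rw [this]
  refine setLIntegral_congr_fun measurableSet_posOrthant fun z hz => ?_
  change paramIntegral X y a z / paramIntegral X y a z * F z = F z
  rw [ENNReal.div_self (paramIntegral_ne_zero hU hn hz) (paramIntegral_ne_top hU hn hz), one_mul]

lemma measurable_condLatent_right (hh : IsMixingDensity h) (θ : Param p d) :
    Measurable fun z => condLatent X y h θ z :=
  (measurable_condLatent hh).comp (f := fun z : Fin n → ℝ => (θ, z)) (by fun_prop)

lemma lintegral_transDensity (hU : Function.Injective (Matrix.fromCols X y).mulVec)
    (hn : (p : ℝ) + 2 * d - 2 * a < n) (hh : IsMixingDensity h) (hM : ConditionM d h)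
    {θ₀ : Param p d} (hθ₀ : θ₀ ∈ stateSpace p d) :
    ∫⁻ θ, transDensity X y a h θ θ₀ = 1 := by
  simp_rw [transDensity_eq hh]
  rw [lintegral_lintegral_paramKernel hU hn (measurable_condLatent_right hh θ₀),
    lintegral_condLatent hh hM hθ₀]

lemma transDensity_eq_zero (hh : IsMixingDensity h) {θ : Param p d} (hθ : θ ∉ stateSpace p d)
    (θ₀ : Param p d) : transDensity X y a h θ θ₀ = 0 := by
  rw [transDensity_eq hh]
  simp [paramKernel, hθ]

/-- The unnormalized posterior is invariant, whether or not it is integrable. -/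
lemma lintegral_transDensity_mul (hh : IsMixingDensity h) (hM : ConditionM d h)
    (hU : Function.Injective (Matrix.fromCols X y).mulVec)
    (hn : (p : ℝ) + 2 * d - 2 * a < n) (θ : Param p d) :
    ∫⁻ θ₀, transDensity X y a h θ θ₀ * (likelihood X y h θ₀ * prior a θ₀)
      = likelihood X y h θ * prior a θ := by
  have h1 := measurable_paramKernel_div X y a
  have h2 := measurable_condLatent (X := X) (y := y) hh
  have hg := measurable_likelihood_mul_prior (X := X) (y := y) (a := a) hh
  have h1z : Measurable fun z => paramKernel X y a θ z / paramIntegral X y a z :=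
    h1.comp (f := fun z : Fin n → ℝ => (θ, z)) (by fun_prop)
  have h3 : ∀ θ₀, transDensity X y a h θ θ₀ * (likelihood X y h θ₀ * prior a θ₀)
      = ∫⁻ z in posOrthant n, paramKernel X y a θ z / paramIntegral X y a z *
          (latentWeight d h z * paramKernel X y a θ₀ z) := fun θ₀ => by
    have hc := measurable_condLatent_right (X := X) (y := y) hh θ₀
    rw [transDensity_eq hh, ← lintegral_mul_const _ (by fun_prop)]
    refine setLIntegral_congr_fun measurableSet_posOrthant fun z hz => ?_
    rw [mul_assoc, condLatent_mul_eq hh hM θ₀ hz]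
  simp_rw [h3]
  have h4 : Measurable fun t : Param p d × (Fin n → ℝ) =>
      paramKernel X y a θ t.2 / paramIntegral X y a t.2 *
          (latentWeight d h t.2 * paramKernel X y a t.1 t.2) :=
    (h1z.comp measurable_snd).mul
      (((measurable_latentWeight hh).comp measurable_snd).mul (measurable_paramKernel X y a))
  rw [lintegral_lintegral_swap h4.aemeasurable, likelihood_mul_prior_eq hh]
  refine setLIntegral_congr_fun measurableSet_posOrthant fun z hz => ?_
  have h5 : Measurable fun θ => paramKernel X y a θ z :=
    (measurable_paramKernel X y a).comp (f := fun θ : Param p d => (θ, z)) (by fun_prop)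
  rw [lintegral_const_mul _ (by fun_prop), lintegral_const_mul _ h5]
  change paramKernel X y a θ z / paramIntegral X y a z *
    (latentWeight d h z * paramIntegral X y a z) = _
  rw [mul_left_comm, ENNReal.div_mul_cancel (paramIntegral_ne_zero hU hn hz)
    (paramIntegral_ne_top hU hn hz)]

variable (X y) in
open Classical in
/-- The drift function: the sum of the squared Mahalanobis residuals, and `∞` outside the state
space. -/
noncomputable def driftFun (θ : Param p d) : ℝ≥0∞ :=
  if θ ∈ stateSpace p d then ∑ i, ENNReal.ofReal (quadForm X y θ i) else ∞

lemma measurable_driftFun : Measurable (driftFun (d := d) X y) := by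
  have := measurable_quadForm (d := d) X y
  exact Measurable.ite measurableSet_stateSpace (by fun_prop) measurable_const

lemma driftFun_ne_top_iff {θ : Param p d} : driftFun X y θ ≠ ∞ ↔ θ ∈ stateSpace p d := by
  by_cases hθ : θ ∈ stateSpace p d <;> simp [driftFun, hθ]

lemma mem_stateSpace_of_driftFun_le {θ : Param p d} {R : ℝ≥0} (hR : driftFun X y θ ≤ R) :
    θ ∈ stateSpace p d :=
  driftFun_ne_top_iff.mp (ne_top_of_le_ne_top ENNReal.coe_ne_top hR)

lemma sum_quadForm_le {θ : Param p d} {R : ℝ≥0} (hR : driftFun X y θ ≤ R) :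
    ∑ i, quadForm X y θ i ≤ R := by
  have hθ := mem_stateSpace_of_driftFun_le hR
  rw [driftFun, if_pos hθ, ← ENNReal.ofReal_sum_of_nonneg fun i _ => quadForm_nonneg hθ i,
    ← ENNReal.ofReal_coe_nnreal] at hR
  exact (ENNReal.ofReal_le_ofReal_iff R.2).mp hR

lemma quadForm_le {θ : Param p d} {R : ℝ≥0} (hR : driftFun X y θ ≤ R) (i : Fin n) :
    quadForm X y θ i ≤ R :=
  (Finset.single_le_sum (fun j _ => quadForm_nonneg (mem_stateSpace_of_driftFun_le hR) j)
    (Finset.mem_univ i)).trans (sum_quadForm_le hR)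

/-- Given `z`, the conditional mean of `r_i` is at most `(n - p + 2 a - 1) / z_i`. -/
lemma lintegral_driftFun_mul_paramKernel_le (hd : 0 < d)
    (hU : Function.Injective (Matrix.fromCols X y).mulVec)
    (hn : (p : ℝ) + 2 * d - 2 * a < n) {z : Fin n → ℝ} (hz : z ∈ posOrthant n) :
    (∫⁻ θ, paramKernel X y a θ z * driftFun X y θ) / paramIntegral X y a z
      ≤ ENNReal.ofReal (n - p + 2 * a - 1) * ∑ i, ENNReal.ofReal (z i)⁻¹ := by
  have hz' : ∀ i, 0 < z i := hz
  have hk : Measurable fun θ => paramKernel X y a θ z :=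
    (measurable_paramKernel X y a).comp (f := fun θ : Param p d => (θ, z)) (by fun_prop)
  have hq := measurable_quadForm (d := d) X y
  have h1 : ∀ θ, paramKernel X y a θ z * driftFun X y θ = ∑ i, ENNReal.ofReal (z i)⁻¹ *
      (paramKernel X y a θ z * ENNReal.ofReal (z i * quadForm X y θ i)) := fun θ => by
    by_cases hθ : θ ∈ stateSpace p d
    swap
    · simp [paramKernel, hθ]
    rw [driftFun, if_pos hθ, Finset.mul_sum]
    refine Finset.sum_congr rfl fun i _ => ?_
    rw [mul_left_comm, ← ENNReal.ofReal_mul (by have := hz' i; positivity),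
      inv_mul_cancel_left₀ (hz' i).ne']
  simp_rw [h1]
  rw [lintegral_finsetSum _ fun i _ => by fun_prop]
  refine ENNReal.div_le_of_le_mul ?_
  rw [Finset.mul_sum, Finset.sum_mul]
  refine Finset.sum_le_sum fun i _ => ?_
  rw [lintegral_const_mul _ (by fun_prop), mul_comm (ENNReal.ofReal _) (ENNReal.ofReal (z i)⁻¹),
    mul_assoc]
  gcongr
  exact lintegral_paramKernel_mul_quadForm_le hd hU hn hz' i

/-- The drift condition. -/
lemma lintegral_driftFun_mul_transDensity_le (hd : 0 < d)
    (hU : Function.Injective (Matrix.fromCols X y).mulVec)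
    (hn : (p : ℝ) + 2 * d - 2 * a < n) (hh : IsMixingDensity h) (hM : ConditionM d h)
    {lam L : ℝ} (hlam : 0 ≤ lam)
    (hkey : ∀ s : ℝ, 0 ≤ s →
      mixIntegral h (((d : ℝ) - 2) / 2) s / mixIntegral h ((d : ℝ) / 2) s
        ≤ ENNReal.ofReal (lam * s + L)) {θ₀ : Param p d} (hθ₀ : θ₀ ∈ stateSpace p d) :
    ∫⁻ θ, driftFun X y θ * transDensity X y a h θ θ₀
      ≤ ENNReal.ofReal (n - p + 2 * a - 1) *
        (ENNReal.ofReal lam * driftFun X y θ₀ + n * ENNReal.ofReal L) := by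
  simp_rw [transDensity_eq hh]
  have hc := measurable_condLatent_right (X := X) (y := y) hh θ₀
  rw [lintegral_mul_lintegral_paramKernel measurable_driftFun hc]
  calc _ ≤ ∫⁻ z in posOrthant n, ENNReal.ofReal (n - p + 2 * a - 1) *
        ∑ i, ENNReal.ofReal (z i)⁻¹ * condLatent X y h θ₀ z :=
        setLIntegral_mono' measurableSet_posOrthant fun z hz => by
          rw [← Finset.sum_mul, ← mul_assoc]
          gcongr
          exact lintegral_driftFun_mul_paramKernel_le hd hU hn hz
    _ ≤ _ := by
        rw [lintegral_const_mul _ (by fun_prop), lintegral_finsetSum _ fun i _ => by fun_prop,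
          driftFun, if_pos hθ₀]
        refine mul_le_mul_right ?_ _
        have hcard : (n : ℝ≥0∞) * ENNReal.ofReal L = ∑ _i : Fin n, ENNReal.ofReal L := by simp
        rw [hcard, Finset.mul_sum, ← Finset.sum_add_distrib]
        refine Finset.sum_le_sum fun i _ => ?_
        rw [lintegral_inv_mul_condLatent hh hM hθ₀, ← ENNReal.ofReal_mul hlam]
        exact (hkey _ (quadForm_nonneg hθ₀ i)).trans ENNReal.ofReal_add_le

/-- The minorization condition on the sublevel sets of the drift function: the conditional density
of each latent weight, given `r ≤ R`, is bounded below by a fixed function of positive mass. -/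
lemma exists_le_transDensity (hU : Function.Injective (Matrix.fromCols X y).mulVec)
    (hn : (p : ℝ) + 2 * d - 2 * a < n) (hh : IsMixingDensity h) (hM : ConditionM d h) (R : ℝ≥0) :
    ∃ ν : Param p d → ℝ≥0∞, Measurable ν ∧ ∫⁻ θ, ν θ ≠ 0 ∧
      ∀ θ₀, driftFun X y θ₀ ≤ R → ∀ θ, ν θ ≤ transDensity X y a h θ θ₀ := by
  have hm := hh.measurable
  obtain ⟨φ, hφ⟩ : ∃ φ : ℝ → ℝ≥0∞, φ = fun u =>
      ENNReal.ofReal (u ^ ((d : ℝ) / 2) * Real.exp (-(R * u / 2)) * h u) /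
        mixIntegral h ((d : ℝ) / 2) 0 := ⟨_, rfl⟩
  have hφm : Measurable φ := by rw [hφ]; fun_prop
  have hFm : Measurable fun z : Fin n → ℝ => ∏ i, φ (z i) := by fun_prop
  have h1 := measurable_paramKernel_div X y a
  have h2 : Measurable fun t : Param p d × (Fin n → ℝ) =>
      paramKernel X y a t.1 t.2 / paramIntegral X y a t.2 * ∏ i, φ (t.2 i) :=
    h1.mul (hFm.comp measurable_snd)
  refine ⟨fun θ => ∫⁻ z in posOrthant n,
    paramKernel X y a θ z / paramIntegral X y a z * ∏ i, φ (z i),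
    h2.lintegral_prod_right', ?_, fun θ₀ hθ₀ θ => ?_⟩
  · rw [lintegral_lintegral_paramKernel hU hn hFm, lintegral_posOrthant_prod fun _ => hφm]
    refine Finset.prod_ne_zero_iff.mpr fun i _ => ?_
    simp only [hφ, div_eq_mul_inv]
    rw [lintegral_mul_const _ (by fun_prop)]
    refine mul_ne_zero (mixIntegral_ne_zero hh _ _) (ENNReal.inv_ne_zero.mpr ?_)
    exact mixIntegral_ne_top hh hM le_rfl
  · rw [transDensity_eq hh]
    have hmem := mem_stateSpace_of_driftFun_le hθ₀
    refine setLIntegral_mono' measurableSet_posOrthant fun z hz => ?_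
    have hz' : ∀ i, 0 < z i := hz
    gcongr
    refine Finset.prod_le_prod' fun i _ => ?_
    have hhi := hh.nonneg _ (hz' i)
    have hzi := hz' i
    have hq := quadForm_le hθ₀ i
    have hq0 := quadForm_nonneg (X := X) (y := y) hmem i
    simp only [hφ, psi]
    refine ENNReal.div_le_div (ENNReal.ofReal_le_ofReal ?_) (mixIntegral_anti hh _ hq0)
    gcongr

/-- The unnormalized posterior is integrable over the sublevel sets of the drift function: there
it is bounded by a multiple of the parameter kernel for unit latent weights. -/
lemma setLIntegral_likelihood_mul_prior_ne_top
    (hU : Function.Injective (Matrix.fromCols X y).mulVec)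
    (hn : (p : ℝ) + 2 * d - 2 * a < n) (hh : IsMixingDensity h) (hM : ConditionM d h) (R : ℝ≥0) :
    ∫⁻ θ in {θ : Param p d | driftFun X y θ ≤ R}, likelihood X y h θ * prior a θ ≠ ∞ := by
  obtain ⟨C, hC⟩ : ∃ C : ℝ≥0∞, C = ENNReal.ofReal (Real.exp (R / 2)) *
      ∏ _i : Fin n, (ENNReal.ofReal ((2 * Real.pi) ^ ((d : ℝ) / 2))⁻¹ *
        mixIntegral h ((d : ℝ) / 2) 0) := ⟨_, rfl⟩
  have hC_top : C ≠ ∞ := by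
    rw [hC]
    exact ENNReal.mul_ne_top ENNReal.ofReal_ne_top (ENNReal.prod_ne_top fun i _ =>
      ENNReal.mul_ne_top ENNReal.ofReal_ne_top (mixIntegral_ne_top hh hM le_rfl))
  have hset : MeasurableSet {θ : Param p d | driftFun X y θ ≤ R} :=
    measurableSet_le measurable_driftFun measurable_const
  have hk : Measurable fun θ : Param p d => paramKernel X y a θ fun _ => 1 :=
    (measurable_paramKernel X y a).comp (f := fun θ : Param p d => (θ, fun _ => (1 : ℝ)))
      (by fun_prop)
  have hle : ∫⁻ θ in {θ : Param p d | driftFun X y θ ≤ R}, likelihood X y h θ * prior a θ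
      ≤ C * paramIntegral X y a fun _ => 1 := by
    rw [paramIntegral, ← lintegral_const_mul _ hk]
    refine (setLIntegral_mono' hset fun θ hθ => ?_).trans (setLIntegral_le_lintegral _ _)
    have hmem := mem_stateSpace_of_driftFun_le hθ
    have hdet : 0 < θ.scale.det := Matrix.PosDef.det_pos hmem
    have hpi := Real.pi_pos
    have hsum := sum_quadForm_le hθ
    have hlik : likelihood X y h θ ≤
        (∏ _i : Fin n, (ENNReal.ofReal ((2 * Real.pi) ^ ((d : ℝ) / 2))⁻¹ *
          mixIntegral h ((d : ℝ) / 2) 0)) *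
          ENNReal.ofReal (θ.scale.det ^ (-((n : ℝ) / 2))) := by
      have hdetn : ENNReal.ofReal (θ.scale.det ^ (-((n : ℝ) / 2)))
          = ∏ _i : Fin n, ENNReal.ofReal (θ.scale.det ^ ((1 : ℝ) / 2))⁻¹ := by
        rw [← ENNReal.ofReal_prod_of_nonneg fun _ _ => by positivity, Finset.prod_const,
          Finset.card_univ, Fintype.card_fin, ← Real.rpow_neg hdet.le, ← Real.rpow_natCast,
          ← Real.rpow_mul hdet.le]
        congr 2
        ring
      rw [hdetn, ← Finset.prod_mul_distrib, likelihood]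
      refine Finset.prod_le_prod' fun i _ => ?_
      rw [lintegral_obsDensity hmem, mul_inv, ENNReal.ofReal_mul (by positivity), mul_right_comm]
      gcongr
      exact mixIntegral_anti hh _ (quadForm_nonneg hmem i)
    have hker : ENNReal.ofReal (θ.scale.det ^ (-((n : ℝ) / 2))) * prior a θ
        ≤ ENNReal.ofReal (Real.exp (R / 2)) * paramKernel X y a θ fun _ => 1 := by
      rw [prior, if_pos hmem, paramKernel, if_pos hmem, ← ENNReal.ofReal_mul (by positivity),
        ← ENNReal.ofReal_mul (by positivity)]
      refine ENNReal.ofReal_le_ofReal ?_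
      rw [← Real.rpow_add hdet, mul_left_comm, ← Real.exp_add, neg_add]
      refine le_mul_of_one_le_right (by positivity) (Real.one_le_exp ?_)
      simp only [one_mul]
      linarith
    calc likelihood X y h θ * prior a θ ≤ _ := mul_le_mul_left hlik _
      _ = (∏ _i : Fin n, (ENNReal.ofReal ((2 * Real.pi) ^ ((d : ℝ) / 2))⁻¹ *
          mixIntegral h ((d : ℝ) / 2) 0)) *
          (ENNReal.ofReal (θ.scale.det ^ (-((n : ℝ) / 2))) * prior a θ) := mul_assoc _ _ _
      _ ≤ _ := mul_le_mul_right hker _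
      _ = _ := by rw [hC, mul_left_comm, mul_assoc]
  refine ne_top_of_le_ne_top (ENNReal.mul_ne_top hC_top ?_) hle
  exact paramIntegral_ne_top hU hn fun _ => one_pos

lemma marginal_ne_zero (hU : Function.Injective (Matrix.fromCols X y).mulVec)
    (hn : (p : ℝ) + 2 * d - 2 * a < n) (hh : IsMixingDensity h) : marginal X y a h ≠ 0 := by
  intro h0
  rw [marginal, lintegral_eq_zero_iff (measurable_likelihood_mul_prior hh)] at h0
  refine paramIntegral_ne_zero hU hn (z := fun _ => 1) (fun _ => one_pos) ?_
  rw [paramIntegral]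
  refine (lintegral_congr_ae ?_).trans lintegral_zero
  filter_upwards [h0] with θ hθ
  refine if_neg fun hmem => ?_
  exact likelihood_mul_prior_ne_zero hh hmem hθ

end Chain

end MixtureRegression

theorem proposition1 {n p d : ℕ} (hd : 0 < d)
    (X : Matrix (Fin n) (Fin p) ℝ) (y : Matrix (Fin n) (Fin d) ℝ) (a : ℝ) (h : ℝ → ℝ)
    (hrank : (Matrix.fromCols X y).rank = p + d)
    (hn : (p : ℝ) + 2 * d - 2 * a < n)
    (hh : MixtureRegression.IsMixingDensity h)
    (hM : MixtureRegression.ConditionM d h)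
    (hkey : ∃ lam L : ℝ, 0 ≤ lam ∧ lam < 1 / ((n : ℝ) - p + 2 * a - 1) ∧
      ∀ s : ℝ, 0 ≤ s →
        MixtureRegression.mixIntegral h (((d : ℝ) - 2) / 2) s
            / MixtureRegression.mixIntegral h ((d : ℝ) / 2) s
          ≤ ENNReal.ofReal (lam * s + L)) :
    MixtureRegression.PosteriorProper X y a h ∧
      MixtureRegression.GeometricallyErgodic X y a h := by
  open MixtureRegression in
  obtain ⟨lam, L, hlam, hlam', hkey⟩ := hkey
  have hU := injective_mulVec_fromCols hrank
  have hd1 : (1 : ℝ) ≤ d := by exact_mod_cast hd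
  have hκ : 0 < (n : ℝ) - p + 2 * a - 1 := by linarith
  -- The rate is kept positive, so that the drift inequality is trivial where `driftFun` is `∞`.
  obtain ⟨γ, hγ⟩ : ∃ γ : ℝ≥0, γ = max (Real.toNNReal (((n : ℝ) - p + 2 * a - 1) * lam)) 2⁻¹ :=
    ⟨_, rfl⟩
  have hγ1 : γ < 1 := by
    rw [hγ, max_lt_iff]
    refine ⟨?_, by norm_num⟩
    rw [Real.toNNReal_lt_one]
    rwa [lt_div_iff₀ hκ, mul_comm] at hlam'
  have hγ0 : γ ≠ 0 := (lt_of_lt_of_le (by positivity) (hγ ▸ le_max_right _ _)).ne'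
  obtain ⟨K, hK⟩ : ∃ K : ℝ≥0, K = Real.toNNReal ((n : ℝ) - p + 2 * a - 1) * (n * Real.toNNReal L) :=
    ⟨_, rfl⟩
  have hmass : ∀ θ₀, driftFun X y θ₀ ≠ ∞ → ∫⁻ θ, transDensity X y a h θ θ₀ = 1 := fun θ₀ hθ₀ =>
    lintegral_transDensity hU hn hh hM (driftFun_ne_top_iff.mp hθ₀)
  have hdrift : ∀ θ₀, ∫⁻ θ, driftFun X y θ * transDensity X y a h θ θ₀
      ≤ γ * driftFun X y θ₀ + K := fun θ₀ => by
    by_cases hθ₀ : driftFun X y θ₀ = ∞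
    · simp [hθ₀, hγ0]
    refine (lintegral_driftFun_mul_transDensity_le hd hU hn hh hM hlam hkey
      (driftFun_ne_top_iff.mp hθ₀)).trans ?_
    rw [mul_add, ← mul_assoc, ← ENNReal.ofReal_mul hκ.le]
    refine add_le_add (mul_le_mul_left (ENNReal.coe_le_coe.mpr (hγ ▸ le_max_left _ _)) _) ?_
    rw [hK]
    simp [ENNReal.ofReal]
  have hk := measurable_transDensity (X := X) (y := y) (a := a) hh
  have hV := measurable_driftFun (d := d) (X := X) (y := y)
  have hg := measurable_likelihood_mul_prior (X := X) (y := y) (a := a) hh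
  have hproper : marginal X y a h ≠ ∞ := by
    refine lintegral_ne_top_of_drift hk hV hγ1 hmass hdrift hg (fun θ hθ => ?_)
      (lintegral_transDensity_mul hh hM hU hn)
      (setLIntegral_likelihood_mul_prior_ne_top hU hn hh hM)
    rw [driftFun_ne_top_iff]
    by_contra hmem
    exact hθ (by simp [prior, hmem])
  refine ⟨hproper.lt_top, ?_⟩
  have hne := marginal_ne_zero hU hn hh
  have hpost : Measurable fun θ => posterior X y a h θ := hg.div_const _
  have hkV : ∀ θ₀ θ, transDensity X y a h θ θ₀ ≠ 0 → driftFun X y θ ≠ ∞ := fun θ₀ θ hθ => by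
    rw [driftFun_ne_top_iff]
    by_contra hmem
    exact hθ (transDensity_eq_zero hh hmem θ₀)
  have hpostV : ∀ θ, posterior X y a h θ ≠ 0 → driftFun X y θ ≠ ∞ := fun θ hθ => by
    rw [driftFun_ne_top_iff]
    by_contra hmem
    exact hθ (by simp [posterior, prior, hmem])
  have hinv : ∀ θ, ∫⁻ θ₀, transDensity X y a h θ θ₀ * posterior X y a h θ₀
      = posterior X y a h θ := fun θ => by
    simp only [posterior, div_eq_mul_inv, ← mul_assoc]
    rw [lintegral_mul_const' _ _ (ENNReal.inv_ne_top.mpr hne)]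
    simp only [mul_assoc]
    rw [← mul_assoc, ← lintegral_transDensity_mul hh hM hU hn θ]
  have hone : ∫⁻ θ, posterior X y a h θ = 1 := by
    simp only [posterior, div_eq_mul_inv]
    rw [lintegral_mul_const' _ _ (ENNReal.inv_ne_top.mpr hne)]
    exact ENNReal.mul_inv_cancel hne hproper
  obtain ⟨M, r, hr, hM'⟩ := exists_geometric_rate hk hV hγ1 hmass hdrift
    (exists_le_transDensity hU hn hh hM) hkV hpost hpostV hinv hone
    (it := iterDensity X y a h) rfl (fun _ _ _ => rfl)
  exact ⟨M, r, hr, fun m θ₀ hθ₀ => hM' m θ₀ (driftFun_ne_top_iff.mpr hθ₀)⟩
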